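/- Let $k$ be a field and let $\mathcal A=\{H_1,\dots,H_n\}$ be a central arrangement of $n$ distinct complex hyperplanes in $\mathbb C^3$. Let $L(\mathcal A)$ be its intersection lattice, consisting of all intersections of hyperplanes of $\mathcal A$, including the empty intersection $\mathbb C^3$, ordered by reverse inclusion and ranked by codimension; let $L_2(\mathcal A)$ be the set of flats of codimension $2$, and write $\mu(X)=\mu(\mathbb C^3,X)$ for the Möbius function of $L(\mathcal A)$. Let $E$ be the exterior algebra over $k$ on generators $e_1,\dots,e_n$ of degree $1$, let $\partial$ be the differential of $E$ with $\partial(1)=0$, $\partial(e_i)=1$ satisfying the graded Leibniz rule, and let $A=E/I$ be the Orlik–Solomon algebra, where $I$ is the ideal generated by the elements $\partial(e_{i_1}\wedge\cdots\wedge e_{i_r})$ for which $\operatorname{codim}(H_{i_1}\cap\cdots\cap H_{i_r})<r$ (with $i_1<\cdots<i_r$). Then $A$ has a minimal graded free resolution $\cdots\to F_1\to F_0\to A\to 0$ by finitely generated graded free $E$-modules $F_i=\bigoplus_j E(-j)^{b'_{ij}}$. The exponents $b'_{ij}=\dim_k\operatorname{Tor}^E_i(A,k)_j$ are the graded Betti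 numbers of $A$ over $E$. Suppose that $\mathcal A$ is a minimal linear strand (MLS) arrangement, that is, $$b'_{23}=2\sum_{X\in L_2(\mathcal A)}\binom{\mu(X)+1}{3}.$$ Then, for every minimal graded free resolution of $A$ over $E$, the graded Betti numbers are as follows. For all $i\ge 1$, $$b'_{i,i+1}=i\sum_{X\in L_2(\mathcal A)}\binom{\mu(X)+i-1}{i+1},$$ $$b'_{i,i+2}=b'_{i+1,i+2}+\binom{i+1}{2}\binom{n+i-2}{i+2}-\binom{n+i-2}{i}\sum_{X\in L_2(\mathcal A)}\binom{\mu(X)}{2}.$$ Moreover $b'_{0,0}=1$, $b'_{0,j}=0$ for $j\ne 0$, and $b'_{i,j}=0$ whenever $i\ge 1$ and $j\notin\{i+1,i+2\}$. (Here $\binom{m}{r}=0$ for integers $m<r$ with $r\geq 0$.) -/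

import Mathlib

open scoped BigOperators

noncomputable section

/-- A central arrangement of `n` (distinct, labelled) complex hyperplanes in `ℂ^ℓ`. -/
structure CentralArrangement (n ℓ : ℕ) where
  hyperplane : Fin n → Submodule ℂ (Fin ℓ → ℂ)
  codim_one : ∀ i, Module.finrank ℂ ((Fin ℓ → ℂ) ⧸ hyperplane i) = 1
  injective : Function.Injective hyperplane

namespace CentralArrangement

variable {n ℓ : ℕ} (A : CentralArrangement n ℓ)

/-- The intersection of the hyperplanes with labels in `B`; it is `ℂ^ℓ` for `B = ∅`. -/
def inter (B : Finset (Fin n)) : Submodule ℂ (Fin ℓ → ℂ) := ⨅ i ∈ B, A.hyperplane i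

/-- Codimension of a linear subspace of `ℂ^ℓ`. -/
def codim (X : Submodule ℂ (Fin ℓ → ℂ)) : ℕ := Module.finrank ℂ ((Fin ℓ → ℂ) ⧸ X)

/-- The intersection lattice: all intersections of hyperplanes of the arrangement, ordered by
reverse inclusion (`OrderDual`). -/
abbrev Lattice : Type :=
  {X : (Submodule ℂ (Fin ℓ → ℂ))ᵒᵈ // ∃ B : Finset (Fin n), X = OrderDual.toDual (A.inter B)}

/-- The flat cut out by the hyperplanes with labels in `B`. -/
def flat (B : Finset (Fin n)) : A.Lattice := ⟨OrderDual.toDual (A.inter B), B, rfl⟩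

theorem flat_surjective : Function.Surjective A.flat := by
  rintro ⟨X, B, rfl⟩
  exact ⟨B, rfl⟩

instance : Fintype A.Lattice :=
  haveI : Finite A.Lattice := Finite.of_surjective A.flat A.flat_surjective
  Fintype.ofFinite _

instance : DecidableEq A.Lattice := Classical.decEq _

instance : DecidableLE A.Lattice := Classical.decRel _

instance : DecidableLT A.Lattice := Classical.decRel _

instance : LocallyFiniteOrder A.Lattice := Fintype.toLocallyFiniteOrder

/-- The Möbius function `μ(X) = μ(ℂ^ℓ, X)` of the intersection lattice; `ℂ^ℓ = A.flat ∅` is its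
least element. -/
def mobius (X : A.Lattice) : ℤ := IncidenceAlgebra.mu ℤ (A.flat ∅) X

/-- The flats of rank two, the rank being the codimension. -/
def rankTwo : Finset A.Lattice :=
  Finset.univ.filter fun X => codim (OrderDual.ofDual X.1) = 2

end CentralArrangement

section Exterior

variable (k : Type*) [Field k] (n : ℕ)

/-- The exterior algebra over `k` on `n` generators of degree one. Its homogeneous component of
degree `j` is `⋀[k]^j (Fin n → k)`. -/
abbrev ExtAlg : Type _ := ExteriorAlgebra k (Fin n → k)

namespace ExtAlg

/-- The generator `e_i`. -/
def gen (i : Fin n) : ExtAlg k n := ExteriorAlgebra.ι k (Pi.single i 1)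

/-- `e_B = e_{i_1} ∧ ⋯ ∧ e_{i_r}` for `B = {i_1 < ⋯ < i_r}`. -/
def monomial (B : Finset (Fin n)) : ExtAlg k n :=
  ((B.sort (· ≤ ·)).map (gen k n)).prod

/-- The linear form on the span of the generators taking the value `1` on each `e_i`. -/
def sumForm : Module.Dual k (Fin n → k) := ∑ i, LinearMap.proj i

/-- The differential `∂`: the antiderivation with `∂ 1 = 0` and `∂ e_i = 1`. -/
def boundary : ExtAlg k n →ₗ[k] ExtAlg k n :=
  CliffordAlgebra.contractLeft (Q := (0 : QuadraticForm k (Fin n → k))) (sumForm k n)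

theorem boundary_one : boundary k n 1 = 0 :=
  CliffordAlgebra.contractLeft_one _ _

theorem boundary_gen_mul (i : Fin n) (x : ExtAlg k n) :
    boundary k n (gen k n i * x) = x - gen k n i * boundary k n x := by
  have h := CliffordAlgebra.contractLeft_ι_mul (Q := (0 : QuadraticForm k (Fin n → k)))
    (sumForm k n) (Pi.single i 1) x
  have h1 : sumForm k n (Pi.single i 1) = 1 := by simp [sumForm]
  rw [h1, one_smul] at h
  exact h

end ExtAlg

end Exterior

section Resolution

variable (k : Type*) [Field k] (n : ℕ)

/-- The homogeneous component of degree `j` of the graded free `E`-module with basis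
`(u_t)_{t < r}`, where `u_t` has degree `deg t`. -/
def freeComponent {r : ℕ} (deg : Fin r → ℕ) (j : ℕ) : Set (Fin r → ExtAlg k n) :=
  {x | ∀ t, (deg t ≤ j → x t ∈ ⋀[k]^(j - deg t) (Fin n → k)) ∧ (j < deg t → x t = 0)}

/-- A minimal graded resolution of the graded left `E`-module `N`, with homogeneous components
`𝒩 j`, by finitely generated graded free `E`-modules `F_i = ⨁_{t < rank i} E(-deg i t)`. All maps
preserve degrees; minimality says that the differentials have entries in the augmentation ideal. -/
structure MinimalFreeResolution (N : Type*) [AddCommGroup N] [Module k N] [Module (ExtAlg k n) N]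
    (𝒩 : ℕ → Submodule k N) where
  rank : ℕ → ℕ
  deg : ∀ i, Fin (rank i) → ℕ
  d : ∀ i, (Fin (rank (i + 1)) → ExtAlg k n) →ₗ[ExtAlg k n] (Fin (rank i) → ExtAlg k n)
  aug : (Fin (rank 0) → ExtAlg k n) →ₗ[ExtAlg k n] N
  d_homogeneous : ∀ i j, ∀ x ∈ freeComponent k n (deg (i + 1)) j,
    d i x ∈ freeComponent k n (deg i) j
  aug_homogeneous : ∀ j, ∀ x ∈ freeComponent k n (deg 0) j, aug x ∈ 𝒩 j
  aug_surjective : Function.Surjective aug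
  exact_aug : Function.Exact (d 0) aug
  exact_d : ∀ i, Function.Exact (d (i + 1)) (d i)
  minimal : ∀ i x t, ExteriorAlgebra.algebraMapInv (d i x t) = 0

/-- The graded Betti number of a minimal free resolution: the number of basis elements of degree
`j` in `F_i`, that is, the exponent of `E(-j)` in `F_i`, which is `dim_k Tor_i^E(N, k)_j`. -/
def MinimalFreeResolution.betti {k : Type*} [Field k] {n : ℕ} {N : Type*} [AddCommGroup N]
    [Module k N] [Module (ExtAlg k n) N] {𝒩 : ℕ → Submodule k N}
    (F : MinimalFreeResolution k n N 𝒩) (i j : ℕ) : ℕ :=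
  (Finset.univ.filter fun t : Fin (F.rank i) => F.deg i t = j).card

end Resolution

namespace CentralArrangement

variable {n ℓ : ℕ} (A : CentralArrangement n ℓ) (k : Type*) [Field k]

/-- The Orlik–Solomon ideal, generated by the `∂ e_B` with `B` dependent. It is spanned, as a left
ideal, by the products `∂ e_B * y`, so that it is the two-sided ideal on these generators. -/
def osIdeal : Ideal (ExtAlg k n) :=
  Ideal.span {x | ∃ (B : Finset (Fin n)) (y : ExtAlg k n), codim (A.inter B) < B.card ∧
    x = ExtAlg.boundary k n (ExtAlg.monomial k n B) * y}

instance osIdeal_isTwoSided : (A.osIdeal k).IsTwoSided := by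
  refine ⟨fun {a} b ha => ?_⟩
  refine Submodule.span_induction (p := fun a _ => a * b ∈ A.osIdeal k) ?_ ?_ ?_ ?_ ha
  · rintro x ⟨B, y, hB, rfl⟩
    exact Submodule.subset_span ⟨B, y * b, hB, mul_assoc _ _ _⟩
  · simp
  · intro x y _ _ hx hy
    rw [add_mul]
    exact (A.osIdeal k).add_mem hx hy
  · intro r x _ hx
    rw [smul_eq_mul, mul_assoc]
    exact (A.osIdeal k).mul_mem_left r hx

/-- The Orlik–Solomon algebra `A = E / I`, a left `E`-module. -/
abbrev OSAlgebra : Type _ := ExtAlg k n ⧸ A.osIdeal k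

/-- The grading of the Orlik–Solomon algebra inherited from `E`. -/
def osGrading (j : ℕ) : Submodule k (A.OSAlgebra k) :=
  (⋀[k]^j (Fin n → k)).map ((A.osIdeal k).mkQ.restrictScalars k)

/-- Minimal graded free resolutions of the Orlik–Solomon algebra over the exterior algebra. -/
abbrev OSResolution : Type _ := MinimalFreeResolution k n (A.OSAlgebra k) (A.osGrading k)

/-- `A` is a minimal linear strand (MLS) arrangement (over `k`):
`b'_{23} = 2 ∑_X binom(μ(X) + 1, 3)`, the sum being over the flats of rank two. The graded Betti
number `b'_{23}` is the same for all minimal resolutions. -/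
def IsMLS : Prop :=
  ∃ F : A.OSResolution k,
    (F.betti 2 3 : ℤ) = 2 * ∑ X ∈ A.rankTwo, Ring.choose (A.mobius X + 1) 3

end CentralArrangement

end

/-!
The graded Betti numbers of a graded `E`-module `N` are computed by the Cartan complex, whose
`p`-chains are the families of elements of `N` indexed by the multi-indices of degree `p` and whose
differential is `(δ x)(β) = ∑ e_a x(β + δ_a)`. The comparison with a given minimal resolution `F` is
made by dimension shifting along `F` itself (`CartanExact.ker`, `finrank_cycles_ker`), since free
modules are acyclic for the Cartan complex in positive degrees (`exists_cartanD_eq`).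

*Shape of the resolution.* The ideal `I` starts in degree two, so that `F_i` has generators in degrees
at least `i + 1` for `i ≥ 1` (`le_deg`). The boundary map descends to `A`, which vanishes in degrees
above three, and each `e_a` inverts it in degree three; this makes the Cartan complex of `A` exact in
internal degrees above two (`cartanExact_quotGrading`), so that `F_i` has generators in degrees at
most `i + 2` (`deg_le`).

*Linear strand.* By dimension shifting, `b'_{i,i+1}` is the dimension of the cycles of degree `i - 1`
with values in the quadratic part `I_2` (`betti_linear`). That part is the direct sum, over the flats
`X` of rank two, of the exterior squares of the spaces spanned by the differences of the `e_a` with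
`H_a ⊇ X` (`idealGr_two`, `sumIndep_localSquare`); such a space has dimension `μ(X)`, and the cycles
with values in the exterior square of an `m`-dimensional space can be counted in `m` variables
(`finrank_cycles_extSquare`). The MLS condition says that the cycles of degree one split along this
direct sum. Slicing a cycle at a multi-index reduces any degree to degree one, hence all cycles split
(`cycles_iSup_eq`).

*Second strand.* The Hilbert series of `I` is determined by `n` and `dim I_2`, because the boundary
complexes of `I` and `E` are exact (`finrank_idealGr_three`). Dividing it by `(1 + t) ^ n` gives the
alternating sums of the Betti numbers (`betti_sub_betti`), and as there are only two strands these
sums are single differences.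

Existence of a minimal resolution follows by repeatedly choosing an irredundant finite set of
homogeneous generators (`exists_minimal_cover`).
-/

open scoped BigOperators

noncomputable section

/-! ### Contractions and the augmentation on the exterior algebra -/

namespace ExtAlg

open ExteriorAlgebra

variable {k : Type*} [Field k] {n : ℕ}

/-- Left contraction of the exterior algebra by a linear form: the antiderivation extending it. -/
def contract (ℓ : Module.Dual k (Fin n → k)) : ExtAlg k n →ₗ[k] ExtAlg k n :=
  CliffordAlgebra.contractLeft (Q := (0 : QuadraticForm k (Fin n → k))) ℓ

theorem contract_ι_mul (ℓ : Module.Dual k (Fin n → k)) (v : Fin n → k) (x : ExtAlg k n) :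
    contract ℓ (ι k v * x) = ℓ v • x - ι k v * contract ℓ x :=
  CliffordAlgebra.contractLeft_ι_mul (Q := (0 : QuadraticForm k (Fin n → k))) ℓ v x

theorem contract_algebraMap (ℓ : Module.Dual k (Fin n → k)) (c : k) :
    contract ℓ (algebraMap k _ c) = 0 :=
  CliffordAlgebra.contractLeft_algebraMap (Q := (0 : QuadraticForm k (Fin n → k))) ℓ c

/-- Contraction by the `a`-th coordinate form. -/
def partialD (a : Fin n) : ExtAlg k n →ₗ[k] ExtAlg k n := contract (LinearMap.proj a)

theorem partialD_gen_mul (a b : Fin n) (x : ExtAlg k n) :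
    partialD a (gen k n b * x) = (if a = b then x else 0) - gen k n b * partialD a x := by
  rw [partialD, gen, contract_ι_mul]
  congr 1
  by_cases h : a = b
  · subst h; simp
  · simp [h]

theorem gen_mul_self (a : Fin n) : gen k n a * gen k n a = 0 := ExteriorAlgebra.ι_sq_zero _

theorem gen_mul_swap (a b : Fin n) : gen k n a * gen k n b = -(gen k n b * gen k n a) :=
  eq_neg_of_add_eq_zero_left (ExteriorAlgebra.ι_add_mul_swap _ _)

theorem ι_eq_sum (v : Fin n → k) : ι k v = ∑ a, v a • gen k n a := by
  conv_lhs => rw [pi_eq_sum_univ' v]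
  simp only [map_sum, gen, map_smul]

theorem ι_mem_one (v : Fin n → k) : ι k v ∈ ⋀[k]^1 (Fin n → k) := by
  rw [exteriorPower, pow_one]
  exact LinearMap.mem_range_self _ v

theorem gen_mem_one (a : Fin n) : gen k n a ∈ ⋀[k]^1 (Fin n → k) := ι_mem_one _

theorem mul_mem_power {i j : ℕ} {x y : ExtAlg k n} (hx : x ∈ ⋀[k]^i (Fin n → k))
    (hy : y ∈ ⋀[k]^j (Fin n → k)) : x * y ∈ ⋀[k]^(i + j) (Fin n → k) :=
  SetLike.mul_mem_graded (A := fun i : ℕ => ⋀[k]^i (Fin n → k)) hx hy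

theorem gen_mul_mem {d : ℕ} (a : Fin n) {x : ExtAlg k n} (hx : x ∈ ⋀[k]^d (Fin n → k)) :
    gen k n a * x ∈ ⋀[k]^(d + 1) (Fin n → k) := by
  rw [add_comm]
  exact mul_mem_power (gen_mem_one a) hx

theorem mem_power_zero {x : ExtAlg k n} :
    x ∈ ⋀[k]^0 (Fin n → k) ↔ ∃ c, x = algebraMap k _ c := by
  rw [exteriorPower, pow_zero, Submodule.mem_one]
  exact ⟨fun ⟨c, h⟩ => ⟨c, h.symm⟩, fun ⟨c, h⟩ => ⟨c, h.symm⟩⟩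

theorem algebraMap_mem_zero (c : k) : algebraMap k (ExtAlg k n) c ∈ ⋀[k]^0 (Fin n → k) :=
  mem_power_zero.2 ⟨c, rfl⟩

theorem exists_gen_mul_of_mem_succ {d : ℕ} {x : ExtAlg k n}
    (hx : x ∈ ⋀[k]^(d + 1) (Fin n → k)) :
    ∃ y : Fin n → ExtAlg k n, (∀ a, y a ∈ ⋀[k]^d (Fin n → k)) ∧ x = ∑ a, gen k n a * y a := by
  rw [exteriorPower, pow_succ'] at hx
  induction hx using Submodule.mul_induction_on' with
  | mem_mul_mem m hm z hz =>
    obtain ⟨v, rfl⟩ := hm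
    refine ⟨fun a => v a • z, fun a => Submodule.smul_mem _ _ hz, ?_⟩
    rw [ι_eq_sum, Finset.sum_mul]
    refine Finset.sum_congr rfl fun a _ => ?_
    rw [smul_mul_assoc, mul_smul_comm]
  | add x _ y _ hx hy =>
    obtain ⟨u, hu, rfl⟩ := hx
    obtain ⟨w, hw, rfl⟩ := hy
    refine ⟨u + w, fun a => Submodule.add_mem _ (hu a) (hw a), ?_⟩
    simp [mul_add, Finset.sum_add_distrib]

theorem contract_mem {d : ℕ} (ℓ : Module.Dual k (Fin n → k)) {x : ExtAlg k n}
    (hx : x ∈ ⋀[k]^(d + 1) (Fin n → k)) : contract ℓ x ∈ ⋀[k]^d (Fin n → k) := by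
  induction d generalizing x with
  | zero =>
    obtain ⟨y, hy, rfl⟩ := exists_gen_mul_of_mem_succ hx
    rw [map_sum]
    refine Submodule.sum_mem _ fun a _ => ?_
    obtain ⟨c, hc⟩ := mem_power_zero.1 (hy a)
    rw [gen, contract_ι_mul, hc, contract_algebraMap, mul_zero, sub_zero]
    exact Submodule.smul_mem _ _ (algebraMap_mem_zero c)
  | succ d ih =>
    obtain ⟨y, hy, rfl⟩ := exists_gen_mul_of_mem_succ hx
    rw [map_sum]
    refine Submodule.sum_mem _ fun a _ => ?_
    rw [gen, contract_ι_mul]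
    exact Submodule.sub_mem _ (Submodule.smul_mem _ _ (hy a)) (gen_mul_mem a (ih (hy a)))

theorem contract_eq_zero_of_mem_zero (ℓ : Module.Dual k (Fin n → k)) {x : ExtAlg k n}
    (hx : x ∈ ⋀[k]^0 (Fin n → k)) : contract ℓ x = 0 := by
  obtain ⟨c, rfl⟩ := mem_power_zero.1 hx
  exact contract_algebraMap ℓ c

theorem algebraMapInv_algebraMap (c : k) :
    algebraMapInv (algebraMap k (ExtAlg k n) c) = c :=
  algebraMap_leftInverse (Fin n → k) c

theorem algebraMapInv_ι (v : Fin n → k) : algebraMapInv (ι k v) = 0 := by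
  simp [algebraMapInv]

theorem algebraMapInv_gen_mul (a : Fin n) (x : ExtAlg k n) :
    algebraMapInv (gen k n a * x) = 0 := by
  rw [map_mul, gen, algebraMapInv_ι, zero_mul]

theorem algebraMapInv_of_mem_succ {d : ℕ} {x : ExtAlg k n}
    (hx : x ∈ ⋀[k]^(d + 1) (Fin n → k)) : algebraMapInv x = 0 := by
  obtain ⟨y, -, rfl⟩ := exists_gen_mul_of_mem_succ hx
  simp [algebraMapInv_gen_mul]

theorem eq_algebraMap_of_mem_zero {x : ExtAlg k n} (hx : x ∈ ⋀[k]^0 (Fin n → k)) :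
    x = algebraMap k _ (algebraMapInv x) := by
  obtain ⟨c, rfl⟩ := mem_power_zero.1 hx
  rw [algebraMapInv_algebraMap]

theorem eq_zero_of_mem_zero {x : ExtAlg k n} (hx : x ∈ ⋀[k]^0 (Fin n → k))
    (h : algebraMapInv x = 0) : x = 0 := by
  rw [eq_algebraMap_of_mem_zero hx, h, map_zero]

/-- Projection of the exterior algebra onto its component of degree `j`. -/
def component (j : ℕ) : ExtAlg k n →ₗ[k] ExtAlg k n :=
  GradedAlgebra.proj (fun i : ℕ => ⋀[k]^i (Fin n → k)) j

theorem component_mem (j : ℕ) (x : ExtAlg k n) : component j x ∈ ⋀[k]^j (Fin n → k) := by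
  rw [component, GradedAlgebra.proj_apply]
  exact SetLike.coe_mem _

theorem component_same {j : ℕ} {x : ExtAlg k n} (hx : x ∈ ⋀[k]^j (Fin n → k)) :
    component j x = x := by
  rw [component, GradedAlgebra.proj_apply]
  exact DirectSum.decompose_of_mem_same _ hx

theorem component_of_ne {i j : ℕ} {x : ExtAlg k n} (hx : x ∈ ⋀[k]^i (Fin n → k)) (h : i ≠ j) :
    component j x = 0 := by
  rw [component, GradedAlgebra.proj_apply]
  exact DirectSum.decompose_of_mem_ne _ hx h

theorem induction_homogeneous {p : ExtAlg k n → Prop} (x : ExtAlg k n) (h0 : p 0)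
    (hadd : ∀ x y, p x → p y → p (x + y))
    (hom : ∀ j, ∀ x ∈ ⋀[k]^j (Fin n → k), p x) : p x := by
  induction x using DirectSum.Decomposition.inductionOn fun i : ℕ => ⋀[k]^i (Fin n → k) with
  | zero => exact h0
  | add x y hx hy => exact hadd x y hx hy
  | @homogeneous i m => exact hom i m m.2

theorem algebraMapInv_component_zero (x : ExtAlg k n) :
    algebraMapInv (component 0 x) = algebraMapInv x := by
  induction x using induction_homogeneous with
  | h0 => simp
  | hadd x y hx hy => simp [hx, hy]
  | hom j x hx =>
    rcases j with _ | j
    · rw [component_same hx]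
    · rw [component_of_ne hx (by simp), algebraMapInv_of_mem_succ hx, map_zero]

/-- The composite of the operators `x ↦ ∂_a (e_a x)` over a list of indices `a`. -/
def stripGens (l : List (Fin n)) (x : ExtAlg k n) : ExtAlg k n :=
  l.foldr (fun a y => partialD a (gen k n a * y)) x

theorem stripGens_sum (l : List (Fin n)) {ι : Type*} (s : Finset ι) (f : ι → ExtAlg k n) :
    stripGens l (∑ i ∈ s, f i) = ∑ i ∈ s, stripGens l (f i) := by
  induction l with
  | nil => rfl
  | cons a l ih =>
    change partialD a (gen k n a * stripGens l _) = _
    rw [ih, Finset.mul_sum, map_sum]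
    rfl

theorem stripGens_gen_mul_of_notMem (l : List (Fin n)) {b : Fin n} (hb : b ∉ l)
    (x : ExtAlg k n) : stripGens l (gen k n b * x) = gen k n b * stripGens l x := by
  induction l with
  | nil => rfl
  | cons a l ih =>
    simp only [List.mem_cons, not_or] at hb
    change partialD a (gen k n a * stripGens l _) = gen k n b * partialD a (gen k n a * stripGens l _)
    rw [ih hb.2, ← mul_assoc, gen_mul_swap, neg_mul, map_neg, mul_assoc, partialD_gen_mul,
      if_neg (Ne.symm hb.1)]
    simp

theorem stripGens_gen_mul (l : List (Fin n)) {b : Fin n} (hb : b ∈ l) (x : ExtAlg k n) :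
    stripGens l (gen k n b * x) = 0 := by
  induction l with
  | nil => simp at hb
  | cons a l ih =>
    change partialD a (gen k n a * stripGens l _) = 0
    by_cases h : b ∈ l
    · rw [ih h, mul_zero, map_zero]
    · have hab : b = a := by simpa [h] using hb
      subst hab
      rw [stripGens_gen_mul_of_notMem l h, ← mul_assoc, gen_mul_self, zero_mul, map_zero]

/-- The operators `x ↦ ∂_a (e_a x)` fix whatever is killed by all the `∂_a`, while their composite
over all `a` kills every multiple of a generator; this works in every characteristic. -/
theorem eq_zero_of_partialD_eq_zero {d : ℕ} {x : ExtAlg k n}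
    (hx : x ∈ ⋀[k]^(d + 1) (Fin n → k)) (h : ∀ a, partialD a x = 0) : x = 0 := by
  have h1 : ∀ l : List (Fin n), stripGens l x = x := by
    intro l
    induction l with
    | nil => rfl
    | cons a l ih =>
      change partialD a (gen k n a * stripGens l x) = x
      rw [ih, partialD_gen_mul, h, if_pos rfl, mul_zero, sub_zero]
  obtain ⟨y, -, hy⟩ := exists_gen_mul_of_mem_succ hx
  rw [← h1 (List.finRange n), hy, stripGens_sum]
  exact Finset.sum_eq_zero fun a _ => stripGens_gen_mul _ (List.mem_finRange a) _

theorem finrank_power (j : ℕ) : Module.finrank k (⋀[k]^j (Fin n → k)) = n.choose j := by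
  rw [exteriorPower.finrank_eq, Module.finrank_fin_fun]

end ExtAlg

/-! ### The Cartan complex of a module over the exterior algebra -/

section Cartan

open ExtAlg

variable {k : Type*} [Field k] {n : ℕ}
variable {M : Type*} [AddCommGroup M] [Module k M]

/-- The `p`-chains of the Cartan complex with values in `P`: families of elements of `P` indexed by
the multi-indices of degree `p`. A multi-index stands for an element of the basis of the divided
power algebra, so that nothing depends on the characteristic. They are encoded as families indexed
by all multi-indices, extended by zero. -/
def chains (P : Submodule k M) (p : ℕ) : Submodule k ((Fin n →₀ ℕ) → M) where
  carrier := {x | ∀ α, x α ∈ P ∧ (α.degree ≠ p → x α = 0)}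
  add_mem' hx hy α := ⟨P.add_mem (hx α).1 (hy α).1, fun h => by
    rw [Pi.add_apply, (hx α).2 h, (hy α).2 h, add_zero]⟩
  zero_mem' α := ⟨P.zero_mem, fun _ => rfl⟩
  smul_mem' c x hx α := ⟨P.smul_mem _ (hx α).1, fun h => by
    rw [Pi.smul_apply, (hx α).2 h, smul_zero]⟩

theorem chains_mono {P Q : Submodule k M} (h : P ≤ Q) (p : ℕ) :
    chains (n := n) P p ≤ chains Q p := fun _ hx α => ⟨h (hx α).1, (hx α).2⟩

theorem degree_add_single (α : Fin n →₀ ℕ) (a : Fin n) :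
    (α + Finsupp.single a 1).degree = α.degree + 1 := by
  rw [map_add, Finsupp.degree_single]

/-- Multi-indices of degree `p` in `n` variables. -/
abbrev MultiIndex (n p : ℕ) : Type := {α : Fin n →₀ ℕ // α.degree = p}

theorem mem_finsuppAntidiag_iff_degree {p : ℕ} {α : Fin n →₀ ℕ} :
    α ∈ Finset.univ.finsuppAntidiag p ↔ α.degree = p := by
  rw [Finset.mem_finsuppAntidiag, Finsupp.degree_eq_sum]
  simp

instance (p : ℕ) : Fintype (MultiIndex n p) :=
  Fintype.subtype (Finset.univ.finsuppAntidiag p) fun _ => mem_finsuppAntidiag_iff_degree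

theorem card_multiIndex (n p : ℕ) : Fintype.card (MultiIndex n p) = (n + p - 1).choose p := by
  rw [Fintype.subtype_card, Finset.card_finsuppAntidiag_nat_eq_choose, Finset.card_fin]

/-- A chain is determined by its values on the multi-indices of its degree. -/
def chainsEquiv (P : Submodule k M) (p : ℕ) : chains (n := n) P p ≃ₗ[k] (MultiIndex n p → P) where
  toFun x α := ⟨x.1 α.1, (x.2 α.1).1⟩
  map_add' _ _ := rfl
  map_smul' _ _ := rfl
  invFun f := ⟨fun α => if h : α.degree = p then f ⟨α, h⟩ else 0, fun α => by
    by_cases h : α.degree = p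
    · simp [h]
    · simp [h]⟩
  left_inv x := by
    ext α
    by_cases h : α.degree = p
    · simp [h]
    · simp [h, (x.2 α).2 h]
  right_inv f := by
    ext α
    simp [α.2]

theorem finrank_chains (P : Submodule k M) [Module.Finite k P] (p : ℕ) :
    Module.finrank k (chains (n := n) P p) = (n + p - 1).choose p * Module.finrank k P := by
  rw [(chainsEquiv P p).finrank_eq, Module.finrank_pi_fintype]
  simp [card_multiIndex]

instance (P : Submodule k M) [Module.Finite k P] (p : ℕ) :
    Module.Finite k (chains (n := n) P p) :=
  Module.Finite.equiv (chainsEquiv P p).symm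

variable [Module (ExtAlg k n) M] [IsScalarTower k (ExtAlg k n) M]

variable (k) in
/-- The differential of the Cartan complex of an `E`-module `M`. Its `p`-th term, divided powers
of degree `p` tensored with `M`, is encoded as the functions from multi-indices to `M` that are
supported in degree `p`; the function space on all multi-indices contains all terms at once. -/
def cartanD : ((Fin n →₀ ℕ) → M) →ₗ[k] ((Fin n →₀ ℕ) → M) where
  toFun x β := ∑ a, gen k n a • x (β + Finsupp.single a 1)
  map_add' x y := by ext β; simp [Finset.sum_add_distrib]
  map_smul' c x := by
    ext β
    simp only [Pi.smul_apply, RingHom.id_apply, Finset.smul_sum]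
    refine Finset.sum_congr rfl fun a _ => ?_
    rw [← algebraMap_smul (ExtAlg k n) c (x _), ← algebraMap_smul (ExtAlg k n) c (_ • x _),
      smul_smul, smul_smul, Algebra.commutes]

theorem cartanD_apply (x : (Fin n →₀ ℕ) → M) (β : Fin n →₀ ℕ) :
    cartanD k x β = ∑ a, gen k n a • x (β + Finsupp.single a 1) := rfl

theorem cartanD_cartanD (x : (Fin n →₀ ℕ) → M) : cartanD k (cartanD k x) = 0 := by
  ext β
  simp only [cartanD_apply, Finset.smul_sum, smul_smul, Pi.zero_apply]
  rw [← Finset.sum_product']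
  refine Finset.sum_involution (fun ab _ => (ab.2, ab.1)) ?_ ?_ (by simp) (by simp)
  · rintro ⟨a, b⟩ -
    dsimp only
    rw [gen_mul_swap a b, add_right_comm β, neg_smul, neg_add_cancel]
  · rintro ⟨a, b⟩ - h heq
    obtain rfl : b = a := congrArg Prod.fst heq
    exact h (by rw [gen_mul_self, zero_smul])

/-- The `p`-cycles of the Cartan complex with values in `P`. -/
def cycles (P : Submodule k M) (p : ℕ) : Submodule k ((Fin n →₀ ℕ) → M) :=
  chains P p ⊓ LinearMap.ker (cartanD k)

theorem mem_cycles {P : Submodule k M} {p : ℕ} {x : (Fin n →₀ ℕ) → M} :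
    x ∈ cycles P p ↔ x ∈ chains P p ∧ cartanD k x = 0 := by
  rw [cycles, Submodule.mem_inf, LinearMap.mem_ker]

theorem cycles_mono {P Q : Submodule k M} (h : P ≤ Q) (p : ℕ) :
    cycles (n := n) P p ≤ cycles Q p := inf_le_inf_right _ (chains_mono h p)

theorem cartanD_mem_chains {P Q : Submodule k M} {p : ℕ} {x : (Fin n →₀ ℕ) → M}
    (hx : x ∈ chains P (p + 1)) (h : ∀ a, ∀ m ∈ P, gen k n a • m ∈ Q) :
    cartanD k x ∈ chains Q p := by
  intro β
  rw [cartanD_apply]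
  refine ⟨Submodule.sum_mem _ fun a _ => h a _ (hx _).1, fun hβ => ?_⟩
  refine Finset.sum_eq_zero fun a _ => ?_
  rw [(hx _).2 (by rw [degree_add_single]; omega), smul_zero]

theorem cartanD_eq_zero_of_mem_chains_zero {P : Submodule k M} {x : (Fin n →₀ ℕ) → M}
    (hx : x ∈ chains P 0) : cartanD k x = 0 := by
  ext β
  rw [cartanD_apply]
  refine Finset.sum_eq_zero fun a _ => ?_
  rw [(hx _).2 (by rw [degree_add_single]; omega), smul_zero]

theorem cycles_zero (P : Submodule k M) : cycles (n := n) P 0 = chains P 0 :=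
  le_antisymm inf_le_left fun _ hx => mem_cycles.2 ⟨hx, cartanD_eq_zero_of_mem_chains_zero hx⟩

instance (P : Submodule k M) [Module.Finite k P] (p : ℕ) :
    Module.Finite k (cycles (n := n) P p) :=
  Submodule.finiteDimensional_of_le (S₂ := chains (n := n) P p) inf_le_left

/-- One step of the contracting homotopy: modulo a boundary, a cycle can be made to vanish at all
multi-indices involving the index `a`. -/
theorem exists_sub_cartanD_vanish (D : M →ₗ[k] M) (a : Fin n)
    (hD : ∀ b m, D (gen k n b • m) = (if a = b then m else 0) - gen k n b • D m)
    {P Q : Submodule k M} (hPQ : ∀ m ∈ P, D m ∈ Q) {p : ℕ}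
    {x : (Fin n →₀ ℕ) → M} (hx : x ∈ cycles P p) :
    ∃ y ∈ chains Q (p + 1), ∀ α, (α a ≠ 0 ∨ x α = 0) → x α = cartanD k y α := by
  have hcyc : ∀ γ, ∑ b, gen k n b • D (x (γ + Finsupp.single b 1))
      = x (γ + Finsupp.single a 1) := by
    intro γ
    have h := congrArg D (congrFun (mem_cycles.1 hx).2 γ)
    rw [cartanD_apply, map_sum] at h
    simp only [hD, Finset.sum_sub_distrib, Finset.sum_ite_eq, Finset.mem_univ, if_true,
      Pi.zero_apply, map_zero] at h
    exact (sub_eq_zero.1 h).symm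
  refine ⟨fun α => if α a ≠ 0 then D (x (α - Finsupp.single a 1)) else 0, ?_, ?_⟩
  · intro α
    dsimp only
    split_ifs with h
    · refine ⟨hPQ _ (hx.1 _).1, fun hα => ?_⟩
      have hle : Finsupp.single a 1 ≤ α := by
        rw [Finsupp.single_le_iff]; omega
      have : α.degree = (α - Finsupp.single a 1).degree + 1 := by
        conv_lhs => rw [← tsub_add_cancel_of_le hle, degree_add_single]
      rw [(hx.1 _).2 (by omega), map_zero]
    · exact ⟨Q.zero_mem, fun _ => rfl⟩
  · intro α hα
    rw [cartanD_apply]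
    by_cases h : α a ≠ 0
    · have hle : Finsupp.single a 1 ≤ α := by
        rw [Finsupp.single_le_iff]; omega
      have e := hcyc (α - Finsupp.single a 1)
      rw [tsub_add_cancel_of_le hle] at e
      conv_lhs => rw [← e]
      refine Finset.sum_congr rfl fun b _ => ?_
      have h1 : (α + Finsupp.single b 1 : Fin n →₀ ℕ) a ≠ 0 := by
        rw [Finsupp.add_apply]; omega
      rw [if_pos h1, tsub_add_eq_add_tsub hle]
    · have h0 : x α = 0 := by tauto
      rw [h0]
      symm
      refine Finset.sum_eq_zero fun b _ => ?_
      by_cases hb : b = a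
      · subst hb
        rw [if_pos (by simp), add_tsub_cancel_right, h0, map_zero, smul_zero]
      · rw [if_neg, smul_zero]
        rw [Finsupp.add_apply, Finsupp.single_eq_of_ne (Ne.symm hb)]
        omega

/-- Exactness of the Cartan complex in positive degree, for a module carrying operators `D a` that
behave like contractions; such are the free modules. -/
theorem exists_cartanD_eq (D : Fin n → M →ₗ[k] M)
    (hD : ∀ a b m, D a (gen k n b • m) = (if a = b then m else 0) - gen k n b • D a m)
    {P Q : Submodule k M} (hPQ : ∀ a, ∀ m ∈ P, D a m ∈ Q)
    (hQP : ∀ a, ∀ m ∈ Q, gen k n a • m ∈ P) {p : ℕ}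
    {x : (Fin n →₀ ℕ) → M} (hx : x ∈ cycles P (p + 1)) :
    ∃ y ∈ chains Q (p + 2), cartanD k y = x := by
  have key : ∀ s : Finset (Fin n), ∃ y ∈ chains Q (p + 2),
      ∀ α, (∃ a ∈ s, α a ≠ 0) → x α = cartanD k y α := by
    intro s
    induction s using Finset.induction_on with
    | empty => exact ⟨0, Submodule.zero_mem _, by simp⟩
    | insert a s _ ih =>
      obtain ⟨y, hy, hys⟩ := ih
      have hx' : x - cartanD k y ∈ cycles P (p + 1) := by
        refine mem_cycles.2 ⟨Submodule.sub_mem _ hx.1 (cartanD_mem_chains hy hQP), ?_⟩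
        rw [map_sub, (mem_cycles.1 hx).2, cartanD_cartanD, sub_zero]
      obtain ⟨z, hz, hzs⟩ := exists_sub_cartanD_vanish (D a) a (hD a) (hPQ a) hx'
      refine ⟨y + z, Submodule.add_mem _ hy hz, ?_⟩
      rintro α ⟨b, hb, hα⟩
      have h := hzs α ?_
      · rw [map_add, Pi.add_apply, ← h, Pi.sub_apply, add_sub_cancel]
      · rcases Finset.mem_insert.1 hb with rfl | hb
        · exact Or.inl hα
        · exact Or.inr (by rw [Pi.sub_apply, hys α ⟨b, hb, hα⟩, sub_self])
  obtain ⟨y, hy, h⟩ := key Finset.univ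
  refine ⟨y, hy, funext fun α => ?_⟩
  by_cases hα : α = 0
  · rw [(hx.1 α).2 (by simp [hα]), (cartanD_mem_chains hy hQP α).2 (by simp [hα])]
  · obtain ⟨a, ha⟩ := Finsupp.ne_iff.1 hα
    exact (h α ⟨a, Finset.mem_univ a, by simpa using ha⟩).symm

theorem finrank_map_of_injOn {V W : Type*} [AddCommGroup V] [Module k V] [AddCommGroup W]
    [Module k W] (f : V →ₗ[k] W) (S : Submodule k V) (h : ∀ x ∈ S, f x = 0 → x = 0) :
    Module.finrank k (S.map f) = Module.finrank k S := by
  rw [← LinearMap.range_domRestrict]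
  refine LinearMap.finrank_range_of_inj ?_
  rw [← LinearMap.ker_eq_bot, LinearMap.ker_eq_bot']
  rintro ⟨x, hx⟩ hfx
  exact Subtype.ext (h x hx hfx)

end Cartan

/-! ### Graded free modules -/

section GradedFree

open ExtAlg ExteriorAlgebra

variable {k : Type*} [Field k] {n r : ℕ}

/-- `freeComponent` as a `k`-subspace. -/
def freeGr (deg : Fin r → ℕ) (j : ℕ) : Submodule k (Fin r → ExtAlg k n) where
  carrier := freeComponent k n deg j
  add_mem' hx hy t := ⟨fun h => Submodule.add_mem _ ((hx t).1 h) ((hy t).1 h), fun h => by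
    rw [Pi.add_apply, (hx t).2 h, (hy t).2 h, add_zero]⟩
  zero_mem' t := ⟨fun _ => Submodule.zero_mem _, fun _ => rfl⟩
  smul_mem' c x hx t := ⟨fun h => Submodule.smul_mem _ c ((hx t).1 h), fun h => by
    rw [Pi.smul_apply, (hx t).2 h, smul_zero]⟩

theorem mem_freeGr {deg : Fin r → ℕ} {j : ℕ} {x : Fin r → ExtAlg k n} :
    x ∈ freeGr deg j ↔
      ∀ t, (deg t ≤ j → x t ∈ ⋀[k]^(j - deg t) (Fin n → k)) ∧ (j < deg t → x t = 0) := Iff.rfl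

/-- Projection of a graded free module onto its component of degree `j`. -/
def freeProj (deg : Fin r → ℕ) (j : ℕ) : (Fin r → ExtAlg k n) →ₗ[k] (Fin r → ExtAlg k n) :=
  LinearMap.pi fun t => if deg t ≤ j then component (j - deg t) ∘ₗ LinearMap.proj t else 0

theorem freeProj_apply (deg : Fin r → ℕ) (j : ℕ) (x : Fin r → ExtAlg k n) (t : Fin r) :
    freeProj deg j x t = if deg t ≤ j then component (j - deg t) (x t) else 0 := by
  rw [freeProj, LinearMap.pi_apply]
  split_ifs <;> rfl

theorem freeProj_mem (deg : Fin r → ℕ) (j : ℕ) (x : Fin r → ExtAlg k n) :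
    freeProj deg j x ∈ freeGr deg j := by
  intro t
  rw [freeProj_apply]
  refine ⟨fun h => ?_, fun h => if_neg (by omega)⟩
  rw [if_pos h]
  exact component_mem _ _

theorem freeProj_same {deg : Fin r → ℕ} {j : ℕ} {x : Fin r → ExtAlg k n}
    (hx : x ∈ freeGr deg j) : freeProj deg j x = x := by
  ext1 t
  rw [freeProj_apply]
  split_ifs with h
  · exact component_same ((hx t).1 h)
  · exact ((hx t).2 (by omega)).symm

theorem freeProj_of_ne {deg : Fin r → ℕ} {i j : ℕ} {x : Fin r → ExtAlg k n}
    (hx : x ∈ freeGr deg i) (hij : i ≠ j) : freeProj deg j x = 0 := by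
  ext1 t
  rw [freeProj_apply]
  split_ifs with h
  · by_cases hi : deg t ≤ i
    · exact component_of_ne ((hx t).1 hi) (by omega)
    · rw [(hx t).2 (by omega), map_zero, Pi.zero_apply]
  · rfl

theorem single_mem_freeGr (deg : Fin r → ℕ) (t : Fin r) {i : ℕ} {y : ExtAlg k n}
    (hy : y ∈ ⋀[k]^i (Fin n → k)) :
    (Pi.single t y : Fin r → ExtAlg k n) ∈ freeGr deg (deg t + i) := by
  intro s
  by_cases h : s = t
  · subst h
    rw [Pi.single_eq_same, Nat.add_sub_cancel_left]
    exact ⟨fun _ => hy, fun h => by omega⟩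
  · rw [Pi.single_eq_of_ne h]
    exact ⟨fun _ => Submodule.zero_mem _, fun _ => rfl⟩

theorem basis_mem_freeGr (deg : Fin r → ℕ) (t : Fin r) :
    (Pi.single t 1 : Fin r → ExtAlg k n) ∈ freeGr deg (deg t) :=
  single_mem_freeGr deg t (i := 0) (by
    rw [← map_one (algebraMap k (ExtAlg k n))]
    exact algebraMap_mem_zero 1)

theorem free_induction_homogeneous (deg : Fin r → ℕ) {p : (Fin r → ExtAlg k n) → Prop}
    (x : Fin r → ExtAlg k n) (h0 : p 0) (hadd : ∀ x y, p x → p y → p (x + y))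
    (hom : ∀ j, ∀ x ∈ freeGr deg j, p x) : p x := by
  have h1 : ∀ t y, p (Pi.single t y) := by
    intro t y
    induction y using induction_homogeneous with
    | h0 => rwa [Pi.single_zero]
    | hadd y z hy hz => rw [Pi.single_add]; exact hadd _ _ hy hz
    | hom j y hy => exact hom _ _ (single_mem_freeGr deg t hy)
  rw [← Finset.univ_sum_single x]
  exact Finset.sum_induction _ p hadd h0 fun t _ => h1 t _

theorem mul_smul_mem_freeGr {deg : Fin r → ℕ} {i j : ℕ} {y : ExtAlg k n}
    (hy : y ∈ ⋀[k]^i (Fin n → k)) {x : Fin r → ExtAlg k n} (hx : x ∈ freeGr deg j) :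
    y • x ∈ freeGr deg (i + j) := by
  intro t
  rw [Pi.smul_apply, smul_eq_mul]
  refine ⟨fun h => ?_, fun h => by rw [(hx t).2 (by omega), mul_zero]⟩
  by_cases hj : deg t ≤ j
  · have := mul_mem_power hy ((hx t).1 hj)
    rwa [← Nat.add_sub_assoc hj] at this
  · rw [(hx t).2 (by omega), mul_zero]
    exact Submodule.zero_mem _

theorem gen_smul_mem_freeGr {deg : Fin r → ℕ} {j : ℕ} (a : Fin n) {x : Fin r → ExtAlg k n}
    (hx : x ∈ freeGr deg j) : gen k n a • x ∈ freeGr deg (j + 1) := by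
  rw [add_comm]
  exact mul_smul_mem_freeGr (gen_mem_one a) hx

/-- Contraction by a coordinate form, applied to each entry. -/
def freePartialD (r : ℕ) (a : Fin n) : (Fin r → ExtAlg k n) →ₗ[k] (Fin r → ExtAlg k n) :=
  LinearMap.pi fun t => partialD a ∘ₗ LinearMap.proj t

theorem freePartialD_gen_smul (a b : Fin n) (x : Fin r → ExtAlg k n) :
    freePartialD r a (gen k n b • x) =
      (if a = b then x else 0) - gen k n b • freePartialD r a x := by
  ext1 t
  change partialD a (gen k n b * x t) = _
  rw [partialD_gen_mul]
  split_ifs <;> rfl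

theorem freePartialD_mem {deg : Fin r → ℕ} {j : ℕ} (a : Fin n) {x : Fin r → ExtAlg k n}
    (hx : x ∈ freeGr deg (j + 1)) : freePartialD r a x ∈ freeGr deg j := by
  intro t
  change (_ → partialD a (x t) ∈ _) ∧ (_ → partialD a (x t) = 0)
  refine ⟨fun h => ?_, fun h => ?_⟩
  · have h1 := (hx t).1 (by omega)
    rw [show j + 1 - deg t = (j - deg t) + 1 by omega] at h1
    exact contract_mem _ h1
  · by_cases hj : j + 1 < deg t
    · rw [(hx t).2 hj, map_zero]
    · have h1 := (hx t).1 (by omega)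
      rw [show j + 1 - deg t = 0 by omega] at h1
      exact contract_eq_zero_of_mem_zero _ h1

theorem freePartialD_eq_zero {deg : Fin r → ℕ} {j : ℕ} (hj : ∀ t, j ≤ deg t) (a : Fin n)
    {x : Fin r → ExtAlg k n} (hx : x ∈ freeGr deg j) : freePartialD r a x = 0 := by
  ext1 t
  change partialD a (x t) = 0
  by_cases h : j < deg t
  · rw [(hx t).2 h, map_zero]
  · have h1 := (hx t).1 (by omega)
    rw [show j - deg t = 0 by have := hj t; omega] at h1
    exact contract_eq_zero_of_mem_zero _ h1

theorem freeGr_eq_bot {deg : Fin r → ℕ} {j : ℕ} (hj : ∀ t, j < deg t) :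
    freeGr (k := k) (n := n) deg j = ⊥ :=
  (Submodule.eq_bot_iff _).2 fun _ hx => funext fun t => (hx t).2 (hj t)

theorem exists_gen_smul_of_mem_freeGr {deg : Fin r → ℕ} {j : ℕ} {x : Fin r → ExtAlg k n}
    (hx : x ∈ freeGr deg (j + 1)) (h0 : ∀ t, algebraMapInv (x t) = 0) :
    ∃ y : Fin n → Fin r → ExtAlg k n, (∀ a, y a ∈ freeGr deg j) ∧ x = ∑ a, gen k n a • y a := by
  have h : ∀ t, ∃ y : Fin n → ExtAlg k n, x t = ∑ a, gen k n a * y a ∧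
      ∀ a, (deg t ≤ j → y a ∈ ⋀[k]^(j - deg t) (Fin n → k)) ∧ (j < deg t → y a = 0) := by
    intro t
    by_cases h : deg t ≤ j
    · have h1 := (hx t).1 (by omega)
      rw [show j + 1 - deg t = (j - deg t) + 1 by omega] at h1
      obtain ⟨y, hy, e⟩ := exists_gen_mul_of_mem_succ h1
      exact ⟨y, e, fun a => ⟨fun _ => hy a, fun _ => by omega⟩⟩
    · refine ⟨0, ?_, fun a => ⟨fun _ => Submodule.zero_mem _, fun _ => rfl⟩⟩
      have : x t = 0 := by
        by_cases h2 : j + 1 < deg t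
        · exact (hx t).2 h2
        · have h1 := (hx t).1 (by omega)
          rw [show j + 1 - deg t = 0 by omega] at h1
          exact eq_zero_of_mem_zero h1 (h0 t)
      simp [this]
  choose y hy1 hy2 using h
  refine ⟨fun a t => y t a, fun a t => hy2 t a, funext fun t => ?_⟩
  rw [hy1 t, Finset.sum_apply]
  rfl

/-- The space of `t`-th entries of the elements of degree `j` in a graded free module. -/
def freeEntry (k : Type*) [Field k] (n : ℕ) (deg : Fin r → ℕ) (j : ℕ) (t : Fin r) :
    Submodule k (ExtAlg k n) :=
  if deg t ≤ j then ⋀[k]^(j - deg t) (Fin n → k) else ⊥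

theorem mem_freeGr_iff_entry {deg : Fin r → ℕ} {j : ℕ} {x : Fin r → ExtAlg k n} :
    x ∈ freeGr deg j ↔ ∀ t, x t ∈ freeEntry k n deg j t := by
  rw [mem_freeGr]
  refine forall_congr' fun t => ?_
  rw [freeEntry]
  split_ifs with h
  · simp [h, not_lt.2 h]
  · simp [h, not_le.1 h]

/-- A homogeneous element of a free module is the family of its entries. -/
def freeGrEquiv (deg : Fin r → ℕ) (j : ℕ) :
    freeGr (k := k) (n := n) deg j ≃ₗ[k] ((t : Fin r) → freeEntry k n deg j t) where
  toFun x t := ⟨x.1 t, mem_freeGr_iff_entry.1 x.2 t⟩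
  map_add' _ _ := rfl
  map_smul' _ _ := rfl
  invFun f := ⟨fun t => f t, mem_freeGr_iff_entry.2 fun t => (f t).2⟩
  left_inv _ := rfl
  right_inv _ := rfl

instance (deg : Fin r → ℕ) (j : ℕ) (t : Fin r) : Module.Finite k (freeEntry k n deg j t) := by
  by_cases h : deg t ≤ j
  · rw [freeEntry, if_pos h]
    infer_instance
  · rw [freeEntry, if_neg h]
    infer_instance

instance (deg : Fin r → ℕ) (j : ℕ) : Module.Finite k (freeGr (k := k) (n := n) deg j) :=
  Module.Finite.equiv (freeGrEquiv deg j).symm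

theorem finrank_freeGr (deg : Fin r → ℕ) (j : ℕ) :
    Module.finrank k (freeGr (k := k) (n := n) deg j) =
      ∑ t, if deg t ≤ j then n.choose (j - deg t) else 0 := by
  rw [(freeGrEquiv deg j).finrank_eq, Module.finrank_pi_fintype]
  refine Finset.sum_congr rfl fun t _ => ?_
  by_cases h : deg t ≤ j
  · rw [freeEntry, if_pos h, if_pos h, finrank_power]
  · rw [freeEntry, if_neg h, if_neg h, finrank_bot]

end GradedFree

/-! ### Homogeneous maps and dimension shifting -/

section Shift

open ExtAlg ExteriorAlgebra

variable {k : Type*} [Field k] {n r : ℕ}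
variable {M : Type*} [AddCommGroup M] [Module k M]

/-- `q j` acts on the family of subspaces `𝓜` as the projection onto its `j`-th member. -/
structure IsGradingProj (𝓜 : ℕ → Submodule k M) (q : ℕ → M →ₗ[k] M) : Prop where
  same : ∀ j, ∀ m ∈ 𝓜 j, q j m = m
  of_ne : ∀ i j, ∀ m ∈ 𝓜 i, i ≠ j → q j m = 0

theorem isGradingProj_free (deg : Fin r → ℕ) :
    IsGradingProj (k := k) (freeGr (n := n) deg) (freeProj deg) :=
  ⟨fun _ _ hm => freeProj_same hm, fun _ _ _ hm h => freeProj_of_ne hm h⟩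

variable [Module (ExtAlg k n) M]

theorem map_freeProj {𝓜 : ℕ → Submodule k M} {q : ℕ → M →ₗ[k] M} (hq : IsGradingProj 𝓜 q)
    {deg : Fin r → ℕ} (f : (Fin r → ExtAlg k n) →ₗ[ExtAlg k n] M)
    (hf : ∀ j, ∀ x ∈ freeComponent k n deg j, f x ∈ 𝓜 j) (j : ℕ) (x : Fin r → ExtAlg k n) :
    f (freeProj deg j x) = q j (f x) := by
  induction x using free_induction_homogeneous deg with
  | h0 => simp
  | hadd x y hx hy => simp [hx, hy]
  | hom i x hx =>
    by_cases h : i = j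
    · subst h
      rw [freeProj_same hx, hq.same _ _ (hf _ _ hx)]
    · rw [freeProj_of_ne hx h, hq.of_ne _ _ _ (hf _ _ hx) h, map_zero]

variable [IsScalarTower k (ExtAlg k n) M]

/-- The range of an `E`-linear map, as a `k`-subspace. -/
abbrev rangeK (f : (Fin r → ExtAlg k n) →ₗ[ExtAlg k n] M) : Submodule k M :=
  (LinearMap.range f).restrictScalars k

/-- The kernel of an `E`-linear map, as a `k`-subspace. -/
abbrev kerK (f : (Fin r → ExtAlg k n) →ₗ[ExtAlg k n] M) : Submodule k (Fin r → ExtAlg k n) :=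
  (LinearMap.ker f).restrictScalars k

theorem exists_lift {𝓜 : ℕ → Submodule k M} {q : ℕ → M →ₗ[k] M} (hq : IsGradingProj 𝓜 q)
    {deg : Fin r → ℕ} {f : (Fin r → ExtAlg k n) →ₗ[ExtAlg k n] M}
    (hf : ∀ j, ∀ x ∈ freeComponent k n deg j, f x ∈ 𝓜 j) {j : ℕ} {m : M}
    (hm : m ∈ 𝓜 j ⊓ rangeK f) : ∃ x ∈ freeGr deg j, f x = m := by
  obtain ⟨hm, x, rfl⟩ := hm
  exact ⟨freeProj deg j x, freeProj_mem deg j x, by rw [map_freeProj hq f hf, hq.same _ _ hm]⟩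

theorem exists_lift_chains {𝓜 : ℕ → Submodule k M} {q : ℕ → M →ₗ[k] M}
    (hq : IsGradingProj 𝓜 q) {deg : Fin r → ℕ} {f : (Fin r → ExtAlg k n) →ₗ[ExtAlg k n] M}
    (hf : ∀ j, ∀ x ∈ freeComponent k n deg j, f x ∈ 𝓜 j) {j p : ℕ} {w : (Fin n →₀ ℕ) → M}
    (hw : w ∈ chains (𝓜 j ⊓ rangeK f) p) :
    ∃ z ∈ chains (freeGr deg j) p, ∀ α, f (z α) = w α := by
  have h : ∀ α, ∃ x ∈ freeGr deg j, f x = w α ∧ (α.degree ≠ p → x = 0) := by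
    intro α
    by_cases hα : α.degree = p
    · obtain ⟨x, hx, e⟩ := exists_lift hq hf (hw α).1
      exact ⟨x, hx, e, fun h => absurd hα h⟩
    · exact ⟨0, Submodule.zero_mem _, by rw [map_zero, (hw α).2 hα], fun _ => rfl⟩
  choose z hz1 hz2 hz3 using h
  exact ⟨z, fun α => ⟨hz1 α, hz3 α⟩, hz2⟩

theorem map_cartanD (f : (Fin r → ExtAlg k n) →ₗ[ExtAlg k n] M)
    (x : (Fin n →₀ ℕ) → Fin r → ExtAlg k n) (β : Fin n →₀ ℕ) :
    f (cartanD k x β) = cartanD k (fun α => f (x α)) β := by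
  rw [cartanD_apply, cartanD_apply, map_sum]
  exact Finset.sum_congr rfl fun a _ => map_smul f _ _

theorem exists_cartanD_eq_of_zero {P Q : Submodule k M} {x : (Fin n →₀ ℕ) → M}
    (hx : x ∈ chains P 0) {y : Fin n → M} (hy : ∀ a, y a ∈ Q) (h : x 0 = ∑ a, gen k n a • y a) :
    ∃ z ∈ chains Q 1, cartanD k z = x := by
  refine ⟨fun α => ∑ a, if α = Finsupp.single a 1 then y a else 0, fun α => ⟨?_, ?_⟩, ?_⟩
  · refine Submodule.sum_mem _ fun a _ => ?_
    split_ifs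
    · exact hy a
    · exact Q.zero_mem
  · intro hα
    refine Finset.sum_eq_zero fun a _ => if_neg ?_
    rintro rfl
    exact hα (Finsupp.degree_single _ _)
  · ext β
    rw [cartanD_apply]
    by_cases hβ : β = 0
    · subst hβ
      rw [h]
      refine Finset.sum_congr rfl fun a _ => ?_
      rw [Finset.sum_eq_single a, if_pos (zero_add _)]
      · intro b _ hb
        rw [if_neg]
        rw [zero_add, Finsupp.single_left_inj one_ne_zero]
        exact Ne.symm hb
      · simp
    · have hd : β.degree ≠ 0 := by rwa [Ne, Finsupp.degree_eq_zero_iff]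
      rw [(hx β).2 hd]
      refine Finset.sum_eq_zero fun a _ => ?_
      rw [Finset.sum_eq_zero, smul_zero]
      intro b _
      rw [if_neg]
      intro e
      have := congrArg Finsupp.degree e
      rw [degree_add_single, Finsupp.degree_single] at this
      omega

/-- The Cartan complex of the graded module `⨁ 𝓝 d` is exact at the `p`-chains of internal degree
`d + 1`. This encodes the vanishing of `Tor_p(N, k)` in degree `p + d + 1`. -/
def CartanExact (𝓝 : ℕ → Submodule k M) (p d : ℕ) : Prop :=
  ∀ x ∈ cycles (n := n) (𝓝 (d + 1)) p, ∃ y ∈ chains (n := n) (𝓝 d) (p + 1), cartanD k y = x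

/-- Exactness of the Cartan complex passes from the image of a homogeneous map out of a free module
to its kernel, with a shift in both degrees. -/
theorem CartanExact.ker {𝓜 : ℕ → Submodule k M} {q : ℕ → M →ₗ[k] M} (hq : IsGradingProj 𝓜 q)
    {deg : Fin r → ℕ} {f : (Fin r → ExtAlg k n) →ₗ[ExtAlg k n] M}
    (hf : ∀ j, ∀ x ∈ freeComponent k n deg j, f x ∈ 𝓜 j)
    (hmin : ∀ x, f x = 0 → ∀ t, algebraMapInv (x t) = 0) {p d : ℕ}
    (h : CartanExact (n := n) (fun j => 𝓜 j ⊓ rangeK f) (p + 1) d) :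
    CartanExact (n := n) (fun j => freeGr deg j ⊓ kerK f) p (d + 1) := by
  intro x hx
  obtain ⟨y, hy, rfl⟩ : ∃ y ∈ chains (freeGr deg (d + 1)) (p + 1), cartanD k y = x := by
    rcases p with _ | p
    · obtain ⟨y, hy, e⟩ := exists_gen_smul_of_mem_freeGr (hx.1 0).1.1 (hmin _ (hx.1 0).1.2)
      exact exists_cartanD_eq_of_zero hx.1 hy e
    · exact exists_cartanD_eq (freePartialD r) freePartialD_gen_smul
        (fun a m hm => freePartialD_mem a hm) (fun a m hm => gen_smul_mem_freeGr a hm)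
        (cycles_mono inf_le_left _ hx)
  have hfy : (fun α => f (y α)) ∈ cycles (𝓜 (d + 1) ⊓ rangeK f) (p + 1) := by
    refine mem_cycles.2 ⟨fun α => ⟨⟨hf _ _ (hy α).1, y α, rfl⟩, fun hα => ?_⟩, ?_⟩
    · change f (y α) = 0
      rw [(hy α).2 hα, map_zero]
    · ext β
      rw [← map_cartanD]
      exact (hx.1 β).1.2
  obtain ⟨w, hw, hwy⟩ := h _ hfy
  obtain ⟨z, hz, hzw⟩ := exists_lift_chains hq hf hw
  have hz' : cartanD k z ∈ chains (freeGr deg (d + 1)) (p + 1) :=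
    cartanD_mem_chains hz fun a m hm => gen_smul_mem_freeGr a hm
  refine ⟨y - cartanD k z, fun α => ⟨⟨?_, ?_⟩, ?_⟩, ?_⟩
  · exact Submodule.sub_mem _ (hy α).1 (hz' α).1
  · change f (y α - cartanD k z α) = 0
    rw [map_sub, map_cartanD, sub_eq_zero]
    simp only [hzw]
    exact (congrFun hwy α).symm
  · intro hα
    rw [Pi.sub_apply, (hy α).2 hα, (hz' α).2 hα, sub_zero]
  · rw [map_sub, cartanD_cartanD, sub_zero]

/-- In the lowest degrees, dimension shifting identifies cycles of the image of a homogeneous map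
with cycles of its kernel. -/
theorem finrank_cycles_ker {𝓜 : ℕ → Submodule k M} {q : ℕ → M →ₗ[k] M}
    (hq : IsGradingProj 𝓜 q) {deg : Fin r → ℕ}
    {f : (Fin r → ExtAlg k n) →ₗ[ExtAlg k n] M}
    (hf : ∀ j, ∀ x ∈ freeComponent k n deg j, f x ∈ 𝓜 j)
    (hmin : ∀ x, f x = 0 → ∀ t, algebraMapInv (x t) = 0) {d : ℕ} (hd : ∀ t, d ≤ deg t) (p : ℕ) :
    Module.finrank k (cycles (n := n) (freeGr deg (d + 1) ⊓ kerK f) p) =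
      Module.finrank k (cycles (n := n) (𝓜 d ⊓ rangeK f) (p + 1)) := by
  let fk : ((Fin n →₀ ℕ) → Fin r → ExtAlg k n) →ₗ[k] ((Fin n →₀ ℕ) → M) :=
    LinearMap.pi fun α => f.restrictScalars k ∘ₗ LinearMap.proj α
  have hfk : ∀ x α, fk x α = f (x α) := fun _ _ => rfl
  have hfD : ∀ x, fk (cartanD k x) = cartanD k (fk x) := fun x => funext fun β => map_cartanD f x β
  let S : Submodule k ((Fin n →₀ ℕ) → Fin r → ExtAlg k n) :=
    chains (freeGr deg d) (p + 1) ⊓ LinearMap.ker (fk ∘ₗ cartanD k)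
  have hS : ∀ x, x ∈ S ↔ x ∈ chains (freeGr deg d) (p + 1) ∧ fk (cartanD k x) = 0 := fun _ => Iff.rfl
  have h1 : S.map fk = cycles (𝓜 d ⊓ rangeK f) (p + 1) := by
    refine le_antisymm ?_ fun w hw => ?_
    · rintro _ ⟨x, hx, rfl⟩
      have hx := (hS x).1 hx
      refine mem_cycles.2 ⟨fun α => ⟨⟨hf _ _ (hx.1 α).1, x α, rfl⟩, fun hα => ?_⟩, ?_⟩
      · rw [hfk, (hx.1 α).2 hα, map_zero]
      · rw [← hfD, hx.2]
    · obtain ⟨z, hz, e⟩ := exists_lift_chains hq hf hw.1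
      have e : fk z = w := funext e
      exact ⟨z, (hS z).2 ⟨hz, by rw [hfD, e, (mem_cycles.1 hw).2]⟩, e⟩
  have h2 : S.map (cartanD k) = cycles (freeGr deg (d + 1) ⊓ kerK f) p := by
    refine le_antisymm ?_ fun x hx => ?_
    · rintro _ ⟨y, hy, rfl⟩
      have hy := (hS y).1 hy
      have hy' : cartanD k y ∈ chains (freeGr deg (d + 1)) p :=
        cartanD_mem_chains hy.1 fun a m hm => gen_smul_mem_freeGr a hm
      exact mem_cycles.2 ⟨fun α => ⟨⟨(hy' α).1, congrFun hy.2 α⟩, (hy' α).2⟩, cartanD_cartanD _⟩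
    · obtain ⟨y, hy, rfl⟩ : ∃ y ∈ chains (freeGr deg d) (p + 1), cartanD k y = x := by
        rcases p with _ | p
        · obtain ⟨y, hy, e⟩ := exists_gen_smul_of_mem_freeGr (hx.1 0).1.1 (hmin _ (hx.1 0).1.2)
          exact exists_cartanD_eq_of_zero hx.1 hy e
        · exact exists_cartanD_eq (freePartialD r) freePartialD_gen_smul
            (fun a m hm => freePartialD_mem a hm) (fun a m hm => gen_smul_mem_freeGr a hm)
            (cycles_mono inf_le_left _ hx)
      exact ⟨y, (hS y).2 ⟨hy, funext fun β => (hx.1 β).1.2⟩, rfl⟩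
  rw [← h1, ← h2, finrank_map_of_injOn, finrank_map_of_injOn]
  · intro x hx h
    ext1 α
    have h0 := hmin _ (congrFun h α)
    ext1 t
    have hm := (((hS x).1 hx).1 α).1 t
    by_cases ht : d < deg t
    · exact hm.2 ht
    · have h3 := hm.1 (by omega)
      rw [show d - deg t = 0 by have := hd t; omega] at h3
      exact eq_zero_of_mem_zero h3 (h0 t)
  · intro x hx h
    have hx : x ∈ cycles (freeGr deg d) (p + 1) := mem_cycles.2 ⟨((hS x).1 hx).1, h⟩
    obtain ⟨y, hy, rfl⟩ := exists_cartanD_eq (Q := ⊥) (freePartialD r) freePartialD_gen_smul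
        (fun a m hm => (Submodule.mem_bot k).2 (freePartialD_eq_zero hd a hm))
        (fun a m hm => by rw [(Submodule.mem_bot k).1 hm, smul_zero]; exact Submodule.zero_mem _) hx
    have : y = 0 := funext fun α => (Submodule.mem_bot k).1 (hy α).1
    rw [this, map_zero]

end Shift

/-! ### Minimal free resolutions of quotients of the exterior algebra -/

section QuotientGrading

open ExtAlg ExteriorAlgebra

variable {k : Type*} [Field k] {n : ℕ}

/-- The grading induced on the quotient by a left ideal; for the Orlik–Solomon ideal it is
`osGrading` by definition. -/
def quotGrading (I : Ideal (ExtAlg k n)) (j : ℕ) : Submodule k (ExtAlg k n ⧸ I) :=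
  (⋀[k]^j (Fin n → k)).map (I.mkQ.restrictScalars k)

/-- The part of degree `j` of a left ideal. -/
def idealGr (I : Ideal (ExtAlg k n)) (j : ℕ) : Submodule k (ExtAlg k n) :=
  ⋀[k]^j (Fin n → k) ⊓ I.restrictScalars k

theorem mem_idealGr {I : Ideal (ExtAlg k n)} {j : ℕ} {x : ExtAlg k n} :
    x ∈ idealGr I j ↔ x ∈ ⋀[k]^j (Fin n → k) ∧ x ∈ I := Iff.rfl

instance (I : Ideal (ExtAlg k n)) (j : ℕ) : Module.Finite k (idealGr I j) :=
  Submodule.finiteDimensional_of_le (S₂ := ⋀[k]^j (Fin n → k)) inf_le_left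

theorem exists_isGradingProj_quotGrading {I : Ideal (ExtAlg k n)}
    (hI : ∀ x ∈ I, ∀ j, component j x ∈ I) : ∃ q, IsGradingProj (quotGrading I) q := by
  let e := Submodule.Quotient.restrictScalarsEquiv k I
  let q : ℕ → (ExtAlg k n ⧸ I) →ₗ[k] (ExtAlg k n ⧸ I) := fun j =>
    e.toLinearMap ∘ₗ (I.restrictScalars k).mapQ (I.restrictScalars k) (component j)
      (fun x hx => hI x hx j) ∘ₗ e.symm.toLinearMap
  have hq : ∀ j x, q j (I.mkQ x) = I.mkQ (component j x) := fun _ _ => rfl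
  refine ⟨q, ?_, ?_⟩
  · rintro j _ ⟨x, hx, rfl⟩
    exact (hq j x).trans (by rw [component_same hx]; rfl)
  · rintro i j _ ⟨x, hx, rfl⟩ hij
    exact (hq j x).trans (by rw [component_of_ne hx hij, map_zero])

end QuotientGrading

namespace MinimalFreeResolution

open ExtAlg ExteriorAlgebra

variable {k : Type*} [Field k] {n : ℕ} {I : Ideal (ExtAlg k n)}
  (F : MinimalFreeResolution k n (ExtAlg k n ⧸ I) (quotGrading I))

theorem kerK_aug : kerK F.aug = rangeK (F.d 0) := by
  ext x
  exact F.exact_aug x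

theorem kerK_d (i : ℕ) : kerK (F.d i) = rangeK (F.d (i + 1)) := by
  ext x
  exact F.exact_d i x

theorem algebraMapInv_of_aug_eq_zero (x) (hx : F.aug x = 0) (t) : algebraMapInv (x t) = 0 := by
  obtain ⟨y, rfl⟩ := (F.exact_aug x).1 hx
  exact F.minimal _ _ _

theorem algebraMapInv_of_d_eq_zero (i : ℕ) (x) (hx : F.d i x = 0) (t) :
    algebraMapInv (x t) = 0 := by
  obtain ⟨y, rfl⟩ := (F.exact_d i x).1 hx
  exact F.minimal _ _ _

theorem d_basis_ne_zero (i : ℕ) (t) : F.d i (Pi.single t 1) ≠ 0 := by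
  intro h
  have := F.algebraMapInv_of_d_eq_zero i _ h t
  rw [Pi.single_eq_same, map_one] at this
  exact one_ne_zero this

variable (hI : ∀ x ∈ I, ∀ j, component j x ∈ I)
  (hlow : ∀ x ∈ I, ∀ j ≤ 1, x ∈ ⋀[k]^j (Fin n → k) → x = 0)

include hI hlow in
/-- The zeroth term of a minimal resolution of a nonzero cyclic module is free of rank one. -/
theorem exists_unique_basis_zero : ∃ t₀, (∀ t, t = t₀) ∧ F.deg 0 t₀ = 0 ∧
    ∀ x, F.aug x = 0 ↔ x t₀ ∈ I := by
  obtain ⟨q, hq⟩ := exists_isGradingProj_quotGrading hI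
  have h1 : I.mkQ 1 ∈ quotGrading I 0 := by
    refine ⟨1, ?_, rfl⟩
    rw [← map_one (algebraMap k (ExtAlg k n))]
    exact algebraMap_mem_zero 1
  obtain ⟨g, hg, hg1⟩ := exists_lift hq F.aug_homogeneous ⟨h1, F.aug_surjective _⟩
  have hne : I.mkQ (1 : ExtAlg k n) ≠ 0 := by
    intro h
    have h0 : (1 : ExtAlg k n) ∈ I := (Submodule.Quotient.mk_eq_zero I).1 h
    refine one_ne_zero (hlow 1 h0 0 (by omega) ?_)
    rw [← map_one (algebraMap k (ExtAlg k n))]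
    exact algebraMap_mem_zero 1
  have key : ∀ t, ∃ y ∈ ⋀[k]^(F.deg 0 t) (Fin n → k), ∀ s,
      algebraMapInv ((Pi.single t 1 : Fin (F.rank 0) → ExtAlg k n) s) =
        algebraMapInv y * algebraMapInv (g s) := by
    intro t
    obtain ⟨y, hy, hyt⟩ := F.aug_homogeneous _ _ (basis_mem_freeGr (F.deg 0) t)
    refine ⟨y, hy, fun s => ?_⟩
    have h0 : F.aug (Pi.single t 1 - y • g) = 0 := by
      rw [map_sub, ← hyt, map_smul, hg1, ← map_smul, smul_eq_mul, mul_one]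
      exact sub_self _
    have := F.algebraMapInv_of_aug_eq_zero _ h0 s
    rwa [Pi.sub_apply, map_sub, Pi.smul_apply, smul_eq_mul, map_mul, sub_eq_zero] at this
  have hdeg : ∀ t, F.deg 0 t = 0 := by
    intro t
    obtain ⟨y, hy, h⟩ := key t
    by_contra hd
    obtain ⟨d, hd⟩ := Nat.exists_eq_succ_of_ne_zero hd
    rw [hd] at hy
    have := h t
    rw [Pi.single_eq_same, map_one, algebraMapInv_of_mem_succ hy, zero_mul] at this
    exact one_ne_zero this
  have hsub : ∀ t s : Fin (F.rank 0), t = s := by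
    intro t s
    by_contra hts
    obtain ⟨y, -, h⟩ := key t
    obtain ⟨z, -, h'⟩ := key s
    have e1 := h t
    have e2 := h s
    have e3 := h' s
    rw [Pi.single_eq_same, map_one] at e1 e3
    rw [Pi.single_eq_of_ne (Ne.symm hts), map_zero] at e2
    rcases mul_eq_zero.1 e2.symm with e | e
    · rw [e, zero_mul] at e1; exact one_ne_zero e1
    · rw [e, mul_zero] at e3; exact one_ne_zero e3
  obtain ⟨t₀⟩ : Nonempty (Fin (F.rank 0)) := by
    by_contra hem
    rw [not_nonempty_iff] at hem
    apply hne
    rw [← hg1, Subsingleton.elim g 0, map_zero]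
  refine ⟨t₀, fun t => hsub t t₀, hdeg t₀, fun x => ?_⟩
  obtain ⟨y, hy, hyt⟩ := F.aug_homogeneous _ _ (basis_mem_freeGr (F.deg 0) t₀)
  rw [hdeg] at hy
  obtain ⟨c, rfl⟩ := mem_power_zero.1 hy
  have hx : ∀ x : Fin (F.rank 0) → ExtAlg k n, F.aug x = I.mkQ (c • x t₀) := by
    intro x
    have : x = x t₀ • Pi.single t₀ (1 : ExtAlg k n) := by
      funext t
      rw [hsub t t₀, Pi.smul_apply, Pi.single_eq_same, smul_eq_mul, mul_one]
    conv_lhs => rw [this, map_smul, ← hyt]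
    change x t₀ • I.mkQ _ = _
    rw [← map_smul, smul_eq_mul, ← Algebra.commutes, ← Algebra.smul_def]
  have hc : c ≠ 0 := by
    rintro rfl
    apply hne
    rw [← hg1, hx, zero_smul, map_zero]
  rw [hx]
  refine (Submodule.Quotient.mk_eq_zero I).trans ⟨fun h => ?_, fun h => ?_⟩
  · have := (I.restrictScalars k).smul_mem c⁻¹ h
    rwa [smul_smul, inv_mul_cancel₀ hc, one_smul] at this
  · exact (I.restrictScalars k).smul_mem c h

include hI hlow in
theorem le_deg (i : ℕ) (t) : i + 2 ≤ F.deg (i + 1) t := by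
  induction i with
  | zero =>
    by_contra hlt
    obtain ⟨t₀, h0, hd, hk⟩ := F.exists_unique_basis_zero hI hlow
    apply F.d_basis_ne_zero 0 t
    have hmem := F.d_homogeneous 0 _ _ (basis_mem_freeGr (F.deg 1) t)
    have hin := (hk _).1 (F.exact_aug.apply_apply_eq_zero (Pi.single t 1))
    funext s
    rw [h0 s]
    rw [zero_add] at hlt
    have hm := (hmem t₀).1 (by omega)
    exact hlow _ hin _ (by rw [hd]; exact Nat.le_of_lt_succ (not_le.1 hlt)) hm
  | succ i ih =>
    by_contra hlt
    apply F.d_basis_ne_zero (i + 1) t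
    have hmem := F.d_homogeneous (i + 1) _ _ (basis_mem_freeGr (F.deg (i + 2)) t)
    funext s
    have hs := ih s
    by_cases h : F.deg (i + 1) s ≤ F.deg (i + 2) t
    · have hm := (hmem s).1 h
      have hlt : ¬ i + 1 + 2 ≤ F.deg (i + 2) t := hlt
      rw [show F.deg (i + 2) t - F.deg (i + 1) s = 0 by omega] at hm
      exact eq_zero_of_mem_zero hm (F.minimal _ _ _)
    · exact (hmem s).2 (by omega)

/-- Dimension shifting along the resolution. -/
theorem cartanExact_range {q} (hq : IsGradingProj (quotGrading I) q) {c : ℕ}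
    (hA : ∀ p d, c ≤ d → CartanExact (n := n) (quotGrading I) p d) (i p d : ℕ)
    (hd : c + i + 1 ≤ d) :
    CartanExact (n := n) (fun j => freeGr (F.deg i) j ⊓ rangeK (F.d i)) p d := by
  induction i generalizing p d with
  | zero =>
    obtain ⟨d, rfl⟩ := Nat.exists_eq_succ_of_ne_zero (show d ≠ 0 by omega)
    rw [← F.kerK_aug]
    refine CartanExact.ker hq F.aug_homogeneous F.algebraMapInv_of_aug_eq_zero ?_
    have : rangeK F.aug = ⊤ :=
      (Submodule.eq_top_iff').2 fun x => F.aug_surjective x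
    rw [this]
    simp only [inf_top_eq]
    exact hA (p + 1) d (by omega)
  | succ i ih =>
    obtain ⟨d, rfl⟩ := Nat.exists_eq_succ_of_ne_zero (show d ≠ 0 by omega)
    rw [← F.kerK_d i]
    exact CartanExact.ker (isGradingProj_free _) (F.d_homogeneous i)
      (F.algebraMapInv_of_d_eq_zero i) (ih (p + 1) d (by omega))

include hI in
/-- Vanishing of the Cartan homology of the quotient bounds the degrees of all generators: a basis
element of larger degree would map to a combination of boundaries of degree one less, and so be
redundant. -/
theorem deg_le {c : ℕ} (hA : ∀ p d, c ≤ d → CartanExact (n := n) (quotGrading I) p d)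
    (i : ℕ) (t) : F.deg (i + 1) t ≤ c + i + 1 := by
  obtain ⟨q, hq⟩ := exists_isGradingProj_quotGrading hI
  by_contra hlt
  obtain ⟨d, hd⟩ := Nat.exists_eq_succ_of_ne_zero (show F.deg (i + 1) t ≠ 0 by omega)
  have hex := F.cartanExact_range hq hA i 0 d (by omega)
  let x : (Fin n →₀ ℕ) → Fin (F.rank i) → ExtAlg k n :=
    fun α => if α = 0 then F.d i (Pi.single t 1) else 0
  have hx : x ∈ cycles (freeGr (F.deg i) (d + 1) ⊓ rangeK (F.d i)) 0 := by
    rw [cycles_zero]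
    intro α
    dsimp only [x]
    split_ifs with h
    · refine ⟨⟨?_, _, rfl⟩, fun h' => ?_⟩
      · have hb := basis_mem_freeGr (k := k) (n := n) (F.deg (i + 1)) t
        rw [hd] at hb
        exact F.d_homogeneous i _ _ hb
      · exact absurd (by rw [h, map_zero]) h'
    · exact ⟨Submodule.zero_mem _, fun _ => rfl⟩
  obtain ⟨y, hy, hyx⟩ := hex x hx
  have hy' : ∀ a, ∃ z, F.d i z = y (Finsupp.single a 1) := fun a => (hy _).1.2
  choose z hz using hy'
  have h0 : F.d i (Pi.single t 1 - ∑ a, gen k n a • z a) = 0 := by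
    have := congrFun hyx 0
    dsimp only [x] at this
    rw [if_pos rfl, cartanD_apply] at this
    rw [map_sub, ← this, map_sum, sub_eq_zero]
    refine Finset.sum_congr rfl fun a _ => ?_
    rw [map_smul, hz, zero_add]
  have := F.algebraMapInv_of_d_eq_zero i _ h0 t
  rw [Pi.sub_apply, map_sub, Pi.single_eq_same, map_one, Finset.sum_apply, map_sum,
    Finset.sum_eq_zero, sub_zero] at this
  · exact one_ne_zero this
  · intro a _
    exact algebraMapInv_gen_mul _ _

include hI hlow in
/-- Dimension shifting in the lowest degree of each syzygy module, down to the ideal. -/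
theorem finrank_cycles_range (i p : ℕ) :
    Module.finrank k (cycles (n := n) (freeGr (F.deg i) (i + 2) ⊓ rangeK (F.d i)) p) =
      Module.finrank k (cycles (n := n) (idealGr I 2) (p + i)) := by
  induction i generalizing p with
  | zero =>
    obtain ⟨t₀, h0, hd, hk⟩ := F.exists_unique_basis_zero hI hlow
    let ev : ((Fin n →₀ ℕ) → Fin (F.rank 0) → ExtAlg k n) →ₗ[k] ((Fin n →₀ ℕ) → ExtAlg k n) :=
      LinearMap.pi fun α => LinearMap.proj t₀ ∘ₗ LinearMap.proj α
    have hev : ∀ x α, ev x α = x α t₀ := fun _ _ => rfl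
    have hevD : ∀ x, ev (cartanD k x) = cartanD k (ev x) := by
      intro x
      ext β
      rw [hev, cartanD_apply, cartanD_apply, Finset.sum_apply]
      rfl
    have hinj : ∀ x, ev x = 0 → x = 0 := by
      intro x hx
      funext α t
      rw [h0 t]
      exact congrFun hx α
    have hmem : ∀ y : Fin (F.rank 0) → ExtAlg k n,
        y ∈ freeGr (F.deg 0) (0 + 2) ⊓ rangeK (F.d 0) ↔ y t₀ ∈ idealGr I 2 := by
      intro y
      rw [← F.kerK_aug, mem_idealGr, ← hk]
      refine and_congr_left fun _ => ⟨fun h => ?_, fun h t => ?_⟩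
      · have := (h t₀).1 (by omega)
        rwa [hd] at this
      · rw [h0 t, hd]
        exact ⟨fun _ => h, fun h => by omega⟩
    rw [← finrank_map_of_injOn ev _ fun x _ => hinj x]
    suffices h : (cycles (freeGr (F.deg 0) (0 + 2) ⊓ rangeK (F.d 0)) p).map ev =
        cycles (idealGr I 2) (p + 0) by rw [h]
    refine le_antisymm ?_ fun x hx => ?_
    · rintro _ ⟨x, hx, rfl⟩
      refine mem_cycles.2 ⟨fun α => ⟨(hmem _).1 (hx.1 α).1, fun hα => ?_⟩, ?_⟩
      · rw [hev, (hx.1 α).2 hα, Pi.zero_apply]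
      · rw [← hevD, (mem_cycles.1 hx).2, map_zero]
    · have e : ev (fun α _ => x α) = x := rfl
      refine ⟨fun α _ => x α, mem_cycles.2 ⟨fun α => ⟨(hmem _).2 (hx.1 α).1, fun hα => ?_⟩, ?_⟩, e⟩
      · funext t
        exact (hx.1 α).2 hα
      · apply hinj
        rw [hevD, e, (mem_cycles.1 hx).2]
  | succ i ih =>
    rw [← F.kerK_d i, show i + 1 + 2 = (i + 2) + 1 by omega,
      finrank_cycles_ker (isGradingProj_free (F.deg i)) (F.d_homogeneous i)
        (F.algebraMapInv_of_d_eq_zero i) (F.le_deg hI hlow i) p, ih, add_right_comm, add_assoc]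

/-- Rank and nullity of a differential in a fixed degree. -/
theorem finrank_freeGr_succ (i j : ℕ) :
    Module.finrank k (freeGr (k := k) (n := n) (F.deg (i + 1)) j) =
      Module.finrank k ↥(freeGr (F.deg i) j ⊓ rangeK (F.d i)) +
      Module.finrank k ↥(freeGr (F.deg (i + 1)) j ⊓ rangeK (F.d (i + 1))) := by
  let f := ((F.d i).restrictScalars k).domRestrict (freeGr (F.deg (i + 1)) j)
  rw [← LinearMap.finrank_range_add_finrank_ker f]
  congr 1
  · suffices h : freeGr (F.deg i) j ⊓ rangeK (F.d i) = LinearMap.range f by rw [h]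
    rw [LinearMap.range_domRestrict]
    symm
    refine le_antisymm ?_ fun m hm => ?_
    · rintro _ ⟨x, hx, rfl⟩
      exact ⟨F.d_homogeneous i _ _ hx, x, rfl⟩
    · exact exists_lift (isGradingProj_free (F.deg i)) (F.d_homogeneous i) hm
  · rw [← F.kerK_d i, ← Submodule.map_comap_subtype, finrank_map_of_injOn]
    · rfl
    · exact fun x _ hx => Subtype.ext hx

include hI hlow in
theorem finrank_range_zero (j : ℕ) :
    Module.finrank k ↥(freeGr (F.deg 0) j ⊓ rangeK (F.d 0)) = Module.finrank k (idealGr I j) := by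
  obtain ⟨t₀, h0, hd, hk⟩ := F.exists_unique_basis_zero hI hlow
  let ev : (Fin (F.rank 0) → ExtAlg k n) →ₗ[k] ExtAlg k n := LinearMap.proj t₀
  rw [← finrank_map_of_injOn ev]
  · suffices h : (freeGr (F.deg 0) j ⊓ rangeK (F.d 0)).map ev = idealGr I j by rw [h]
    have hmem : ∀ y : Fin (F.rank 0) → ExtAlg k n,
        y ∈ freeGr (F.deg 0) j ⊓ rangeK (F.d 0) ↔ y t₀ ∈ idealGr I j := by
      intro y
      rw [← F.kerK_aug, mem_idealGr, ← hk]
      refine and_congr_left fun _ => ⟨fun h => ?_, fun h t => ?_⟩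
      · have := (h t₀).1 (by omega)
        rwa [hd] at this
      · rw [h0 t, hd]
        exact ⟨fun _ => h, fun h => by omega⟩
    refine le_antisymm ?_ fun x hx => ⟨fun _ => x, (hmem _).2 hx, rfl⟩
    rintro _ ⟨x, hx, rfl⟩
    exact (hmem x).1 hx
  · intro x _ hx
    funext t
    rw [h0 t]
    exact hx

theorem finrank_freeGr_eq_betti {i j : ℕ} (h : ∀ t, j ≤ F.deg i t) :
    Module.finrank k (freeGr (k := k) (n := n) (F.deg i) j) = F.betti i j := by
  rw [finrank_freeGr, betti, Finset.card_filter]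
  refine Finset.sum_congr rfl fun t _ => ?_
  have := h t
  by_cases e : F.deg i t = j
  · rw [if_pos e, if_pos e.le, e, Nat.sub_self, Nat.choose_zero_right]
  · rw [if_neg e, if_neg (by omega)]

include hI hlow in
/-- The linear strand consists of the Cartan cycles with values in the quadratic part of the
ideal. -/
theorem betti_linear (i : ℕ) :
    F.betti (i + 1) (i + 2) = Module.finrank k (cycles (n := n) (idealGr I 2) i) := by
  have hfin : Module.Finite k ↥(freeGr (F.deg i) (i + 2) ⊓ rangeK (F.d i)) :=
    Submodule.finiteDimensional_of_le (S₂ := freeGr (F.deg i) (i + 2)) inf_le_left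
  have h1 : freeGr (F.deg (i + 1)) (i + 2) ⊓ rangeK (F.d (i + 1)) = ⊥ := by
    rw [← F.kerK_d i, Submodule.eq_bot_iff]
    rintro x ⟨hx, hx0⟩
    funext t
    have ht := F.le_deg hI hlow i t
    by_cases h : i + 2 < F.deg (i + 1) t
    · exact (hx t).2 h
    · have hm := (hx t).1 (by omega)
      rw [show i + 2 - F.deg (i + 1) t = 0 by omega] at hm
      exact eq_zero_of_mem_zero hm (F.algebraMapInv_of_d_eq_zero i x hx0 t)
  rw [← F.finrank_freeGr_eq_betti (F.le_deg hI hlow i), F.finrank_freeGr_succ, h1, finrank_bot,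
    add_zero, ← zero_add i, ← F.finrank_cycles_range hI hlow, cycles_zero, zero_add, finrank_chains,
    Nat.choose_zero_right, one_mul]

theorem betti_eq_zero {i j : ℕ} (h : ∀ t, F.deg i t ≠ j) : F.betti i j = 0 :=
  Finset.card_eq_zero.2 (Finset.filter_eq_empty_iff.2 fun t _ => h t)

end MinimalFreeResolution

/-! ### Linear change of coordinates in the Cartan complex -/

section Pull

open ExtAlg

variable {k : Type*} [Field k] {n m l : ℕ}

/-- The linear map on polynomials that takes the values `x α` on the monomials; this identifies
elements of the Cartan complex with functionals on the polynomial ring. -/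
def polyEval {M : Type*} [AddCommGroup M] [Module k M] (x : (Fin n →₀ ℕ) → M) :
    MvPolynomial (Fin n) k →ₗ[k] M :=
  (MvPolynomial.basisMonomials (Fin n) k).constr k x

theorem polyEval_monomial {M : Type*} [AddCommGroup M] [Module k M] (x : (Fin n →₀ ℕ) → M)
    (α : Fin n →₀ ℕ) : polyEval (k := k) x (MvPolynomial.monomial α 1) = x α := by
  have h : MvPolynomial.basisMonomials (Fin n) k α = MvPolynomial.monomial α 1 :=
    congrFun (MvPolynomial.coe_basisMonomials _ _) α
  rw [polyEval, ← h, Module.Basis.constr_basis]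

theorem poly_hom_ext {M : Type*} [AddCommGroup M] [Module k M]
    {f g : MvPolynomial (Fin n) k →ₗ[k] M}
    (h : ∀ α, f (MvPolynomial.monomial α 1) = g (MvPolynomial.monomial α 1)) : f = g :=
  (MvPolynomial.basisMonomials (Fin n) k).ext fun α => by
    rw [MvPolynomial.coe_basisMonomials]
    exact h α

theorem polyEval_mem {M : Type*} [AddCommGroup M] [Module k M] {P : Submodule k M}
    {x : (Fin n →₀ ℕ) → M} (hx : ∀ α, x α ∈ P) (f : MvPolynomial (Fin n) k) :
    polyEval x f ∈ P := by
  rw [polyEval, Module.Basis.constr_apply]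
  exact Submodule.sum_mem _ fun α _ => P.smul_mem _ (hx α)

theorem polyEval_eq_zero {M : Type*} [AddCommGroup M] [Module k M] {P : Submodule k M} {p e : ℕ}
    {x : (Fin n →₀ ℕ) → M} (hx : x ∈ chains P p) {f : MvPolynomial (Fin n) k}
    (hf : f.IsHomogeneous e) (he : e ≠ p) : polyEval x f = 0 := by
  rw [polyEval, Module.Basis.constr_apply]
  refine Finset.sum_eq_zero fun α hα => ?_
  have h1 : MvPolynomial.coeff α f ≠ 0 := Finsupp.mem_support_iff.1 hα
  have h2 := hf h1
  dsimp only
  rw [(hx α).2, smul_zero]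
  have h3 : α.degree = Finsupp.weight 1 α :=
    DFunLike.congr_fun (Finsupp.degree_eq_weight_one (R := ℕ)) α
  rw [h3, h2]
  exact he

theorem polyEval_cartanD (x : (Fin n →₀ ℕ) → ExtAlg k n) (f : MvPolynomial (Fin n) k) :
    polyEval (cartanD k x) f = ∑ a, gen k n a * polyEval x (MvPolynomial.X a * f) := by
  have : polyEval (k := k) (cartanD k x) =
      ∑ a, LinearMap.mulLeft k (gen k n a) ∘ₗ polyEval x ∘ₗ
        LinearMap.mulLeft k (MvPolynomial.X a) := by
    refine poly_hom_ext fun α => ?_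
    rw [polyEval_monomial, cartanD_apply, LinearMap.sum_apply]
    refine Finset.sum_congr rfl fun a _ => ?_
    simp only [LinearMap.comp_apply, LinearMap.mulLeft_apply]
    rw [MvPolynomial.X, MvPolynomial.monomial_mul, one_mul, polyEval_monomial, add_comm,
      smul_eq_mul]
  rw [this, LinearMap.sum_apply]
  rfl

/-- The map induced on polynomial functions by a linear map `j`. -/
def symMap (j : (Fin m → k) →ₗ[k] (Fin n → k)) :
    MvPolynomial (Fin n) k →ₐ[k] MvPolynomial (Fin m) k :=
  MvPolynomial.aeval fun a => ∑ c, j (Pi.single c 1) a • MvPolynomial.X c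

theorem symMap_X (j : (Fin m → k) →ₗ[k] (Fin n → k)) (a : Fin n) :
    symMap j (MvPolynomial.X a) = ∑ c, j (Pi.single c 1) a • MvPolynomial.X c :=
  MvPolynomial.aeval_X _ _

theorem apply_eq_sum (j : (Fin m → k) →ₗ[k] (Fin n → k)) (v : Fin m → k) (a : Fin n) :
    j v a = ∑ c, v c * j (Pi.single c 1) a := by
  conv_lhs => rw [pi_eq_sum_univ' v, map_sum, Finset.sum_apply]
  refine Finset.sum_congr rfl fun c _ => ?_
  rw [map_smul, Pi.smul_apply, smul_eq_mul]

theorem symMap_symMap (j : (Fin m → k) →ₗ[k] (Fin n → k)) (q : (Fin n → k) →ₗ[k] (Fin l → k))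
    (f : MvPolynomial (Fin l) k) : symMap j (symMap q f) = symMap (q ∘ₗ j) f := by
  suffices h : (symMap j).comp (symMap q) = symMap (q ∘ₗ j) from DFunLike.congr_fun h f
  refine MvPolynomial.algHom_ext fun b => ?_
  rw [AlgHom.comp_apply, symMap_X, symMap_X, map_sum]
  simp only [map_smul, symMap_X, Finset.smul_sum, smul_smul]
  rw [Finset.sum_comm]
  refine Finset.sum_congr rfl fun c _ => ?_
  rw [← Finset.sum_smul, LinearMap.comp_apply, apply_eq_sum q]
  congr 1
  exact Finset.sum_congr rfl fun a _ => mul_comm _ _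

theorem symMap_id (f : MvPolynomial (Fin n) k) : symMap LinearMap.id f = f := by
  suffices h : symMap LinearMap.id = AlgHom.id k (MvPolynomial (Fin n) k) from
    DFunLike.congr_fun h f
  refine MvPolynomial.algHom_ext fun b => ?_
  rw [symMap_X, Finset.sum_eq_single b]
  · simp
  · intro c _ hc
    simp [Pi.single_eq_of_ne (Ne.symm hc)]
  · simp

theorem symMap_homogeneous (j : (Fin m → k) →ₗ[k] (Fin n → k)) (α : Fin n →₀ ℕ) :
    (symMap j (MvPolynomial.monomial α 1)).IsHomogeneous α.degree := by
  have h := (MvPolynomial.isHomogeneous_monomial (R := k) 1 (rfl : α.degree = α.degree)).aeval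
    (fun a => ∑ c, j (Pi.single c 1) a • (MvPolynomial.X c : MvPolynomial (Fin m) k)) (n := 1)
    fun a => ?_
  · rwa [one_mul] at h
  · refine MvPolynomial.IsHomogeneous.sum _ _ _ fun c _ => ?_
    rw [MvPolynomial.smul_eq_C_mul]
    simpa using (MvPolynomial.isHomogeneous_C (Fin m) (j (Pi.single c 1) a)).mul
      (MvPolynomial.isHomogeneous_X k c)

/-- Functoriality of the Cartan complex of the exterior algebra in the underlying vector space:
on exterior powers it is induced by `j`, on functionals on polynomials by precomposition with
`symMap j`. -/
def pull (j : (Fin m → k) →ₗ[k] (Fin n → k)) :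
    ((Fin m →₀ ℕ) → ExtAlg k m) →ₗ[k] ((Fin n →₀ ℕ) → ExtAlg k n) :=
  LinearMap.pi fun α => (ExteriorAlgebra.map j).toLinearMap ∘ₗ
    (LinearMap.applyₗ (symMap j (MvPolynomial.monomial α 1))) ∘ₗ
    ((MvPolynomial.basisMonomials (Fin m) k).constr k).toLinearMap

theorem pull_apply (j : (Fin m → k) →ₗ[k] (Fin n → k)) (x : (Fin m →₀ ℕ) → ExtAlg k m)
    (α : Fin n →₀ ℕ) : pull j x α =
      ExteriorAlgebra.map j (polyEval x (symMap j (MvPolynomial.monomial α 1))) := rfl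

theorem polyEval_pull (j : (Fin m → k) →ₗ[k] (Fin n → k)) (x : (Fin m →₀ ℕ) → ExtAlg k m)
    (f : MvPolynomial (Fin n) k) :
    polyEval (pull j x) f = ExteriorAlgebra.map j (polyEval x (symMap j f)) := by
  have : polyEval (pull j x) = (ExteriorAlgebra.map j).toLinearMap ∘ₗ polyEval x ∘ₗ
      (symMap j).toLinearMap := by
    refine poly_hom_ext fun α => ?_
    rw [polyEval_monomial]
    rfl
  rw [this]
  rfl

theorem cartanD_pull (j : (Fin m → k) →ₗ[k] (Fin n → k)) (x : (Fin m →₀ ℕ) → ExtAlg k m) :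
    cartanD k (pull j x) = pull j (cartanD k x) := by
  funext β
  have h1 : cartanD k (pull j x) β =
      polyEval (cartanD k (pull j x)) (MvPolynomial.monomial β (1 : k)) :=
    (polyEval_monomial _ _).symm
  rw [h1, polyEval_cartanD, pull_apply, polyEval_cartanD, map_sum]
  have h2 : ∀ c, ExteriorAlgebra.map j (gen k m c) = ∑ a, j (Pi.single c 1) a • gen k n a := by
    intro c
    rw [gen, ExteriorAlgebra.map_apply_ι, ι_eq_sum]
  simp only [polyEval_pull, map_mul, symMap_X, h2, Finset.sum_mul, map_sum, Finset.mul_sum,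
    smul_mul_assoc, map_smul, mul_smul_comm]
  rw [Finset.sum_comm]

theorem pull_pull (j : (Fin m → k) →ₗ[k] (Fin n → k)) (q : (Fin n → k) →ₗ[k] (Fin l → k))
    (x : (Fin m →₀ ℕ) → ExtAlg k m) : pull q (pull j x) = pull (q ∘ₗ j) x := by
  funext α
  rw [pull_apply, polyEval_pull, symMap_symMap, pull_apply, ← AlgHom.comp_apply,
    ExteriorAlgebra.map_comp_map]

theorem pull_id (x : (Fin n →₀ ℕ) → ExtAlg k n) : pull LinearMap.id x = x := by
  funext α
  rw [pull_apply, symMap_id, polyEval_monomial, ExteriorAlgebra.map_id, AlgHom.id_apply]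

theorem pull_mem_chains (j : (Fin m → k) →ₗ[k] (Fin n → k)) {P : Submodule k (ExtAlg k m)}
    {p : ℕ} {x : (Fin m →₀ ℕ) → ExtAlg k m} (hx : x ∈ chains P p) :
    pull j x ∈ chains (P.map (ExteriorAlgebra.map j).toLinearMap) p := by
  intro α
  rw [pull_apply]
  refine ⟨⟨_, polyEval_mem (fun β => (hx β).1) _, rfl⟩, fun hα => ?_⟩
  rw [polyEval_eq_zero hx (symMap_homogeneous j α) hα, map_zero]

theorem contract_map (j : (Fin m → k) →ₗ[k] (Fin n → k)) (ℓ : Module.Dual k (Fin n → k))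
    (x : ExtAlg k m) :
    contract ℓ (ExteriorAlgebra.map j x) = ExteriorAlgebra.map j (contract (ℓ ∘ₗ j) x) := by
  induction x using induction_homogeneous with
  | h0 => simp
  | hadd x y hx hy => simp [hx, hy]
  | hom d x hx =>
    induction d generalizing x with
    | zero =>
      obtain ⟨c, rfl⟩ := mem_power_zero.1 hx
      rw [AlgHom.commutes, contract_algebraMap, contract_algebraMap, map_zero]
    | succ d ih =>
      obtain ⟨y, hy, rfl⟩ := exists_gen_mul_of_mem_succ hx
      simp only [map_sum, map_mul, gen, ExteriorAlgebra.map_apply_ι, contract_ι_mul, map_sub,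
        map_smul, LinearMap.comp_apply]
      refine Finset.sum_congr rfl fun a _ => ?_
      rw [ih _ (hy a)]

/-- A cycle whose values lie over the image of an idempotent `g` is supported on the coordinates of
that image: contracting the cycle condition by a form vanishing on the image shows that the cycle
kills every multiple of that form. -/
theorem pull_eq_self {g : (Fin n → k) →ₗ[k] (Fin n → k)} (hg : g ∘ₗ g = g)
    {P : Submodule k (ExtAlg k n)} (hP : ∀ u ∈ P, ExteriorAlgebra.map g u = u)
    {p : ℕ} {x : (Fin n →₀ ℕ) → ExtAlg k n} (hx : x ∈ cycles P p) : pull g x = x := by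
  have hval : ∀ f : MvPolynomial (Fin n) k, polyEval x f ∈ P :=
    polyEval_mem fun α => (hx.1 α).1
  have key : ∀ (a : Fin n) (h : MvPolynomial (Fin n) k),
      polyEval x (symMap g (MvPolynomial.X a) * h) = polyEval x (MvPolynomial.X a * h) := by
    intro a h
    let ℓ : Module.Dual k (Fin n → k) := LinearMap.proj a - LinearMap.proj a ∘ₗ g
    have hℓ : ℓ ∘ₗ g = 0 := by
      rw [LinearMap.sub_comp, LinearMap.comp_assoc, hg, sub_self]
    have hkill : ∀ f : MvPolynomial (Fin n) k, contract ℓ (polyEval x f) = 0 := by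
      intro f
      rw [← hP _ (hval f), contract_map, hℓ]
      simp [contract]
    have h1 := congrArg (contract ℓ) (polyEval_cartanD x h)
    rw [(mem_cycles.1 hx).2, map_sum] at h1
    have h2 : polyEval (0 : (Fin n →₀ ℕ) → ExtAlg k n) h = 0 := by
      rw [polyEval, map_zero, LinearMap.zero_apply]
    rw [h2, map_zero] at h1
    simp only [gen, contract_ι_mul, hkill, mul_zero, sub_zero] at h1
    have h3 : ∑ b, ℓ (Pi.single b 1) • (MvPolynomial.X b * h) =
        MvPolynomial.X a * h - symMap g (MvPolynomial.X a) * h := by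
      simp only [ℓ, LinearMap.sub_apply, LinearMap.comp_apply, LinearMap.proj_apply, sub_smul,
        Finset.sum_sub_distrib, symMap_X, Finset.sum_mul, smul_mul_assoc]
      congr 1
      rw [Finset.sum_eq_single a]
      · rw [Pi.single_eq_same, one_smul]
      · intro b _ hb
        rw [Pi.single_eq_of_ne (Ne.symm hb), zero_smul]
      · simp
    have h4 := congrArg (polyEval x) h3
    rw [map_sum] at h4
    simp only [map_smul] at h4
    rw [← h1, map_sub] at h4
    exact (sub_eq_zero.1 h4.symm).symm
  have key2 : ∀ f h : MvPolynomial (Fin n) k,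
      polyEval x (symMap g f * h) = polyEval x (f * h) := by
    intro f
    induction f using MvPolynomial.induction_on with
    | C c => intro h; rw [← MvPolynomial.algebraMap_eq, AlgHom.commutes]
    | add f₁ f₂ h₁ h₂ => intro h; rw [map_add, add_mul, add_mul, map_add, map_add, h₁, h₂]
    | mul_X f a hf =>
      intro h
      rw [map_mul (symMap g), mul_assoc, hf, mul_left_comm, key, mul_left_comm, mul_assoc]
  funext α
  have := key2 (MvPolynomial.monomial α 1) 1
  rw [mul_one, mul_one] at this
  rw [pull_apply, hP _ (hval _), this, polyEval_monomial]

/-- The subspace of the exterior square spanned by products of vectors of `W`. -/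
def extSquare (W : Submodule k (Fin n → k)) : Submodule k (ExtAlg k n) :=
  (W.map (ExteriorAlgebra.ι k)) ^ 2

theorem map_power_two (j : (Fin m → k) →ₗ[k] (Fin n → k)) :
    (⋀[k]^2 (Fin m → k)).map (ExteriorAlgebra.map j).toLinearMap =
      extSquare (LinearMap.range j) := by
  rw [ExteriorAlgebra.exteriorPower, Submodule.map_pow, extSquare, ← LinearMap.range_comp, ← LinearMap.range_comp,
    ExteriorAlgebra.map_comp_ι]

theorem finrank_cycles_extSquare_range {j : (Fin m → k) →ₗ[k] (Fin n → k)}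
    (hj : LinearMap.ker j = ⊥) (p : ℕ) :
    Module.finrank k (cycles (n := n) (extSquare (LinearMap.range j)) p) =
      Module.finrank k (cycles (n := m) (⋀[k]^2 (Fin m → k)) p) := by
  obtain ⟨q, hq⟩ := LinearMap.exists_leftInverse_of_injective j hj
  rw [← map_power_two, ← finrank_map_of_injOn (pull j)]
  · suffices h : (cycles (⋀[k]^2 (Fin m → k)) p).map (pull j) =
        cycles ((⋀[k]^2 (Fin m → k)).map (ExteriorAlgebra.map j).toLinearMap) p by rw [h]
    refine le_antisymm ?_ fun x hx => ?_
    · rintro _ ⟨x, hx, rfl⟩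
      refine mem_cycles.2 ⟨pull_mem_chains j hx.1, ?_⟩
      rw [cartanD_pull, (mem_cycles.1 hx).2, map_zero]
    · have hqj : ∀ u, ExteriorAlgebra.map q (ExteriorAlgebra.map j u) = u := by
        intro u
        rw [← AlgHom.comp_apply, ExteriorAlgebra.map_comp_map, hq, ExteriorAlgebra.map_id,
          AlgHom.id_apply]
      refine ⟨pull q x, mem_cycles.2 ⟨?_, ?_⟩, ?_⟩
      · refine chains_mono ?_ p (pull_mem_chains q hx.1)
        rintro _ ⟨_, ⟨u, hu, rfl⟩, rfl⟩
        exact (hqj u).symm ▸ hu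
      · rw [cartanD_pull, (mem_cycles.1 hx).2, map_zero]
      · rw [pull_pull]
        refine pull_eq_self ?_ ?_ hx
        · rw [LinearMap.comp_assoc, ← LinearMap.comp_assoc q j q, hq, LinearMap.id_comp]
        · rintro _ ⟨u, -, rfl⟩
          rw [← ExteriorAlgebra.map_comp_map, AlgHom.comp_apply]
          exact congrArg _ (hqj u)
  · intro x _ hx
    rw [← pull_id x, ← hq, ← pull_pull, hx, map_zero]

/-! ### The linear strand of a local arrangement -/

theorem exists_cartanD_eq_of_mem_cycles_power {d p : ℕ} {x : (Fin n →₀ ℕ) → ExtAlg k n}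
    (hx : x ∈ cycles (⋀[k]^(d + 1) (Fin n → k)) p) :
    ∃ y ∈ chains (⋀[k]^d (Fin n → k)) (p + 1), cartanD k y = x := by
  rcases p with _ | p
  · obtain ⟨y, hy, e⟩ := exists_gen_mul_of_mem_succ (hx.1 0).1
    exact exists_cartanD_eq_of_zero hx.1 hy e
  · exact exists_cartanD_eq (M := ExtAlg k n) partialD (fun a b m => partialD_gen_mul a b m)
      (fun a m hm => contract_mem _ hm) (fun a m hm => gen_mul_mem a hm) hx

theorem finrank_cycles_power_succ (d p : ℕ) :
    Module.finrank k (chains (n := n) (⋀[k]^d (Fin n → k)) (p + 1)) =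
      Module.finrank k (cycles (n := n) (⋀[k]^(d + 1) (Fin n → k)) p) +
      Module.finrank k (cycles (n := n) (⋀[k]^d (Fin n → k)) (p + 1)) := by
  let f := (cartanD k (n := n) (M := ExtAlg k n)).domRestrict
    (chains (⋀[k]^d (Fin n → k)) (p + 1))
  rw [← LinearMap.finrank_range_add_finrank_ker f]
  congr 1
  · suffices h : LinearMap.range f = cycles (⋀[k]^(d + 1) (Fin n → k)) p by rw [h]
    rw [LinearMap.range_domRestrict]
    refine le_antisymm ?_ fun x hx => exists_cartanD_eq_of_mem_cycles_power hx
    rintro _ ⟨x, hx, rfl⟩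
    exact mem_cycles.2 ⟨cartanD_mem_chains hx fun a m hm => gen_mul_mem a hm, cartanD_cartanD x⟩
  · rw [cycles, ← Submodule.map_comap_subtype, finrank_map_of_injOn]
    · rfl
    · exact fun x _ hx => Subtype.ext hx

theorem cycles_power_zero (p : ℕ) : cycles (n := n) (⋀[k]^0 (Fin n → k)) (p + 1) = ⊥ := by
  rw [Submodule.eq_bot_iff]
  intro x hx
  obtain ⟨y, hy, rfl⟩ := exists_cartanD_eq (M := ExtAlg k n) (Q := ⊥) partialD
    (fun a b m => partialD_gen_mul a b m)
    (fun a m hm => (Submodule.mem_bot k).2 (contract_eq_zero_of_mem_zero _ hm))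
    (fun a m hm => by rw [(Submodule.mem_bot k).1 hm, smul_zero]; exact Submodule.zero_mem _) hx
  have : y = 0 := funext fun α => (Submodule.mem_bot k).1 (hy α).1
  rw [this, map_zero]

theorem mul_choose_eq (m p : ℕ) :
    m * (m + p).choose (p + 1) =
      (m + p + 1).choose (p + 2) + (p + 1) * (m + p).choose (p + 2) := by
  have h1 : (m + p + 1).choose (p + 2) = (m + p).choose (p + 1) + (m + p).choose (p + 2) :=
    Nat.choose_succ_succ _ _
  have h2 := Nat.choose_succ_right_eq (m + p) (p + 1)
  rcases m with _ | m
  · simp [Nat.choose_eq_zero_of_lt (show p < p + 2 by omega)]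
  · rw [show m + 1 + p - (p + 1) = m by omega] at h2
    rw [h1]
    linarith

theorem finrank_cycles_power_two (m p : ℕ) :
    Module.finrank k (cycles (n := m) (⋀[k]^2 (Fin m → k)) p) =
      (p + 1) * (m + p).choose (p + 2) := by
  have h1 := finrank_cycles_power_succ (k := k) (n := m) 1 p
  have h2 := finrank_cycles_power_succ (k := k) (n := m) 0 (p + 1)
  rw [cycles_power_zero, finrank_bot, add_zero, zero_add] at h2
  rw [← h2, finrank_chains, finrank_chains, finrank_power, finrank_power, Nat.choose_one_right,
    Nat.choose_zero_right, mul_one, ← add_assoc, Nat.add_sub_cancel, mul_comm, mul_choose_eq] at h1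
  rw [show m + (p + 1 + 1) - 1 = m + p + 1 by omega, show p + 1 + 1 = p + 2 from rfl,
    show 1 + 1 = 2 from rfl] at h1
  omega

/-- The Cartan cycles of degree `p` with values in the exterior square of an `m`-dimensional
space. -/
theorem finrank_cycles_extSquare (W : Submodule k (Fin n → k)) (p : ℕ) :
    Module.finrank k (cycles (n := n) (extSquare W) p) =
      (p + 1) * (Module.finrank k W + p).choose (p + 2) := by
  let e := (Module.finBasis k W).equivFun
  let j : (Fin (Module.finrank k W) → k) →ₗ[k] (Fin n → k) := W.subtype ∘ₗ e.symm.toLinearMap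
  have hj : LinearMap.ker j = ⊥ := by
    rw [LinearMap.ker_eq_bot]
    exact W.injective_subtype.comp e.symm.injective
  have hr : LinearMap.range j = W := by
    rw [LinearMap.range_comp, LinearEquiv.range, Submodule.map_top, Submodule.range_subtype]
  have h := finrank_cycles_extSquare_range hj p
  rwa [hr, finrank_cycles_power_two] at h

end Pull

/-! ### Flats of rank two -/

namespace CentralArrangement

variable {n ℓ : ℕ} (A : CentralArrangement n ℓ)

theorem codim_add_finrank (X : Submodule ℂ (Fin ℓ → ℂ)) :
    codim X + Module.finrank ℂ X = ℓ := by
  rw [codim, Submodule.finrank_quotient_add_finrank, Module.finrank_fin_fun]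

theorem eq_of_le_of_codim_le {X Y : Submodule ℂ (Fin ℓ → ℂ)} (h : X ≤ Y)
    (hc : codim X ≤ codim Y) : X = Y := by
  refine Submodule.eq_of_le_of_finrank_le h ?_
  have h1 := codim_add_finrank X
  have h2 := codim_add_finrank Y
  omega

theorem codim_anti {X Y : Submodule ℂ (Fin ℓ → ℂ)} (h : X ≤ Y) : codim Y ≤ codim X := by
  have h1 := codim_add_finrank X
  have h2 := codim_add_finrank Y
  have h3 := Submodule.finrank_mono h
  omega

theorem le_inter_iff {X : Submodule ℂ (Fin ℓ → ℂ)} {B : Finset (Fin n)} :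
    X ≤ A.inter B ↔ ∀ a ∈ B, X ≤ A.hyperplane a := le_iInf₂_iff

theorem inter_empty : A.inter ∅ = ⊤ := by simp [inter]

theorem inter_singleton (a : Fin n) : A.inter {a} = A.hyperplane a := by simp [inter]

theorem inter_pair (a b : Fin n) : A.inter {a, b} = A.hyperplane a ⊓ A.hyperplane b := by
  simp [inter, iInf_or, iInf_inf_eq]

theorem inter_anti {B C : Finset (Fin n)} (h : B ⊆ C) : A.inter C ≤ A.inter B :=
  A.le_inter_iff.2 fun a ha => A.le_inter_iff.1 le_rfl a (h ha)

theorem codim_top : codim (⊤ : Submodule ℂ (Fin ℓ → ℂ)) = 0 := by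
  have := codim_add_finrank (⊤ : Submodule ℂ (Fin ℓ → ℂ))
  rw [finrank_top, Module.finrank_fin_fun] at this
  omega

theorem codim_hyperplane (a : Fin n) : codim (A.hyperplane a) = 1 := A.codim_one a

theorem hyperplane_le_iff {a b : Fin n} : A.hyperplane a ≤ A.hyperplane b ↔ a = b := by
  refine ⟨fun h => A.injective (eq_of_le_of_codim_le h ?_), fun h => h ▸ le_rfl⟩
  rw [A.codim_hyperplane, A.codim_hyperplane]

theorem codim_pair {a b : Fin n} (hab : a ≠ b) : codim (A.inter {a, b}) = 2 := by
  rw [inter_pair]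
  have h1 := Submodule.finrank_sup_add_finrank_inf_eq (A.hyperplane a) (A.hyperplane b)
  have ha := codim_add_finrank (A.hyperplane a)
  have hb := codim_add_finrank (A.hyperplane b)
  have hi := codim_add_finrank (A.hyperplane a ⊓ A.hyperplane b)
  have hs := codim_add_finrank (A.hyperplane a ⊔ A.hyperplane b)
  rw [A.codim_hyperplane] at ha hb
  have h2 : codim (A.hyperplane a ⊔ A.hyperplane b) = 0 := by
    by_contra h
    have e : A.hyperplane b = A.hyperplane a ⊔ A.hyperplane b :=
      eq_of_le_of_codim_le le_sup_right (by rw [A.codim_hyperplane]; omega)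
    exact hab (A.hyperplane_le_iff.1 (e ▸ le_sup_left))
  omega

/-- The labels of the hyperplanes containing a flat. -/
def labels (X : A.Lattice) : Finset (Fin n) :=
  by classical exact Finset.univ.filter fun a => OrderDual.ofDual X.1 ≤ A.hyperplane a

variable {A}

theorem mem_labels {X : A.Lattice} {a : Fin n} :
    a ∈ A.labels X ↔ OrderDual.ofDual X.1 ≤ A.hyperplane a := by
  simp [labels]

theorem mem_rankTwo {X : A.Lattice} : X ∈ A.rankTwo ↔ codim (OrderDual.ofDual X.1) = 2 := by
  simp [rankTwo]

theorem ofDual_flat (B : Finset (Fin n)) : OrderDual.ofDual (A.flat B).1 = A.inter B := rfl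

theorem flat_le_iff {B : Finset (Fin n)} {X : A.Lattice} : A.flat B ≤ X ↔ B ⊆ A.labels X := by
  change OrderDual.ofDual X.1 ≤ A.inter B ↔ _
  rw [A.le_inter_iff]
  exact forall₂_congr fun a _ => mem_labels.symm

theorem flat_eq_iff {B : Finset (Fin n)} {X : A.Lattice} :
    A.flat B = X ↔ A.inter B = OrderDual.ofDual X.1 := Subtype.ext_iff

theorem flat_pair_eq {X : A.Lattice} (hX : X ∈ A.rankTwo) {a b : Fin n} (hab : a ≠ b)
    (ha : a ∈ A.labels X) (hb : b ∈ A.labels X) : A.flat {a, b} = X := by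
  rw [flat_eq_iff]
  refine (eq_of_le_of_codim_le ?_ ?_).symm
  · rw [A.le_inter_iff]
    intro c hc
    rw [Finset.mem_insert, Finset.mem_singleton] at hc
    rcases hc with rfl | rfl
    · exact mem_labels.1 ha
    · exact mem_labels.1 hb
  · rw [A.codim_pair hab, mem_rankTwo.1 hX]

theorem flat_pair_mem_rankTwo {a b : Fin n} (hab : a ≠ b) : A.flat {a, b} ∈ A.rankTwo :=
  mem_rankTwo.2 (A.codim_pair hab)

theorem subset_labels_flat (B : Finset (Fin n)) : B ⊆ A.labels (A.flat B) :=
  flat_le_iff.1 le_rfl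

theorem labels_nonempty {X : A.Lattice} (hX : X ∈ A.rankTwo) : (A.labels X).Nonempty := by
  obtain ⟨B, rfl⟩ := A.flat_surjective X
  have hB : B.Nonempty := by
    by_contra h
    rw [Finset.not_nonempty_iff_eq_empty] at h
    subst h
    have := mem_rankTwo.1 hX
    rw [ofDual_flat, A.inter_empty, codim_top] at this
    omega
  exact hB.mono (subset_labels_flat B)

theorem mobius_flat_singleton (a : Fin n) : A.mobius (A.flat {a}) = -1 := by
  have hne : A.flat ∅ ≠ A.flat {a} := by
    rw [Ne, flat_eq_iff, A.inter_empty, ofDual_flat, A.inter_singleton]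
    intro h
    have := A.codim_hyperplane a
    rw [← h, codim_top] at this
    omega
  have hIco : Finset.Ico (A.flat ∅) (A.flat {a}) = {A.flat ∅} := by
    ext Y
    rw [Finset.mem_Ico, Finset.mem_singleton]
    constructor
    · rintro ⟨-, hlt⟩
      obtain ⟨B, rfl⟩ := A.flat_surjective Y
      have hB : B ⊆ {a} := by
        intro b hb
        have := mem_labels.1 (flat_le_iff.1 hlt.le hb)
        rw [ofDual_flat, A.inter_singleton, A.hyperplane_le_iff] at this
        exact Finset.mem_singleton.2 this.symm
      rcases Finset.subset_singleton_iff.1 hB with rfl | rfl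
      · rfl
      · exact absurd hlt (lt_irrefl _)
    · rintro rfl
      exact ⟨le_rfl, lt_of_le_of_ne (flat_le_iff.2 (Finset.empty_subset _)) hne⟩
  rw [mobius, IncidenceAlgebra.mu_eq_neg_sum_Ico_of_ne hne, hIco, Finset.sum_singleton,
    IncidenceAlgebra.mu_self]

theorem mobius_rankTwo {X : A.Lattice} (hX : X ∈ A.rankTwo) :
    A.mobius X = (A.labels X).card - 1 := by
  classical
  have hne : A.flat ∅ ≠ X := by
    rw [Ne, flat_eq_iff, A.inter_empty]
    intro h
    have := mem_rankTwo.1 hX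
    rw [← h, codim_top] at this
    omega
  have hsing : ∀ a, A.flat {a} ≠ X := by
    intro a
    rw [Ne, flat_eq_iff, A.inter_singleton]
    intro h
    have := mem_rankTwo.1 hX
    rw [← h, A.codim_hyperplane] at this
    omega
  have hIco : Finset.Ico (A.flat ∅) X =
      insert (A.flat ∅) ((A.labels X).image fun a => A.flat {a}) := by
    ext Y
    rw [Finset.mem_Ico, Finset.mem_insert, Finset.mem_image]
    constructor
    · rintro ⟨-, hlt⟩
      obtain ⟨B, rfl⟩ := A.flat_surjective Y
      have hB := flat_le_iff.1 hlt.le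
      rcases B.eq_empty_or_nonempty with rfl | ⟨a, ha⟩
      · exact Or.inl rfl
      · refine Or.inr ⟨a, hB ha, ?_⟩
        congr 1
        symm
        rw [Finset.eq_singleton_iff_unique_mem]
        refine ⟨ha, fun b hb => ?_⟩
        by_contra hba
        refine absurd hlt (not_lt_of_ge ?_)
        rw [← flat_pair_eq hX hba (hB hb) (hB ha)]
        refine flat_le_iff.2 (subset_trans ?_ (subset_labels_flat B))
        intro c hc
        rw [Finset.mem_insert, Finset.mem_singleton] at hc
        rcases hc with rfl | rfl
        · exact hb
        · exact ha
    · rintro (rfl | ⟨a, ha, rfl⟩)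
      · exact ⟨le_rfl, lt_of_le_of_ne (flat_le_iff.2 (Finset.empty_subset _)) hne⟩
      · refine ⟨?_, lt_of_le_of_ne ?_ (hsing a)⟩
        · exact flat_le_iff.2 (Finset.empty_subset _)
        · exact flat_le_iff.2 (Finset.singleton_subset_iff.2 ha)
  have hinj : ∀ a b, A.flat {a} = A.flat {b} → a = b := by
    intro a b h
    rw [flat_eq_iff, ofDual_flat, A.inter_singleton, A.inter_singleton] at h
    exact A.injective h
  have hnot : A.flat ∅ ∉ (A.labels X).image fun a => A.flat {a} := by
    rw [Finset.mem_image]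
    rintro ⟨a, -, h⟩
    rw [flat_eq_iff, A.inter_singleton, ofDual_flat, A.inter_empty] at h
    have := A.codim_hyperplane a
    rw [h, codim_top] at this
    omega
  rw [mobius, IncidenceAlgebra.mu_eq_neg_sum_Ico_of_ne hne, hIco, Finset.sum_insert hnot,
    IncidenceAlgebra.mu_self, Finset.sum_image fun a _ b _ h => hinj a b h]
  have : ∀ a ∈ A.labels X, IncidenceAlgebra.mu ℤ (A.flat ∅) (A.flat {a}) = -1 :=
    fun a _ => mobius_flat_singleton a
  rw [Finset.sum_congr rfl this, Finset.sum_const]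
  simp
  ring

end CentralArrangement

/-! ### Vectors with coordinate sum zero -/

section SumZero

open ExtAlg

variable {k : Type*} [Field k] {n : ℕ}

variable (k) in
/-- The vectors supported on `S` whose coordinates add up to zero; it is spanned by the
differences `e_a - e_b` with `a, b ∈ S`. -/
def sumZero (S : Finset (Fin n)) : Submodule k (Fin n → k) where
  carrier := {v | (∀ a ∉ S, v a = 0) ∧ ∑ a, v a = 0}
  add_mem' hu hv := ⟨fun a ha => by rw [Pi.add_apply, hu.1 a ha, hv.1 a ha, add_zero], by
    simp [Finset.sum_add_distrib, hu.2, hv.2]⟩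
  zero_mem' := ⟨fun _ _ => rfl, by simp⟩
  smul_mem' c v hv := ⟨fun a ha => by rw [Pi.smul_apply, hv.1 a ha, smul_zero], by
    simp only [Pi.smul_apply, ← Finset.smul_sum, hv.2, smul_zero]⟩

theorem single_sub_single_mem_sumZero {S : Finset (Fin n)} {a b : Fin n} (ha : a ∈ S)
    (hb : b ∈ S) : (Pi.single a 1 - Pi.single b 1 : Fin n → k) ∈ sumZero k S := by
  refine ⟨fun c hc => ?_, ?_⟩
  · rw [Pi.sub_apply, Pi.single_eq_of_ne (fun h => hc (by rwa [h])),
      Pi.single_eq_of_ne (fun h => hc (by rwa [h])), sub_zero]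
  · simp [Finset.sum_sub_distrib]

theorem ι_eq_sum_of_mem_sumZero {S : Finset (Fin n)} (m : Fin n) {v : Fin n → k}
    (hv : v ∈ sumZero k S) :
    ExteriorAlgebra.ι k v = ∑ a ∈ S, v a • (gen k n a - gen k n m) := by
  have h1 : ∑ a ∈ S, v a • (gen k n a - gen k n m) = ∑ a, v a • (gen k n a - gen k n m) :=
    Finset.sum_subset (Finset.subset_univ S) fun a _ ha => by rw [hv.1 a ha, zero_smul]
  rw [h1, ι_eq_sum]
  simp only [smul_sub, Finset.sum_sub_distrib, ← Finset.sum_smul, hv.2, zero_smul, sub_zero]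

theorem finrank_sumZero {S : Finset (Fin n)} (hS : S.Nonempty) :
    Module.finrank k (sumZero k S) + 1 = S.card := by
  obtain ⟨m, hm⟩ := hS
  let f : (S → k) →ₗ[k] k := ∑ a, LinearMap.proj a
  have hf : ∀ v, f v = ∑ a, v a := fun v => by simp [f]
  let e : sumZero k S ≃ₗ[k] LinearMap.ker f :=
    { toFun := fun v => ⟨fun a => v.1 a, by
        rw [LinearMap.mem_ker, hf, Finset.sum_coe_sort S v.1, ← v.2.2]
        exact Finset.sum_subset (Finset.subset_univ S) fun a _ ha => v.2.1 a ha⟩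
      map_add' := fun _ _ => rfl
      map_smul' := fun _ _ => rfl
      invFun := fun w => ⟨fun a => if h : a ∈ S then w.1 ⟨a, h⟩ else 0,
        fun a ha => dif_neg ha, by
          have h := LinearMap.mem_ker.1 w.2
          rw [hf] at h
          refine Eq.trans ?_ h
          refine (Finset.sum_subset (Finset.subset_univ S) fun a _ ha => dif_neg ha).symm.trans ?_
          rw [← Finset.sum_coe_sort]
          exact Finset.sum_congr rfl fun a _ => dif_pos a.2⟩
      left_inv := fun v => by
        ext a
        by_cases h : a ∈ S
        · simp [h]
        · simp [h, v.2.1 a h]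
      right_inv := fun w => by
        ext a
        simp }
  have hsurj : LinearMap.range f = ⊤ := by
    rw [LinearMap.range_eq_top]
    intro c
    exact ⟨Pi.single ⟨m, hm⟩ c, by rw [hf]; simp⟩
  have h := LinearMap.finrank_range_add_finrank_ker f
  rw [hsurj, finrank_top, Module.finrank_self, Module.finrank_fintype_fun_eq_card,
    Fintype.card_coe] at h
  rw [e.finrank_eq]
  omega

end SumZero

/-! ### Products of generators and the boundary map -/

namespace ExtAlg

variable {k : Type*} [Field k] {n : ℕ}

/-- The product of the generators with labels in a list. -/
def genProd (k : Type*) [Field k] {n : ℕ} (l : List (Fin n)) : ExtAlg k n :=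
  (l.map (gen k n)).prod

theorem genProd_cons (a : Fin n) (l : List (Fin n)) :
    genProd k (a :: l) = gen k n a * genProd k l := by
  rw [genProd, List.map_cons, List.prod_cons]
  rfl

theorem genProd_perm {l l' : List (Fin n)} (h : l.Perm l') :
    genProd k l' = genProd k l ∨ genProd k l' = -genProd k l := by
  induction h with
  | nil => exact Or.inl rfl
  | cons a _ ih =>
    rw [genProd_cons, genProd_cons]
    rcases ih with h | h
    · exact Or.inl (by rw [h])
    · exact Or.inr (by rw [h, mul_neg])
  | swap a b l =>
    right
    simp only [genProd_cons, ← mul_assoc]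
    rw [gen_mul_swap a b, neg_mul]
  | trans _ _ h₁ h₂ =>
    rcases h₁ with h₁ | h₁ <;> rcases h₂ with h₂ | h₂ <;> simp [h₁, h₂]

theorem genProd_eq_monomial {l : List (Fin n)} (hl : l.Nodup) :
    genProd k l = monomial k n l.toFinset ∨ genProd k l = -monomial k n l.toFinset := by
  refine genProd_perm (l := l.toFinset.sort (· ≤ ·)) ?_
  exact List.perm_of_nodup_nodup_toFinset_eq (Finset.sort_nodup _ _) hl
    (Finset.sort_toFinset _ _)

theorem gen_mul_genProd_eq_zero {a : Fin n} {l : List (Fin n)} (h : a ∈ l) :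
    gen k n a * genProd k l = 0 := by
  induction l with
  | nil => simp at h
  | cons b l ih =>
    rw [genProd_cons, ← mul_assoc]
    by_cases hab : a = b
    · rw [hab, gen_mul_self, zero_mul]
    · rw [gen_mul_swap, neg_mul, mul_assoc, ih (by simpa [hab] using h), mul_zero, neg_zero]

theorem genProd_eq_zero {l : List (Fin n)} (h : ¬ l.Nodup) : genProd k l = 0 := by
  induction l with
  | nil => simp at h
  | cons a l ih =>
    rw [genProd_cons]
    by_cases ha : a ∈ l
    · exact gen_mul_genProd_eq_zero ha
    · rw [ih fun h' => h (List.nodup_cons.2 ⟨ha, h'⟩), mul_zero]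

theorem genProd_mem (l : List (Fin n)) : genProd k l ∈ ⋀[k]^l.length (Fin n → k) := by
  induction l with
  | nil =>
    rw [genProd, List.map_nil, List.prod_nil, ← map_one (algebraMap k (ExtAlg k n))]
    exact algebraMap_mem_zero 1
  | cons a l ih =>
    rw [genProd_cons]
    exact gen_mul_mem a ih

theorem mem_span_genProd {j : ℕ} {x : ExtAlg k n} (hx : x ∈ ⋀[k]^j (Fin n → k)) :
    x ∈ Submodule.span k {y | ∃ l : List (Fin n), l.length = j ∧ y = genProd k l} := by
  induction j generalizing x with
  | zero =>
    obtain ⟨c, rfl⟩ := mem_power_zero.1 hx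
    rw [Algebra.algebraMap_eq_smul_one]
    exact Submodule.smul_mem _ _ (Submodule.subset_span ⟨[], rfl, rfl⟩)
  | succ j ih =>
    obtain ⟨y, hy, rfl⟩ := exists_gen_mul_of_mem_succ hx
    refine Submodule.sum_mem _ fun a _ => ?_
    have h := ih (hy a)
    have h2 := Submodule.mem_map_of_mem (f := LinearMap.mulLeft k (gen k n a)) h
    rw [Submodule.map_span] at h2
    refine Submodule.span_mono ?_ h2
    rintro _ ⟨_, ⟨l, hl, rfl⟩, rfl⟩
    exact ⟨a :: l, by simp [hl], (genProd_cons a l).symm⟩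

theorem contract_mul (ℓ : Module.Dual k (Fin n → k)) {i : ℕ} {u : ExtAlg k n}
    (hu : u ∈ ⋀[k]^i (Fin n → k)) (y : ExtAlg k n) :
    contract ℓ (u * y) = contract ℓ u * y + (-1 : k) ^ i • (u * contract ℓ y) := by
  induction i generalizing u with
  | zero =>
    obtain ⟨c, rfl⟩ := mem_power_zero.1 hu
    rw [contract_algebraMap, zero_mul, zero_add, pow_zero, one_smul, ← Algebra.smul_def,
      ← Algebra.smul_def, map_smul]
  | succ i ih =>
    obtain ⟨z, hz, rfl⟩ := exists_gen_mul_of_mem_succ hu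
    simp only [Finset.sum_mul, map_sum, Finset.smul_sum, ← Finset.sum_add_distrib]
    refine Finset.sum_congr rfl fun a _ => ?_
    rw [mul_assoc, gen, contract_ι_mul, contract_ι_mul, ih (hz a), sub_mul, mul_add,
      smul_mul_assoc, mul_smul_comm, mul_assoc, mul_assoc, pow_succ, mul_neg_one, neg_smul]
    abel

theorem boundary_eq_contract (x : ExtAlg k n) : boundary k n x = contract (sumForm k n) x := rfl

theorem boundary_boundary (x : ExtAlg k n) : boundary k n (boundary k n x) = 0 :=
  CliffordAlgebra.contractLeft_contractLeft _ x

theorem boundary_mem {d : ℕ} {x : ExtAlg k n} (hx : x ∈ ⋀[k]^(d + 1) (Fin n → k)) :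
    boundary k n x ∈ ⋀[k]^d (Fin n → k) := contract_mem _ hx

theorem component_mul {i : ℕ} {u : ExtAlg k n} (hu : u ∈ ⋀[k]^i (Fin n → k)) (j : ℕ)
    (y : ExtAlg k n) :
    component j (u * y) = if i ≤ j then u * component (j - i) y else 0 := by
  induction y using induction_homogeneous with
  | h0 => simp
  | hadd x y hx hy =>
    rw [mul_add, map_add, hx, hy]
    split_ifs
    · rw [map_add, mul_add]
    · rw [add_zero]
  | hom d y hy =>
    have h := mul_mem_power hu hy
    by_cases e : i + d = j
    · subst e
      rw [component_same h, if_pos (by omega), Nat.add_sub_cancel_left, component_same hy]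
    · rw [component_of_ne h e]
      split_ifs
      · rw [component_of_ne hy (by omega), mul_zero]
      · rfl

theorem boundary_gen (a : Fin n) : boundary k n (gen k n a) = 1 := by
  have h := boundary_gen_mul k n a 1
  rwa [mul_one, boundary_one, mul_zero, sub_zero] at h

theorem boundary_genProd_two (a b m : Fin n) :
    boundary k n (genProd k [m, a, b]) = (gen k n a - gen k n m) * (gen k n b - gen k n m) := by
  have h := gen_mul_swap (k := k) a m
  simp only [genProd_cons]
  rw [show genProd k ([] : List (Fin n)) = 1 from rfl]
  simp only [boundary_gen_mul, boundary_gen, mul_sub, sub_mul, gen_mul_self, mul_one, sub_zero, h]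
  abel

end ExtAlg

/-! ### The Orlik–Solomon ideal -/

namespace CentralArrangement

open ExtAlg ExteriorAlgebra

variable {k : Type*} [Field k] {n : ℕ} {A : CentralArrangement n 3}

theorem boundary_genProd_mem_osIdeal {l : List (Fin n)} (hl : l.Nodup)
    (h : codim (A.inter l.toFinset) < l.length) : boundary k n (genProd k l) ∈ A.osIdeal k := by
  have h1 : boundary k n (monomial k n l.toFinset) ∈ A.osIdeal k :=
    Submodule.subset_span ⟨l.toFinset, 1, by rwa [List.toFinset_card_of_nodup hl],
      (mul_one _).symm⟩
  rcases genProd_eq_monomial (k := k) hl with e | e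
  · rwa [e]
  · rw [e, map_neg]
    exact neg_mem h1

theorem codim_le (X : Submodule ℂ (Fin 3 → ℂ)) : codim X ≤ 3 := by
  have := codim_add_finrank X
  omega

theorem genProd_mem_osIdeal {l : List (Fin n)} (h : 4 ≤ l.length) :
    genProd k l ∈ A.osIdeal k := by
  by_cases hl : l.Nodup
  · obtain ⟨a, l', rfl⟩ := List.exists_cons_of_length_pos (show 0 < l.length by omega)
    have h1 := boundary_genProd_mem_osIdeal (k := k) (A := A) hl (lt_of_le_of_lt (codim_le _) h)
    have h2 := (A.osIdeal k).mul_mem_left (gen k n a) h1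
    rwa [genProd_cons, boundary_gen_mul, mul_sub, ← mul_assoc, gen_mul_self, zero_mul, sub_zero,
      ← genProd_cons] at h2
  · rw [genProd_eq_zero hl]
    exact Submodule.zero_mem _

theorem power_le_osIdeal {j : ℕ} (hj : 4 ≤ j) {x : ExtAlg k n}
    (hx : x ∈ ⋀[k]^j (Fin n → k)) : x ∈ A.osIdeal k := by
  have h : Submodule.span k {y | ∃ l : List (Fin n), l.length = j ∧ y = genProd k l} ≤
      (A.osIdeal k).restrictScalars k := by
    rw [Submodule.span_le]
    rintro _ ⟨l, hl, rfl⟩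
    exact genProd_mem_osIdeal (hl ▸ hj)
  exact h (mem_span_genProd hx)

variable (A k) in
/-- The contribution of a flat of rank two to the quadratic part of the Orlik–Solomon ideal. -/
def localSquare (X : A.Lattice) : Submodule k (ExtAlg k n) :=
  extSquare (sumZero k (A.labels X))

variable (A k) in
/-- The sum of the contributions of all flats of rank two. -/
def localSum : Submodule k (ExtAlg k n) := ⨆ X : A.rankTwo, A.localSquare k X.1

theorem localSquare_le_power (X : A.Lattice) : A.localSquare k X ≤ ⋀[k]^2 (Fin n → k) :=
  pow_le_pow_left' LinearMap.map_le_range 2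

theorem localSum_le_power : A.localSum k ≤ ⋀[k]^2 (Fin n → k) :=
  iSup_le fun X => localSquare_le_power X.1

theorem sub_mul_sub_mem_osIdeal {X : A.Lattice} (hX : X ∈ A.rankTwo) {a b m : Fin n}
    (ha : a ∈ A.labels X) (hb : b ∈ A.labels X) (hm : m ∈ A.labels X) :
    (gen k n a - gen k n m) * (gen k n b - gen k n m) ∈ A.osIdeal k := by
  rw [← boundary_genProd_two]
  by_cases hl : [m, a, b].Nodup
  · refine boundary_genProd_mem_osIdeal hl ?_
    have h1 : OrderDual.ofDual X.1 ≤ A.inter [m, a, b].toFinset := by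
      rw [A.le_inter_iff]
      intro c hc
      simp only [List.mem_toFinset, List.mem_cons, List.not_mem_nil, or_false] at hc
      rcases hc with rfl | rfl | rfl
      exacts [mem_labels.1 hm, mem_labels.1 ha, mem_labels.1 hb]
    have h2 := codim_anti h1
    rw [mem_rankTwo.1 hX] at h2
    exact Nat.lt_succ_of_le h2
  · rw [genProd_eq_zero hl, map_zero]
    exact Submodule.zero_mem _

theorem localSquare_le_osIdeal {X : A.Lattice} (hX : X ∈ A.rankTwo) :
    A.localSquare k X ≤ (A.osIdeal k).restrictScalars k := by
  obtain ⟨m, hm⟩ := labels_nonempty hX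
  rw [localSquare, extSquare, pow_two, Submodule.mul_le]
  rintro _ ⟨v, hv, rfl⟩ _ ⟨w, hw, rfl⟩
  rw [ι_eq_sum_of_mem_sumZero m hv, ι_eq_sum_of_mem_sumZero m hw, Finset.sum_mul]
  refine Submodule.sum_mem _ fun a ha => ?_
  rw [Finset.mul_sum]
  refine Submodule.sum_mem _ fun b hb => ?_
  rw [smul_mul_assoc, mul_smul_comm]
  exact Submodule.smul_mem _ _ (Submodule.smul_mem _ _ (sub_mul_sub_mem_osIdeal hX ha hb hm))

theorem localSum_le_osIdeal : A.localSum k ≤ (A.osIdeal k).restrictScalars k :=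
  iSup_le fun X => localSquare_le_osIdeal X.2

/-- A dependent set of three labels lies over a single flat of rank two. -/
theorem boundary_monomial_mem_localSum {B : Finset (Fin n)} (h3 : B.card = 3)
    (h : codim (A.inter B) < B.card) : boundary k n (monomial k n B) ∈ A.localSum k := by
  obtain ⟨m, a, b, hma, hmb, hab, rfl⟩ := Finset.card_eq_three.1 h3
  have hl : [m, a, b].Nodup := by simp [hma, hmb, hab]
  have hX := flat_pair_mem_rankTwo (A := A) hma
  have hsub : ({m, a} : Finset (Fin n)) ⊆ A.labels (A.flat {m, a}) := subset_labels_flat _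
  have hm : m ∈ A.labels (A.flat {m, a}) := hsub (by simp)
  have ha : a ∈ A.labels (A.flat {m, a}) := hsub (by simp)
  have hb : b ∈ A.labels (A.flat {m, a}) := by
    have hle : A.inter {m, a, b} ≤ A.inter {m, a} := A.inter_anti (by
      intro c hc
      simp only [Finset.mem_insert, Finset.mem_singleton] at hc ⊢
      tauto)
    have e := eq_of_le_of_codim_le hle (by rw [A.codim_pair hma]; omega)
    rw [mem_labels, ofDual_flat, ← e]
    exact A.le_inter_iff.1 le_rfl b (by simp)
  have hmem : boundary k n (genProd k [m, a, b]) ∈ A.localSum k := by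
    rw [boundary_genProd_two]
    refine Submodule.mem_iSup_of_mem (⟨_, hX⟩ : A.rankTwo) ?_
    rw [localSquare, extSquare, pow_two]
    refine Submodule.mul_mem_mul ⟨_, single_sub_single_mem_sumZero ha hm, ?_⟩
      ⟨_, single_sub_single_mem_sumZero hb hm, ?_⟩ <;> rw [map_sub] <;> rfl
  have hfs : [m, a, b].toFinset = {m, a, b} := by
    ext c
    simp
  rcases genProd_eq_monomial (k := k) hl with e | e
  · rwa [e, hfs] at hmem
  · rw [e, hfs, map_neg] at hmem
    exact neg_mem_iff.1 hmem

theorem three_le_card {B : Finset (Fin n)} (h : codim (A.inter B) < B.card) : 3 ≤ B.card := by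
  by_contra hlt
  have h012 : B.card = 0 ∨ B.card = 1 ∨ B.card = 2 := by omega
  rcases h012 with h0 | h1 | h2
  · omega
  · obtain ⟨a, rfl⟩ := Finset.card_eq_one.1 h1
    rw [A.inter_singleton, A.codim_hyperplane, Finset.card_singleton] at h
    omega
  · obtain ⟨a, b, hab, rfl⟩ := Finset.card_eq_two.1 h2
    rw [A.codim_pair hab] at h
    omega

theorem monomial_mem (B : Finset (Fin n)) : monomial k n B ∈ ⋀[k]^B.card (Fin n → k) := by
  have := genProd_mem (k := k) (B.sort (· ≤ ·))
  rwa [Finset.length_sort] at this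

theorem boundary_monomial_mem_power {B : Finset (Fin n)} (h : codim (A.inter B) < B.card) :
    boundary k n (monomial k n B) ∈ ⋀[k]^(B.card - 1) (Fin n → k) := by
  have h3 := A.three_le_card h
  refine boundary_mem ?_
  rw [Nat.sub_add_cancel (by omega)]
  exact monomial_mem B

theorem component_mem_osIdeal {x : ExtAlg k n} (hx : x ∈ A.osIdeal k) (j : ℕ) :
    component j x ∈ A.osIdeal k := by
  induction hx using Submodule.span_induction generalizing j with
  | mem x hx =>
    obtain ⟨B, y, hB, rfl⟩ := hx
    rw [component_mul (boundary_monomial_mem_power hB)]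
    split_ifs
    · exact Submodule.subset_span ⟨B, _, hB, rfl⟩
    · exact Submodule.zero_mem _
  | zero => rw [map_zero]; exact Submodule.zero_mem _
  | add x y _ _ hx hy => rw [map_add]; exact Submodule.add_mem _ (hx j) (hy j)
  | smul r x _ hx =>
    rw [smul_eq_mul]
    induction r using induction_homogeneous with
    | h0 => simp
    | hadd r s hr hs => rw [add_mul, map_add]; exact Submodule.add_mem _ hr hs
    | hom i r hr =>
      rw [component_mul hr]
      split_ifs
      · exact (A.osIdeal k).mul_mem_left _ (hx _)
      · exact Submodule.zero_mem _

theorem component_low_of_mem_osIdeal {x : ExtAlg k n} (hx : x ∈ A.osIdeal k) :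
    component 0 x = 0 ∧ component 1 x = 0 ∧ component 2 x ∈ A.localSum k := by
  induction hx using Submodule.span_induction with
  | mem x hx =>
    obtain ⟨B, y, hB, rfl⟩ := hx
    have hb := boundary_monomial_mem_power (k := k) hB
    have h3 := A.three_le_card hB
    rw [component_mul hb, component_mul hb, component_mul hb, if_neg (by omega),
      if_neg (by omega)]
    refine ⟨rfl, rfl, ?_⟩
    split_ifs with h
    · rw [show 2 - (B.card - 1) = 0 by omega]
      obtain ⟨c, hc⟩ := mem_power_zero.1 (component_mem 0 y)
      rw [hc, ← Algebra.commutes, ← Algebra.smul_def]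
      exact Submodule.smul_mem _ _ (boundary_monomial_mem_localSum (by omega) hB)
    · exact Submodule.zero_mem _
  | zero => simp
  | add x y _ _ hx hy =>
    simp only [map_add, hx.1, hx.2.1, hy.1, hy.2.1, add_zero, true_and]
    exact Submodule.add_mem _ hx.2.2 hy.2.2
  | smul r x _ hx =>
    obtain ⟨h0, h1, h2⟩ := hx
    rw [smul_eq_mul]
    induction r using induction_homogeneous with
    | h0 => simp
    | hadd r s hr hs =>
      simp only [add_mul, map_add, hr.1, hr.2.1, hs.1, hs.2.1, add_zero, true_and]
      exact Submodule.add_mem _ hr.2.2 hs.2.2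
    | hom i r hr =>
      rw [component_mul hr, component_mul hr, component_mul hr]
      rcases i with _ | _ | _ | i
      · obtain ⟨c, rfl⟩ := mem_power_zero.1 hr
        simp only [Nat.zero_le, if_true, Nat.sub_zero, h0, h1, mul_zero, true_and]
        rw [← Algebra.smul_def]
        exact Submodule.smul_mem _ _ h2
      · simp [h0, h1]
      · simp [h0]
      · simp

theorem eq_zero_of_mem_osIdeal {x : ExtAlg k n} (hx : x ∈ A.osIdeal k) {j : ℕ} (hj : j ≤ 1)
    (hxj : x ∈ ⋀[k]^j (Fin n → k)) : x = 0 := by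
  obtain ⟨h0, h1, -⟩ := component_low_of_mem_osIdeal hx
  rw [← component_same hxj]
  have : j = 0 ∨ j = 1 := by omega
  rcases this with rfl | rfl
  exacts [h0, h1]

theorem idealGr_two : idealGr (A.osIdeal k) 2 = A.localSum k := by
  refine le_antisymm ?_ fun x hx => ⟨localSum_le_power hx, localSum_le_osIdeal hx⟩
  rintro x ⟨hx, hxI⟩
  rw [← component_same hx]
  exact (component_low_of_mem_osIdeal hxI).2.2

theorem idealGr_of_four_le {j : ℕ} (hj : 4 ≤ j) :
    idealGr (A.osIdeal k) j = ⋀[k]^j (Fin n → k) :=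
  le_antisymm inf_le_left fun _ hx => ⟨hx, power_le_osIdeal hj hx⟩

theorem idealGr_of_le_one {j : ℕ} (hj : j ≤ 1) : idealGr (A.osIdeal k) j = ⊥ :=
  (Submodule.eq_bot_iff _).2 fun _ hx => eq_zero_of_mem_osIdeal hx.2 hj hx.1

/-- The Orlik–Solomon ideal is stable under the boundary map, its generators being boundaries. -/
theorem boundary_mem_osIdeal {x : ExtAlg k n} (hx : x ∈ A.osIdeal k) :
    boundary k n x ∈ A.osIdeal k := by
  induction hx using Submodule.span_induction with
  | mem x hx =>
    obtain ⟨B, y, hB, rfl⟩ := hx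
    rw [boundary_eq_contract, contract_mul _ (boundary_monomial_mem_power hB),
      ← boundary_eq_contract, ← boundary_eq_contract, boundary_boundary, zero_mul, zero_add]
    exact ((A.osIdeal k).restrictScalars k).smul_mem _ (Submodule.subset_span ⟨B, _, hB, rfl⟩)
  | zero => rw [map_zero]; exact Submodule.zero_mem _
  | add x y _ _ hx hy => rw [map_add]; exact Submodule.add_mem _ hx hy
  | smul r x hxI hx =>
    rw [smul_eq_mul]
    induction r using induction_homogeneous with
    | h0 => simp
    | hadd r s hr hs => rw [add_mul, map_add]; exact Submodule.add_mem _ hr hs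
    | hom i r hr =>
      rw [boundary_eq_contract, contract_mul _ hr]
      exact Submodule.add_mem _ ((A.osIdeal k).mul_mem_left _ hxI)
        (((A.osIdeal k).restrictScalars k).smul_mem _ ((A.osIdeal k).mul_mem_left _ hx))

end CentralArrangement

/-! ### Direct sums of quadratic parts -/

section DirectSum

open ExtAlg

variable {k : Type*} [Field k]

theorem mem_iSup_iff_exists_sum {V : Type*} [AddCommGroup V] [Module k V] {ι : Type*} [Fintype ι]
    (U : ι → Submodule k V) {x : V} :
    x ∈ ⨆ i, U i ↔ ∃ u : ι → V, (∀ i, u i ∈ U i) ∧ ∑ i, u i = x := by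
  constructor
  · intro hx
    induction hx using Submodule.iSup_induction' with
    | mem i x hx =>
      classical
      refine ⟨Pi.single i x, fun j => ?_, Finset.sum_pi_single' i x _ |>.trans (by simp)⟩
      by_cases h : j = i
      · subst h; rwa [Pi.single_eq_same]
      · rw [Pi.single_eq_of_ne h]; exact Submodule.zero_mem _
    | zero => exact ⟨0, fun i => Submodule.zero_mem _, by simp⟩
    | add x y _ _ hx hy =>
      obtain ⟨u, hu, rfl⟩ := hx
      obtain ⟨v, hv, rfl⟩ := hy
      exact ⟨u + v, fun i => Submodule.add_mem _ (hu i) (hv i), by simp [Finset.sum_add_distrib]⟩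
  · rintro ⟨u, hu, rfl⟩
    exact Submodule.sum_mem _ fun i _ => Submodule.mem_iSup_of_mem i (hu i)

/-- A finite family of subspaces is independent if a sum of members vanishes only trivially. -/
def SumIndep {V : Type*} [AddCommGroup V] [Module k V] {ι : Type*} [Fintype ι]
    (U : ι → Submodule k V) : Prop :=
  ∀ u : ι → V, (∀ i, u i ∈ U i) → ∑ i, u i = 0 → ∀ i, u i = 0

theorem SumIndep.finrank_iSup {V : Type*} [AddCommGroup V] [Module k V] {ι : Type*} [Fintype ι]
    {U : ι → Submodule k V} [∀ i, Module.Finite k (U i)] (hU : SumIndep U) :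
    Module.finrank k ↥(⨆ i, U i) = ∑ i, Module.finrank k (U i) := by
  let f : ((i : ι) → U i) →ₗ[k] V := ∑ i, (U i).subtype ∘ₗ LinearMap.proj i
  have hf : ∀ u, f u = ∑ i, (u i : V) := fun u => by simp [f]
  have hr : LinearMap.range f = ⨆ i, U i := by
    ext x
    rw [mem_iSup_iff_exists_sum]
    constructor
    · rintro ⟨u, rfl⟩
      exact ⟨fun i => u i, fun i => (u i).2, (hf u).symm⟩
    · rintro ⟨u, hu, rfl⟩
      exact ⟨fun i => ⟨u i, hu i⟩, hf _⟩
  rw [← hr, LinearMap.finrank_range_of_inj, Module.finrank_pi_fintype]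
  rw [← LinearMap.ker_eq_bot, LinearMap.ker_eq_bot']
  intro u hu
  rw [hf] at hu
  exact funext fun i => Subtype.ext (hU (fun i => u i) (fun i => (u i).2) hu i)

variable {n : ℕ} {ι : Type*} [Fintype ι] {U : ι → Submodule k (ExtAlg k n)}

theorem SumIndep.cycles (hU : SumIndep U) (p : ℕ) :
    SumIndep fun i => cycles (n := n) (U i) p := by
  intro u hu h i
  funext α
  refine hU (fun i => u i α) (fun i => ((hu i).1 α).1) ?_ i
  rw [← Finset.sum_apply, h, Pi.zero_apply]

theorem iSup_cycles_le {ι : Type*} (U : ι → Submodule k (ExtAlg k n)) (p : ℕ) :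
    ⨆ i, cycles (n := n) (U i) p ≤ cycles (⨆ i, U i) p :=
  iSup_le fun i => cycles_mono (le_iSup U i) p

theorem exists_sum_chains {p : ℕ} {x : (Fin n →₀ ℕ) → ExtAlg k n}
    (hx : x ∈ chains (⨆ i, U i) p) :
    ∃ u : ι → (Fin n →₀ ℕ) → ExtAlg k n, (∀ i, u i ∈ chains (U i) p) ∧ ∑ i, u i = x := by
  have h : ∀ α, ∃ v : ι → ExtAlg k n, (∀ i, v i ∈ U i ∧ (α.degree ≠ p → v i = 0)) ∧
      ∑ i, v i = x α := by
    intro α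
    by_cases hα : α.degree = p
    · obtain ⟨v, hv, e⟩ := (mem_iSup_iff_exists_sum U).1 (hx α).1
      exact ⟨v, fun i => ⟨hv i, fun h => absurd hα h⟩, e⟩
    · exact ⟨0, fun i => ⟨Submodule.zero_mem _, fun _ => rfl⟩, by simp [(hx α).2 hα]⟩
  choose v hv e using h
  refine ⟨fun i α => v α i, fun i α => hv α i, funext fun α => ?_⟩
  rw [Finset.sum_apply, e]

/-- If the cycles in degree one split along a decomposition of the coefficients, then so do the
cycles in every degree: slicing a cycle at a multi-index `β` of complementary degree gives a cycle
of degree one. -/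
theorem cycles_iSup_eq (hU : SumIndep U)
    (h1 : cycles (n := n) (⨆ i, U i) 1 = ⨆ i, cycles (n := n) (U i) 1) (p : ℕ) :
    cycles (n := n) (⨆ i, U i) p = ⨆ i, cycles (n := n) (U i) p := by
  refine le_antisymm (fun x hx => ?_) (iSup_cycles_le U p)
  obtain ⟨u, hu, rfl⟩ := exists_sum_chains hx.1
  refine (mem_iSup_iff_exists_sum _).2 ⟨u, fun i => mem_cycles.2 ⟨hu i, ?_⟩, rfl⟩
  rcases p with _ | p
  · exact cartanD_eq_zero_of_mem_chains_zero (hu i)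
  funext β
  by_cases hβ : β.degree = p
  swap
  · refine (cartanD_mem_chains (Q := ⊤) (hu i) (fun _ _ _ => Submodule.mem_top) β).2 hβ
  let y : (Fin n →₀ ℕ) → ExtAlg k n := fun α => if α.degree = 1 then (∑ i, u i) (β + α) else 0
  have hy1 : ∀ a, y (Finsupp.single a 1) = (∑ i, u i) (β + Finsupp.single a 1) :=
    fun a => if_pos (Finsupp.degree_single a 1)
  have hy : y ∈ cycles (⨆ i, U i) 1 := by
    refine mem_cycles.2 ⟨fun α => ⟨?_, fun h => if_neg h⟩, funext fun γ => ?_⟩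
    · dsimp only [y]
      split_ifs
      · exact (hx.1 _).1
      · exact Submodule.zero_mem _
    · rw [cartanD_apply]
      by_cases hγ : γ = 0
      · subst hγ
        simp only [zero_add, hy1]
        exact congrFun (mem_cycles.1 hx).2 β
      · refine Finset.sum_eq_zero fun a _ => ?_
        have : γ.degree ≠ 0 := by rwa [Ne, Finsupp.degree_eq_zero_iff]
        have h0 : y (γ + Finsupp.single a 1) = 0 :=
          if_neg (by rw [degree_add_single]; omega)
        rw [h0, smul_zero]
  rw [h1] at hy
  obtain ⟨v, hv, hvy⟩ := (mem_iSup_iff_exists_sum _).1 hy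
  have huv : ∀ a, u i (β + Finsupp.single a 1) = v i (Finsupp.single a 1) := by
    intro a
    refine sub_eq_zero.1 (hU (fun i => u i (β + Finsupp.single a 1) - v i (Finsupp.single a 1))
      (fun i => Submodule.sub_mem _ (hu i _).1 ((hv i).1 _).1) ?_ i)
    rw [Finset.sum_sub_distrib, ← Finset.sum_apply, ← Finset.sum_apply, hvy, hy1, sub_self]
  have h0 := congrFun (mem_cycles.1 (hv i)).2 0
  rw [cartanD_apply] at h0 ⊢
  simp only [zero_add] at h0
  simp only [huv, h0]
  rfl

theorem finrank_cycles_iSup (hU : SumIndep U) [∀ i, Module.Finite k (U i)]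
    (h1 : Module.finrank k (cycles (n := n) (⨆ i, U i) 1) =
      ∑ i, Module.finrank k (cycles (n := n) (U i) 1)) (p : ℕ) :
    Module.finrank k (cycles (n := n) (⨆ i, U i) p) =
      ∑ i, Module.finrank k (cycles (n := n) (U i) p) := by
  have e : cycles (n := n) (⨆ i, U i) 1 = ⨆ i, cycles (n := n) (U i) 1 := by
    symm
    refine Submodule.eq_of_le_of_finrank_eq (iSup_cycles_le U 1) ?_
    rw [h1, (hU.cycles 1).finrank_iSup]
  rw [cycles_iSup_eq hU e p, (hU.cycles p).finrank_iSup]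

end DirectSum

namespace CentralArrangement

open ExtAlg ExteriorAlgebra

variable {k : Type*} [Field k] {n : ℕ} {A : CentralArrangement n 3}

theorem partialD_localSquare {X : A.Lattice} {a : Fin n} (ha : a ∉ A.labels X) {u : ExtAlg k n}
    (hu : u ∈ A.localSquare k X) : partialD a u = 0 := by
  rw [localSquare, extSquare, pow_two] at hu
  induction hu using Submodule.mul_induction_on' with
  | mem_mul_mem x hx y hy =>
    obtain ⟨v, hv, rfl⟩ := hx
    obtain ⟨w, hw, rfl⟩ := hy
    have h1 := contract_ι_mul (LinearMap.proj a) w (1 : ExtAlg k n)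
    rw [mul_one, ← map_one (algebraMap k (ExtAlg k n)), contract_algebraMap, mul_zero, sub_zero,
      LinearMap.proj_apply, hw.1 a ha, zero_smul] at h1
    rw [partialD, contract_ι_mul, h1, LinearMap.proj_apply, hv.1 a ha, zero_smul, mul_zero,
      sub_zero]
  | add x _ y _ hx hy => rw [map_add, hx, hy, add_zero]

theorem partialD_comm (a b : Fin n) (x : ExtAlg k n) :
    partialD a (partialD b x) = -partialD b (partialD a x) :=
  CliffordAlgebra.contractLeft_comm _ _ x

theorem partialD_partialD (a : Fin n) (x : ExtAlg k n) : partialD a (partialD a x) = 0 :=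
  CliffordAlgebra.contractLeft_contractLeft _ x

/-- Two distinct flats of rank two share at most one label, so that the coefficient of `e_a e_b`
sees only the flat spanned by `a` and `b`. -/
theorem sumIndep_localSquare : SumIndep fun X : A.rankTwo => A.localSquare k X.1 := by
  intro u hu h Y
  have key : ∀ a b, partialD b (partialD a (u Y)) = 0 := by
    intro a b
    by_cases ha : a ∈ A.labels Y.1
    swap
    · rw [partialD_localSquare ha (hu Y), map_zero]
    by_cases hb : b ∈ A.labels Y.1
    swap
    · rw [partialD_comm, partialD_localSquare hb (hu Y), map_zero, neg_zero]
    by_cases hab : a = b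
    · rw [hab, partialD_partialD]
    have h1 := congrArg (fun x => partialD b (partialD a x)) h
    simp only [map_sum, map_zero] at h1
    rw [← h1]
    symm
    refine Finset.sum_eq_single Y (fun X _ hXY => ?_) (by simp)
    by_cases ha' : a ∈ A.labels X.1
    swap
    · rw [partialD_localSquare ha' (hu X), map_zero]
    by_cases hb' : b ∈ A.labels X.1
    swap
    · rw [partialD_comm, partialD_localSquare hb' (hu X), map_zero, neg_zero]
    exact absurd (Subtype.ext ((flat_pair_eq X.2 hab ha' hb').symm.trans
      (flat_pair_eq Y.2 hab ha hb))) hXY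
  have h2 : u Y ∈ ⋀[k]^(1 + 1) (Fin n → k) := localSquare_le_power Y.1 (hu Y)
  exact eq_zero_of_partialD_eq_zero h2 fun a =>
    eq_zero_of_partialD_eq_zero (d := 0) (contract_mem _ h2) fun b => key a b

instance (X : A.Lattice) : Module.Finite k (A.localSquare k X) :=
  Submodule.finiteDimensional_of_le (localSquare_le_power X)

variable (A) in
/-- The Möbius number of a flat of rank two, as a natural number. -/
def rankTwoMobius (X : A.Lattice) : ℕ := (A.labels X).card - 1

theorem mobius_eq_rankTwoMobius {X : A.Lattice} (hX : X ∈ A.rankTwo) :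
    A.mobius X = A.rankTwoMobius X := by
  have := (labels_nonempty hX).card_pos
  rw [mobius_rankTwo hX, rankTwoMobius]
  omega

theorem finrank_cycles_localSquare {X : A.Lattice} (hX : X ∈ A.rankTwo) (p : ℕ) :
    Module.finrank k (cycles (n := n) (A.localSquare k X) p) =
      (p + 1) * (A.rankTwoMobius X + p).choose (p + 2) := by
  have h := finrank_sumZero (k := k) (labels_nonempty hX)
  rw [localSquare, finrank_cycles_extSquare, rankTwoMobius, ← h, Nat.add_sub_cancel]

theorem finrank_localSquare {X : A.Lattice} (hX : X ∈ A.rankTwo) :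
    Module.finrank k (A.localSquare k X) = (A.rankTwoMobius X).choose 2 := by
  have h := finrank_cycles_localSquare (k := k) hX 0
  rwa [cycles_zero, finrank_chains, Nat.choose_zero_right, one_mul, zero_add, one_mul, add_zero]
    at h

variable (A) in
/-- The dimension of the quadratic part of the Orlik–Solomon ideal. -/
def quadDim : ℕ := ∑ X ∈ A.rankTwo, (A.rankTwoMobius X).choose 2

theorem finrank_idealGr_two : Module.finrank k (idealGr (A.osIdeal k) 2) = A.quadDim := by
  rw [idealGr_two, localSum, sumIndep_localSquare.finrank_iSup, quadDim, ← Finset.sum_coe_sort A.rankTwo]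
  exact Finset.sum_congr rfl fun X _ => finrank_localSquare X.2

/-- The dimensions of all spaces of cycles with values in the quadratic part of the ideal are
forced by the one in degree one, when that is as small as possible. -/
theorem finrank_cycles_idealGr_two
    (h1 : Module.finrank k (cycles (n := n) (idealGr (A.osIdeal k) 2) 1) =
      ∑ X ∈ A.rankTwo, 2 * (A.rankTwoMobius X + 1).choose 3) (p : ℕ) :
    Module.finrank k (cycles (n := n) (idealGr (A.osIdeal k) 2) p) =
      ∑ X ∈ A.rankTwo, (p + 1) * (A.rankTwoMobius X + p).choose (p + 2) := by
  rw [idealGr_two, localSum] at h1 ⊢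
  rw [finrank_cycles_iSup sumIndep_localSquare ?_ p, ← Finset.sum_coe_sort A.rankTwo]
  · exact Finset.sum_congr rfl fun X _ => finrank_cycles_localSquare X.2 p
  · rw [h1, ← Finset.sum_coe_sort A.rankTwo]
    exact Finset.sum_congr rfl fun X _ => (finrank_cycles_localSquare X.2 1).symm

/-! ### The boundary complex and the cubic part of the ideal -/

theorem boundary_gen_mul_of_boundary_eq_zero (a : Fin n) {x : ExtAlg k n}
    (hx : boundary k n x = 0) : boundary k n (gen k n a * x) = x := by
  rw [boundary_gen_mul, hx, mul_zero, sub_zero]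

/-- Rank and nullity for the boundary map on a graded subspace that is stable under it and under
multiplication by a generator, which is a contracting homotopy. -/
theorem finrank_boundary {P : ℕ → Submodule k (ExtAlg k n)} [∀ j, Module.Finite k (P j)]
    (a : Fin n) (hP : ∀ j, ∀ x ∈ P j, gen k n a * x ∈ P (j + 1))
    (hB : ∀ j, ∀ x ∈ P (j + 1), boundary k n x ∈ P j) (j : ℕ) :
    Module.finrank k (P (j + 1)) =
      Module.finrank k ↥(P j ⊓ LinearMap.ker (boundary k n)) +
        Module.finrank k ↥(P (j + 1) ⊓ LinearMap.ker (boundary k n)) := by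
  let f := (boundary k n).domRestrict (P (j + 1))
  rw [← LinearMap.finrank_range_add_finrank_ker f]
  congr 1
  · suffices h : LinearMap.range f = P j ⊓ LinearMap.ker (boundary k n) by rw [h]
    rw [LinearMap.range_domRestrict]
    refine le_antisymm ?_ fun x hx => ?_
    · rintro _ ⟨x, hx, rfl⟩
      exact ⟨hB j x hx, boundary_boundary x⟩
    · exact ⟨_, hP j x hx.1, boundary_gen_mul_of_boundary_eq_zero a hx.2⟩
  · rw [← Submodule.map_comap_subtype, finrank_map_of_injOn]
    · rfl
    · exact fun x _ hx => Subtype.ext hx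

theorem finrank_power_ker_boundary (m j : ℕ) :
    Module.finrank k ↥(⋀[k]^j (Fin (m + 1) → k) ⊓ LinearMap.ker (boundary k (m + 1))) =
      m.choose j := by
  have h := finrank_boundary (k := k) (P := fun j => ⋀[k]^j (Fin (m + 1) → k)) 0
    (fun j x hx => gen_mul_mem 0 hx) (fun j x hx => boundary_mem hx)
  induction j with
  | zero =>
    have : ⋀[k]^0 (Fin (m + 1) → k) ⊓ LinearMap.ker (boundary k (m + 1)) =
        ⋀[k]^0 (Fin (m + 1) → k) :=
      inf_eq_left.2 fun x hx => contract_eq_zero_of_mem_zero _ hx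
    rw [this, finrank_power, Nat.choose_zero_right, Nat.choose_zero_right]
  | succ j ih =>
    have h1 := h j
    rw [ih, finrank_power, Nat.choose_succ_succ] at h1
    exact (Nat.add_left_cancel h1).symm

/-- The boundary complexes of the ideal and of the exterior algebra are both exact, which leaves the
cubic part as the only unknown in an alternating sum of dimensions. -/
theorem finrank_idealGr_three {m : ℕ} {A : CentralArrangement (m + 1) 3} :
    Module.finrank k (idealGr (A.osIdeal k) 3) = m.choose 3 + A.quadDim := by
  have hI := finrank_boundary (k := k) (P := idealGr (A.osIdeal k)) 0
    (fun j x hx => ⟨gen_mul_mem 0 hx.1, (A.osIdeal k).mul_mem_left _ hx.2⟩)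
    (fun j x hx => ⟨boundary_mem hx.1, boundary_mem_osIdeal hx.2⟩)
  have h2 := hI 1
  have h3 := hI 2
  have h4 := hI 3
  rw [idealGr_of_le_one le_rfl, bot_inf_eq, finrank_bot, zero_add] at h2
  rw [idealGr_of_four_le (j := 3 + 1) (by omega), finrank_power_ker_boundary, finrank_power,
    Nat.choose_succ_succ, Nat.add_right_cancel_iff] at h4
  rw [← h2, ← h4, finrank_idealGr_two] at h3
  rw [h3, add_comm]

/-! ### Regularity of the Orlik–Solomon algebra -/

theorem quotGrading_eq_bot {j : ℕ} (hj : 4 ≤ j) : quotGrading (A.osIdeal k) j = ⊥ := by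
  rw [Submodule.eq_bot_iff]
  rintro _ ⟨x, hx, rfl⟩
  exact (Submodule.Quotient.mk_eq_zero _).2 (power_le_osIdeal hj hx)

/-- In top degree, every generator `e_a` inverts the boundary map. -/
theorem mkQ_gen_mul_boundary (a : Fin n) {x : ExtAlg k n} (hx : x ∈ ⋀[k]^3 (Fin n → k)) :
    gen k n a • (A.osIdeal k).mkQ (boundary k n x) = (A.osIdeal k).mkQ x := by
  have h1 : boundary k n (gen k n a * x) ∈ A.osIdeal k :=
    boundary_mem_osIdeal (power_le_osIdeal le_rfl (gen_mul_mem a hx))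
  rw [boundary_gen_mul] at h1
  rw [← map_smul, smul_eq_mul]
  exact ((Submodule.Quotient.eq _).2 h1).symm

/-- The Cartan differential onto the chains with values in the top degree is surjective: up to
terms with a larger exponent of a fixed index, a preimage is given by the boundary map. -/
theorem exists_cartanD_eq_of_top (a₀ : Fin n) {p : ℕ} (N : ℕ)
    {z : (Fin n →₀ ℕ) → A.OSAlgebra k} (hz : z ∈ chains (quotGrading (A.osIdeal k) 3) p)
    (hN : ∀ α, α a₀ + N ≤ p → z α = 0) :
    ∃ y ∈ chains (n := n) (quotGrading (A.osIdeal k) 2) (p + 1), cartanD k y = z := by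
  induction N generalizing z with
  | zero =>
    have : z = 0 := by
      funext α
      by_cases h : α.degree = p
      · exact hN α (h ▸ Finsupp.le_degree a₀ α)
      · exact (hz α).2 h
    exact ⟨0, Submodule.zero_mem _, by rw [this, map_zero]⟩
  | succ N ih =>
    have hlift : ∀ α, ∃ x ∈ ⋀[k]^3 (Fin n → k), (A.osIdeal k).mkQ x = z α := fun α => (hz α).1
    choose x hx hxz using hlift
    let y : (Fin n →₀ ℕ) → A.OSAlgebra k := fun α =>
      if α a₀ ≠ 0 ∧ α.degree = p + 1 then
        (A.osIdeal k).mkQ (boundary k n (x (α - Finsupp.single a₀ 1))) else 0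
    have hy : y ∈ chains (quotGrading (A.osIdeal k) 2) (p + 1) := by
      intro α
      dsimp only [y]
      split_ifs with h
      · exact ⟨⟨_, boundary_mem (hx _), rfl⟩, fun h' => absurd h.2 h'⟩
      · exact ⟨Submodule.zero_mem _, fun _ => rfl⟩
    have hyv : ∀ β a, gen k n a • y (β + Finsupp.single a 1) =
        if (β + Finsupp.single a 1 : Fin n →₀ ℕ) a₀ ≠ 0 ∧ β.degree = p then
          z (β + Finsupp.single a 1 - Finsupp.single a₀ 1) else 0 := by
      intro β a
      dsimp only [y]
      rw [degree_add_single]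
      by_cases h : (β + Finsupp.single a 1 : Fin n →₀ ℕ) a₀ ≠ 0 ∧ β.degree = p
      · rw [if_pos h, if_pos ⟨h.1, by rw [h.2]⟩, mkQ_gen_mul_boundary a (hx _), hxz]
      · rw [if_neg h, if_neg fun h' => h ⟨h'.1, by omega⟩, smul_zero]
    have hz' : z - cartanD k y ∈ chains (quotGrading (A.osIdeal k) 3) p := by
      refine Submodule.sub_mem _ hz (cartanD_mem_chains hy ?_)
      rintro a _ ⟨u, hu, rfl⟩
      exact ⟨gen k n a * u, gen_mul_mem a hu, rfl⟩
    have hN' : ∀ β, β a₀ + N ≤ p → (z - cartanD k y) β = 0 := by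
      intro β hβ
      rw [Pi.sub_apply]
      by_cases hd : β.degree = p
      swap
      · exact (hz' β).2 hd
      rw [cartanD_apply, Finset.sum_eq_single a₀, hyv, if_pos ⟨by simp, hd⟩, add_tsub_cancel_right,
        sub_self]
      · intro a _ ha
        rw [hyv]
        split_ifs with h
        · have h1 : (β + Finsupp.single a 1 : Fin n →₀ ℕ) a₀ = β a₀ := by
            rw [Finsupp.add_apply, Finsupp.single_eq_of_ne (Ne.symm ha), add_zero]
          rw [h1] at h
          refine hN _ ?_
          rw [Finsupp.tsub_apply, h1, Finsupp.single_eq_same]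
          have := h.1
          omega
        · rfl
      · simp
    obtain ⟨w, hw, e⟩ := ih hz' hN'
    exact ⟨y + w, Submodule.add_mem _ hy hw, by rw [map_add, e, add_sub_cancel]⟩

theorem cartanExact_quotGrading (p d : ℕ) (hd : 2 ≤ d) :
    CartanExact (n := n) (quotGrading (A.osIdeal k)) p d := by
  intro x hx
  rcases Nat.lt_or_ge 2 d with h | h
  · rw [quotGrading_eq_bot (by omega)] at hx
    have : x = 0 := funext fun α => (Submodule.mem_bot k).1 (hx.1 α).1
    exact ⟨0, Submodule.zero_mem _, by rw [this, map_zero]⟩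
  · obtain rfl : d = 2 := le_antisymm h hd
    rcases n with _ | m
    · have : x = 0 := by
        funext α
        obtain ⟨u, hu, e⟩ := (hx.1 α).1
        obtain ⟨y, -, hy⟩ := exists_gen_mul_of_mem_succ hu
        rw [← e, hy, Finset.univ_eq_empty, Finset.sum_empty, map_zero]
        rfl
      exact ⟨0, Submodule.zero_mem _, by rw [this, map_zero]⟩
    · exact exists_cartanD_eq_of_top 0 (p + 1) hx.1 fun α hα => absurd hα (by omega)

end CentralArrangement

/-! ### Euler characteristics -/

section Series

open PowerSeries

/-- The inverse of `(1 + X) ^ N` as a power series. -/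
def invOneAddPow (N : ℕ) : PowerSeries ℤ := rescale (-1 : ℤ) (invOneSubPow ℤ N).val

theorem one_add_pow_mul_inv (N : ℕ) : (1 + X : PowerSeries ℤ) ^ N * invOneAddPow N = 1 := by
  have h : (1 - X : PowerSeries ℤ) ^ N * (invOneSubPow ℤ N).val = 1 := by
    rw [← invOneSubPow_inv_eq_one_sub_pow]
    exact (invOneSubPow ℤ N).inv_val
  have h2 := congrArg (rescale (-1 : ℤ)) h
  rw [map_mul, map_pow, map_sub, map_one, rescale_X, map_neg, map_one, neg_one_mul,
    sub_neg_eq_add] at h2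
  exact h2

theorem coeff_invOneAddPow (N j : ℕ) :
    coeff j (invOneAddPow N) = (-1) ^ j * ((N + j - 1).choose j : ℤ) := by
  rw [invOneAddPow, coeff_rescale]
  congr 1
  rcases N with _ | N
  · rw [invOneSubPow_zero, Units.val_one, coeff_one]
    rcases j with _ | j
    · simp
    · rw [if_neg (by omega), Nat.choose_eq_zero_of_lt (by omega)]
      rfl
  · rw [invOneSubPow_val_succ_eq_mk_add_choose, coeff_mk, Nat.succ_add_sub_one, ← Nat.choose_symm_add]

theorem coeff_one_add_pow (N j : ℕ) : coeff j ((1 + X : PowerSeries ℤ) ^ N) = (N.choose j : ℤ) := by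
  rw [show (1 + X : PowerSeries ℤ) ^ N = ((1 + Polynomial.X : Polynomial ℤ) ^ N : Polynomial ℤ) by
    simp, Polynomial.coeff_coe, add_comm, Polynomial.coeff_X_add_one_pow]

/-- Telescoping of `B l = Z l + Z (l + 1)`. -/
theorem alternating_sum {V : Type*} [AddCommGroup V] {B Z : ℕ → V} (h : ∀ l, B l = Z l + Z (l + 1))
    (m : ℕ) : Z 0 = ∑ l ∈ Finset.range m, (-1 : ℤ) ^ l • B l + (-1 : ℤ) ^ m • Z m := by
  induction m with
  | zero => simp
  | succ m ih =>
    rw [Finset.sum_range_succ, h m, pow_succ, smul_add, mul_neg_one, neg_smul]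
    conv_lhs => rw [ih]
    abel

theorem choose_identity (N i : ℕ) :
    ((N + (i + 3) - 1).choose (i + 3) : ℤ) - N * ((N + (i + 2) - 1).choose (i + 2) : ℤ)
      + (N.choose 2 : ℤ) * ((N + (i + 1) - 1).choose (i + 1) : ℤ) =
    ((i + 2).choose 2 : ℤ) * ((N + i).choose (i + 3) : ℤ) := by
  rcases N with _ | M
  · rw [Nat.choose_eq_zero_of_lt (show 0 + (i + 3) - 1 < i + 3 by omega),
      Nat.choose_eq_zero_of_lt (show 0 + (i + 2) - 1 < i + 2 by omega),
      Nat.choose_eq_zero_of_lt (show 0 + (i + 1) - 1 < i + 1 by omega),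
      Nat.choose_eq_zero_of_lt (show 0 + i < i + 3 by omega)]
    simp
  · rw [show M + 1 + (i + 3) - 1 = M + (i + 1) + 1 + 1 by omega,
      show M + 1 + (i + 2) - 1 = M + (i + 1) + 1 by omega,
      show M + 1 + (i + 1) - 1 = M + (i + 1) by omega,
      show M + 1 + i = M + (i + 1) by omega]
    have e1 := Nat.add_one_mul_choose_eq (M + (i + 1)) (i + 1)
    have e2 := Nat.add_one_mul_choose_eq (M + (i + 1) + 1) (i + 2)
    have e3 := Nat.choose_succ_right_eq (M + (i + 1)) (i + 1)
    have e4 := Nat.choose_succ_right_eq (M + (i + 1)) (i + 2)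
    have e5 := Nat.add_one_mul_choose_eq M 1
    have e6 := Nat.add_one_mul_choose_eq (i + 1) 1
    rw [Nat.choose_one_right] at e5 e6
    rw [Nat.add_sub_cancel] at e3
    have e4' : ((M + (i + 1)).choose (i + 3) : ℤ) * (i + 3) =
        ((M + (i + 1)).choose (i + 2) : ℤ) * (M - 1) := by
      rcases M with _ | M
      · rw [Nat.choose_eq_zero_of_lt (show 0 + (i + 1) < i + 3 by omega),
          Nat.choose_eq_zero_of_lt (show 0 + (i + 1) < i + 2 by omega)]
        simp
      · rw [show M + 1 + (i + 1) - (i + 2) = M by omega] at e4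
        have := congrArg (Nat.cast : ℕ → ℤ) e4
        push_cast at this ⊢
        linear_combination this
    have d1 := congrArg (Nat.cast : ℕ → ℤ) e1
    have d2 := congrArg (Nat.cast : ℕ → ℤ) e2
    have d3 := congrArg (Nat.cast : ℕ → ℤ) e3
    have d5 := congrArg (Nat.cast : ℕ → ℤ) e5
    have d6 := congrArg (Nat.cast : ℕ → ℤ) e6
    push_cast at d1 d2 d3 d5 d6 ⊢
    rw [show i + 1 + 1 = i + 2 from rfl] at *
    rw [show i + 2 + 1 = i + 3 from rfl] at *
    generalize ((M + (i + 1)).choose (i + 1) : ℤ) = t at *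
    generalize ((M + (i + 1) + 1).choose (i + 2) : ℤ) = t1 at *
    generalize ((M + (i + 1) + 1 + 1).choose (i + 3) : ℤ) = t2 at *
    generalize ((M + (i + 1)).choose (i + 2) : ℤ) = s1 at *
    generalize ((M + (i + 1)).choose (i + 3) : ℤ) = s2 at *
    generalize ((M + 1).choose 2 : ℤ) = c at *
    generalize ((i + 2).choose 2 : ℤ) = c' at *
    have hne : (2 * (i + 2) * (i + 3) : ℤ) ≠ 0 := by positivity
    apply mul_left_cancel₀ hne
    linear_combination (-2 * (i + 2) : ℤ) * d2 + (-2 * (M + i + 3) + 2 * (M + 1) * (i + 3)) * d1 -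
      (i + 2) * (i + 3) * t * d5 + (i + 2) * (i + 3) * s2 * d6 - (i + 2) * (i + 1) * (i + 2) * e4' -
      (i + 2) * (i + 1) * (M - 1) * d3

end Series

/-! ### Hilbert series of the resolution -/

namespace MinimalFreeResolution

open PowerSeries

variable {k : Type*} [Field k] {n : ℕ} {I : Ideal (ExtAlg k n)}
  (F : MinimalFreeResolution k n (ExtAlg k n ⧸ I) (quotGrading I))

/-- The Hilbert series of a free module is that of its generators times `(1 + X) ^ n`. -/
theorem bettiSeries_mul (i : ℕ) :
    PowerSeries.mk (fun j => (F.betti i j : ℤ)) * (1 + X) ^ n =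
      PowerSeries.mk fun j => (Module.finrank k (freeGr (k := k) (n := n) (F.deg i) j) : ℤ) := by
  have h : PowerSeries.mk (fun j => (F.betti i j : ℤ)) = ∑ t, (X : PowerSeries ℤ) ^ F.deg i t := by
    ext j
    rw [coeff_mk, map_sum, betti, Finset.card_filter, Nat.cast_sum]
    refine Finset.sum_congr rfl fun t _ => ?_
    rw [coeff_X_pow, Nat.cast_ite, Nat.cast_one, Nat.cast_zero]
    exact if_congr eq_comm rfl rfl
  ext j
  rw [h, Finset.sum_mul, map_sum, coeff_mk, finrank_freeGr, Nat.cast_sum]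
  refine Finset.sum_congr rfl fun t _ => ?_
  rw [coeff_X_pow_mul', coeff_one_add_pow, Nat.cast_ite, Nat.cast_zero]

/-- When the resolution has only two strands, the difference of the Betti numbers on an
antidiagonal is a coefficient of the Hilbert series of the ideal divided by `(1 + X) ^ n`. -/
theorem betti_sub_betti (hI : ∀ x ∈ I, ∀ j, ExtAlg.component j x ∈ I)
    (hlow : ∀ x ∈ I, ∀ j ≤ 1, x ∈ ⋀[k]^j (Fin n → k) → x = 0)
    (hA : ∀ p d, 2 ≤ d → CartanExact (n := n) (quotGrading I) p d) (i : ℕ) :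
    (F.betti (i + 1) (i + 3) : ℤ) - F.betti (i + 2) (i + 3) =
      (-1) ^ i * coeff (i + 3) (PowerSeries.mk (fun j => (Module.finrank k (idealGr I j) : ℤ)) *
        invOneAddPow n) := by
  let Z : ℕ → PowerSeries ℤ := fun l =>
    PowerSeries.mk fun j => (Module.finrank k ↥(freeGr (F.deg l) j ⊓ rangeK (F.d l)) : ℤ)
  let B : ℕ → PowerSeries ℤ := fun l => PowerSeries.mk (fun j => (F.betti (l + 1) j : ℤ)) * (1 + X) ^ n
  have hB : ∀ l, B l = Z l + Z (l + 1) := by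
    intro l
    ext j
    rw [map_add]
    simp only [B, Z]
    rw [bettiSeries_mul, coeff_mk, coeff_mk, coeff_mk, F.finrank_freeGr_succ, Nat.cast_add]
  have hZ0 : Z 0 = PowerSeries.mk (fun j => (Module.finrank k (idealGr I j) : ℤ)) := by
    ext j
    rw [coeff_mk, coeff_mk, F.finrank_range_zero hI hlow]
  have hBR : ∀ l, coeff (i + 3) (B l * invOneAddPow n) = F.betti (l + 1) (i + 3) := by
    intro l
    rw [mul_assoc, one_add_pow_mul_inv, mul_one, coeff_mk]
  -- The remainder `Z (i + 3)` lives in degrees at least `i + 4`.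
  have hZR : coeff (i + 3) (Z (i + 3) * invOneAddPow n) = 0 := by
    rw [coeff_mul]
    refine Finset.sum_eq_zero fun p hp => ?_
    have hp' := Finset.HasAntidiagonal.mem_antidiagonal.1 hp
    have : freeGr (k := k) (n := n) (F.deg (i + 3)) p.1 = ⊥ :=
      freeGr_eq_bot fun t => by
        have : i + 4 ≤ F.deg (i + 3) t := F.le_deg hI hlow (i + 2) t
        omega
    rw [coeff_mk, this, bot_inf_eq, finrank_bot, Nat.cast_zero, zero_mul]
  have key := congrArg (fun f => coeff (i + 3) (f * invOneAddPow n)) (alternating_sum hB (i + 3))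
  simp only [add_mul, Finset.sum_mul, map_add, map_sum, smul_mul_assoc, map_zsmul, hBR, hZR,
    smul_zero, add_zero] at key
  rw [Finset.sum_range_succ, Finset.sum_range_succ, Finset.sum_range_succ, Finset.sum_eq_zero,
    F.betti_eq_zero (i := i + 2 + 1) fun t => by have := F.le_deg hI hlow (i + 2) t; omega] at key
  · rw [← hZ0, key]
    have hs : ((-1) ^ i * (-1) ^ i : ℤ) = 1 := by rw [← mul_pow, neg_one_mul, neg_neg, one_pow]
    simp only [Nat.cast_zero, smul_eq_mul]
    linear_combination ((F.betti (i + 2) (i + 3) : ℤ) - F.betti (i + 1) (i + 3)) * hs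
  · intro l hl
    have hl' := Finset.mem_range.1 hl
    rw [F.betti_eq_zero fun t => by have := F.deg_le hI hA l t; omega, Nat.cast_zero, smul_zero]

end MinimalFreeResolution

/-! ### Betti numbers of the Orlik–Solomon algebra -/

namespace CentralArrangement

open PowerSeries

variable {k : Type*} [Field k] {n : ℕ} {A : CentralArrangement n 3}

theorem one_add_mul_invOneAddPow_succ (N : ℕ) :
    (1 + X) * invOneAddPow (N + 1) = invOneAddPow N := by
  have h1 := one_add_pow_mul_inv N
  have h2 := one_add_pow_mul_inv (N + 1)
  rw [pow_succ] at h2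
  linear_combination invOneAddPow N * h2 - (1 + X) * invOneAddPow (N + 1) * h1

/-- The Hilbert series of the ideal, `(1 + t) ^ n - (1 + t) (1 + (n - 1) t + b t ^ 2)` for a
suitable `b`. -/
theorem hilbertSeries_osIdeal {N : ℕ} (A : CentralArrangement (N + 1) 3) :
    PowerSeries.mk (fun j => (Module.finrank k (idealGr (A.osIdeal k) j) : ℤ)) =
      (1 + X) ^ (N + 1) -
        (1 + X) * (1 + C (N : ℤ) * X + C ((N.choose 2 : ℤ) - A.quadDim) * X ^ 2) := by
  have e : (1 + X : PowerSeries ℤ) * (1 + C (N : ℤ) * X + C ((N.choose 2 : ℤ) - A.quadDim) * X ^ 2) =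
      C 1 * X ^ 0 + C ((N : ℤ) + 1) * X ^ 1 + C ((N : ℤ) + N.choose 2 - A.quadDim) * X ^ 2 +
        C ((N.choose 2 : ℤ) - A.quadDim) * X ^ 3 := by
    simp only [map_add, map_sub, map_one]
    ring
  rw [e]
  ext j
  rw [coeff_mk, map_sub, map_add, map_add, map_add, coeff_one_add_pow, coeff_C_mul_X_pow,
    coeff_C_mul_X_pow, coeff_C_mul_X_pow, coeff_C_mul_X_pow]
  rcases j with _ | _ | _ | _ | j
  · rw [idealGr_of_le_one (by omega), finrank_bot]
    simp
  · rw [idealGr_of_le_one (by omega), finrank_bot]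
    simp
  · rw [finrank_idealGr_two]
    simp [Nat.choose_succ_succ]
  · rw [finrank_idealGr_three]
    simp [Nat.choose_succ_succ N 2]
  · rw [idealGr_of_four_le (by omega), ExtAlg.finrank_power]
    simp

theorem coeff_hilbertSeries_osIdeal (A : CentralArrangement n 3) (i : ℕ) :
    (-1) ^ i * coeff (i + 3) (PowerSeries.mk (fun j => (Module.finrank k (idealGr (A.osIdeal k) j) : ℤ)) *
        invOneAddPow n) =
      ((i + 2).choose 2 : ℤ) * ((n + i - 1).choose (i + 3) : ℤ) -
        ((n + i - 1).choose (i + 1) : ℤ) * A.quadDim := by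
  rcases n with _ | N
  · have h : PowerSeries.mk (fun j => (Module.finrank k (idealGr (A.osIdeal k) j) : ℤ)) = 0 := by
      ext j
      rcases Nat.lt_or_ge 1 j with hj | hj
      · have : idealGr (A.osIdeal k) j ≤ ⋀[k]^j (Fin 0 → k) := inf_le_left
        have h2 := Submodule.finrank_mono this
        rw [ExtAlg.finrank_power, Nat.choose_eq_zero_of_lt (by omega)] at h2
        rw [coeff_mk, Nat.le_zero.1 h2]
        rfl
      · rw [coeff_mk, idealGr_of_le_one hj, finrank_bot]
        rfl
    rw [h, Nat.choose_eq_zero_of_lt (show 0 + i - 1 < i + 3 by omega),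
      Nat.choose_eq_zero_of_lt (show 0 + i - 1 < i + 1 by omega)]
    simp
  · have hm := choose_identity N i
    have e : (PowerSeries.mk (fun j => (Module.finrank k (idealGr (A.osIdeal k) j) : ℤ))) *
        invOneAddPow (N + 1) = 1 - (invOneAddPow N + C (N : ℤ) * (X ^ 1 * invOneAddPow N) +
          C ((N.choose 2 : ℤ) - A.quadDim) * (X ^ 2 * invOneAddPow N)) := by
      have h1 := one_add_pow_mul_inv (N + 1)
      have h2 := one_add_mul_invOneAddPow_succ N
      rw [hilbertSeries_osIdeal]
      linear_combination h1 - (1 + C (N : ℤ) * X + C ((N.choose 2 : ℤ) - A.quadDim) * X ^ 2) * h2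
    rw [e]
    rw [map_sub, map_add, map_add, coeff_C_mul, coeff_C_mul, coeff_X_pow_mul', coeff_X_pow_mul',
      coeff_one, coeff_invOneAddPow, coeff_invOneAddPow, coeff_invOneAddPow,
      if_neg (by omega), if_pos (by omega), if_pos (by omega),
      show i + 3 - 1 = i + 2 from rfl, show i + 3 - 2 = i + 1 from rfl,
      show N + 1 + i - 1 = N + i by omega]
    have hs : ((-1) ^ i * (-1) ^ i : ℤ) = 1 := by rw [← mul_pow, neg_one_mul, neg_neg, one_pow]
    rw [show N + (i + 1) - 1 = N + i by omega] at *
    rw [← hm]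
    linear_combination (((N + (i + 3) - 1).choose (i + 3) : ℤ) -
      N * ((N + (i + 2) - 1).choose (i + 2) : ℤ) +
      ((N.choose 2 : ℤ) - A.quadDim) * ((N + i).choose (i + 1) : ℤ)) * hs

end CentralArrangement

/-! ### Existence of minimal graded free resolutions -/

section Existence

open ExtAlg ExteriorAlgebra

variable {k : Type*} [Field k] {n : ℕ}

theorem ExtAlg.moduleFinite : Module.Finite k (ExtAlg k n) := by
  refine Module.finite_def.2 ?_
  have h : (⊤ : Submodule k (ExtAlg k n)) = ⨆ j : Fin (n + 1), ⋀[k]^(j : ℕ) (Fin n → k) := by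
    refine (eq_top_iff.2 fun x _ => ?_).symm
    induction x using induction_homogeneous with
    | h0 => exact Submodule.zero_mem _
    | hadd x y hx hy => exact Submodule.add_mem _ (hx trivial) (hy trivial)
    | hom j x hx =>
      by_cases hj : j < n + 1
      · exact Submodule.mem_iSup_of_mem (⟨j, hj⟩ : Fin (n + 1)) hx
      · have h0 := finrank_power (k := k) (n := n) j
        rw [Nat.choose_eq_zero_of_lt (by omega), Submodule.finrank_eq_zero] at h0
        rw [h0] at hx
        rw [(Submodule.mem_bot k).1 hx]
        exact Submodule.zero_mem _
  rw [h]
  exact Submodule.fg_iSup _ fun j => Module.Finite.iff_fg.1 inferInstance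

instance : IsNoetherianRing (ExtAlg k n) :=
  haveI : Module.Finite k (ExtAlg k n) := ExtAlg.moduleFinite
  isNoetherian_of_tower k inferInstance

theorem sum_freeProj {r : ℕ} (deg : Fin r → ℕ) (x : Fin r → ExtAlg k n) :
    ∃ D : ℕ, ∀ D' ≥ D, ∑ j ∈ Finset.range D', freeProj deg j x = x := by
  induction x using free_induction_homogeneous deg with
  | h0 => exact ⟨0, fun _ _ => Finset.sum_eq_zero fun _ _ => map_zero _⟩
  | hadd x y hx hy =>
    obtain ⟨D₁, h₁⟩ := hx
    obtain ⟨D₂, h₂⟩ := hy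
    refine ⟨max D₁ D₂, fun D' hD => ?_⟩
    simp only [map_add, Finset.sum_add_distrib]
    rw [h₁ D' (le_of_max_le_left hD), h₂ D' (le_of_max_le_right hD)]
  | hom j x hx =>
    refine ⟨j + 1, fun D' hD => ?_⟩
    rw [Finset.sum_eq_single j, freeProj_same hx]
    · exact fun i _ hij => freeProj_of_ne hx (Ne.symm hij)
    · exact fun h => absurd (Finset.mem_range.2 (by omega)) h

/-- A homogeneous submodule of a graded free module is generated by a finite irredundant set of
homogeneous elements. -/
theorem exists_irredundant_generators {r : ℕ} {deg : Fin r → ℕ}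
    {P : Submodule (ExtAlg k n) (Fin r → ExtAlg k n)} (hP : ∀ x ∈ P, ∀ j, freeProj deg j x ∈ P) :
    ∃ s : Finset (Fin r → ExtAlg k n), (∀ x ∈ s, ∃ j, x ∈ freeGr deg j) ∧
      Submodule.span (ExtAlg k n) (s : Set (Fin r → ExtAlg k n)) = P ∧
      ∀ v ∈ s, v ∉ Submodule.span (ExtAlg k n) ((s : Set (Fin r → ExtAlg k n)) \ {v}) := by
  classical
  let S : Set (Fin r → ExtAlg k n) := {x | x ∈ P ∧ ∃ j, x ∈ freeGr deg j}
  have hS : Submodule.span (ExtAlg k n) S = P := by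
    refine le_antisymm (Submodule.span_le.2 fun x hx => hx.1) fun x hx => ?_
    obtain ⟨D, hD⟩ := sum_freeProj deg x
    rw [← hD D le_rfl]
    exact Submodule.sum_mem _ fun j _ =>
      Submodule.subset_span ⟨hP x hx j, j, freeProj_mem deg j x⟩
  have hex : ∃ s : Finset (Fin r → ExtAlg k n), (∀ x ∈ s, ∃ j, x ∈ freeGr deg j) ∧
      Submodule.span (ExtAlg k n) (s : Set (Fin r → ExtAlg k n)) = P := by
    obtain ⟨s, hs, e⟩ := (Submodule.fg_span_iff_fg_span_finset_subset (R := ExtAlg k n) S).1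
      (IsNoetherian.noetherian _)
    exact ⟨s, fun x hx => (hs hx).2, by rw [← e, hS]⟩
  obtain ⟨s, ⟨hs1, hs2⟩, hmin⟩ := exists_minimal_of_wellFoundedLT _ hex
  refine ⟨s, hs1, hs2, fun v hv hv' => ?_⟩
  have h1 : Submodule.span (ExtAlg k n) ((s.erase v : Finset _) : Set (Fin r → ExtAlg k n)) = P := by
    rw [Finset.coe_erase, ← hs2]
    refine le_antisymm (Submodule.span_mono Set.sdiff_subset) (Submodule.span_le.2 fun x hx => ?_)
    by_cases h : x = v
    · exact h ▸ hv'
    · exact Submodule.subset_span ⟨hx, h⟩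
  exact Finset.notMem_erase v s
    (hmin ⟨fun x hx => hs1 x (Finset.mem_of_mem_erase hx), h1⟩ (Finset.erase_subset v s) hv)

/-- A homogeneous submodule of a graded free module is covered minimally by a graded free module:
a relation with an invertible coefficient would make a generator redundant. -/
theorem exists_minimal_cover {r : ℕ} {deg : Fin r → ℕ}
    {P : Submodule (ExtAlg k n) (Fin r → ExtAlg k n)} (hP : ∀ x ∈ P, ∀ j, freeProj deg j x ∈ P) :
    ∃ (r' : ℕ) (deg' : Fin r' → ℕ)
      (f : (Fin r' → ExtAlg k n) →ₗ[ExtAlg k n] (Fin r → ExtAlg k n)),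
      (∀ j, ∀ x ∈ freeComponent k n deg' j, f x ∈ freeComponent k n deg j) ∧
      LinearMap.range f = P ∧ ∀ x, f x = 0 → ∀ t, algebraMapInv (x t) = 0 := by
  obtain ⟨s, hs, hsP, hirr⟩ := exists_irredundant_generators hP
  let v : Fin s.card → Fin r → ExtAlg k n := fun t => s.equivFin.symm t
  have hv : ∀ t, v t ∈ s := fun t => (s.equivFin.symm t).2
  have hinj : Function.Injective v := Subtype.val_injective.comp s.equivFin.symm.injective
  have hrange : Set.range v = s := by
    ext x
    refine ⟨?_, fun hx => ⟨s.equivFin ⟨x, hx⟩, ?_⟩⟩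
    · rintro ⟨t, rfl⟩
      exact hv t
    · simp [v]
  choose deg' hdeg' using fun t => hs _ (hv t)
  let f := Fintype.linearCombination (ExtAlg k n) v
  have hf : ∀ j, ∀ x ∈ freeComponent k n deg' j, f x ∈ freeComponent k n deg j := by
    intro j x hx
    change f x ∈ freeGr deg j
    rw [Fintype.linearCombination_apply]
    refine Submodule.sum_mem _ fun t _ => ?_
    by_cases h : deg' t ≤ j
    · have := mul_smul_mem_freeGr ((hx t).1 h) (hdeg' t)
      rwa [Nat.sub_add_cancel h] at this
    · rw [(hx t).2 (by omega), zero_smul]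
      exact Submodule.zero_mem _
  refine ⟨s.card, deg', f, hf, by rw [Fintype.range_linearCombination, hrange, hsP],
    fun x hx t => ?_⟩
  by_contra hne
  set c := algebraMapInv (x t) with hc
  have h1 : f (freeProj deg' (deg' t) x) = 0 := by
    rw [map_freeProj (isGradingProj_free deg) f hf, hx, map_zero]
  have h2 : freeProj deg' (deg' t) x t = algebraMap k (ExtAlg k n) c := by
    rw [freeProj_apply, if_pos le_rfl, Nat.sub_self,
      eq_algebraMap_of_mem_zero (component_mem 0 (x t)), algebraMapInv_component_zero]
  rw [Fintype.linearCombination_apply, ← Finset.add_sum_erase _ _ (Finset.mem_univ t), h2,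
    algebraMap_smul] at h1
  have h3 : c • v t ∈ Submodule.span (ExtAlg k n) ((s : Set (Fin r → ExtAlg k n)) \ {v t}) := by
    rw [eq_neg_of_add_eq_zero_left h1]
    refine Submodule.neg_mem _ (Submodule.sum_mem _ fun u hu => Submodule.smul_mem _ _ ?_)
    exact Submodule.subset_span ⟨hv u, fun h => Finset.ne_of_mem_erase hu (hinj h)⟩
  refine hirr (v t) (hv t) ?_
  have h4 := Submodule.smul_of_tower_mem _ c⁻¹ h3
  rwa [smul_smul, inv_mul_cancel₀ hne, one_smul] at h4

/-- A homogeneous submodule of `E_+ F` for a graded free module `F`: the data from which a minimal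
resolution is continued. -/
structure RelationModule (k : Type*) [Field k] (n : ℕ) where
  rank : ℕ
  deg : Fin rank → ℕ
  toSubmodule : Submodule (ExtAlg k n) (Fin rank → ExtAlg k n)
  homogeneous : ∀ x ∈ toSubmodule, ∀ j, freeProj deg j x ∈ toSubmodule
  minimal : ∀ x ∈ toSubmodule, ∀ t, algebraMapInv (x t) = 0

namespace RelationModule

variable (P : RelationModule k n)

/-- The number of generators in a chosen minimal cover of a relation module. -/
def coverRank : ℕ := (exists_minimal_cover P.homogeneous).choose

/-- The degrees of the generators in the chosen minimal cover. -/
def coverDeg : Fin P.coverRank → ℕ := (exists_minimal_cover P.homogeneous).choose_spec.choose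

/-- The chosen minimal cover of a relation module by a graded free module. -/
def cover : (Fin P.coverRank → ExtAlg k n) →ₗ[ExtAlg k n] (Fin P.rank → ExtAlg k n) :=
  (exists_minimal_cover P.homogeneous).choose_spec.choose_spec.choose

theorem cover_spec :
    (∀ j, ∀ x ∈ freeComponent k n P.coverDeg j, P.cover x ∈ freeComponent k n P.deg j) ∧
      LinearMap.range P.cover = P.toSubmodule ∧
      ∀ x, P.cover x = 0 → ∀ t, algebraMapInv (x t) = 0 :=
  (exists_minimal_cover P.homogeneous).choose_spec.choose_spec.choose_spec

/-- The relations between the generators of a relation module. -/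
def syzygy : RelationModule k n where
  rank := P.coverRank
  deg := P.coverDeg
  toSubmodule := LinearMap.ker P.cover
  homogeneous x hx j := by
    rw [LinearMap.mem_ker, map_freeProj (isGradingProj_free P.deg) P.cover P.cover_spec.1,
      LinearMap.mem_ker.1 hx, map_zero]
  minimal := P.cover_spec.2.2


end RelationModule

/-- The identification of the free module of rank one with the exterior algebra. -/
def entryZero (k : Type*) [Field k] (n : ℕ) : (Fin 1 → ExtAlg k n) →ₗ[ExtAlg k n] ExtAlg k n :=
  LinearMap.proj 0

/-- A homogeneous ideal in positive degrees as a relation module of rank one. -/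
def RelationModule.ofIdeal (I : Ideal (ExtAlg k n)) (hI : ∀ x ∈ I, ∀ j, component j x ∈ I)
    (h0 : ∀ x ∈ I, algebraMapInv x = 0) : RelationModule k n where
  rank := 1
  deg _ := 0
  toSubmodule := Submodule.comap (entryZero k n) I
  homogeneous x hx j := by
    change freeProj (fun _ : Fin 1 => 0) j x 0 ∈ I
    rw [freeProj_apply, if_pos (Nat.zero_le j)]
    exact hI _ hx _
  minimal x hx t := by
    rw [Subsingleton.elim t 0]
    exact h0 _ hx

theorem nonempty_minimalFreeResolution {I : Ideal (ExtAlg k n)}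
    (hI : ∀ x ∈ I, ∀ j, component j x ∈ I) (h0 : ∀ x ∈ I, algebraMapInv x = 0) :
    Nonempty (MinimalFreeResolution k n (ExtAlg k n ⧸ I) (quotGrading I)) := by
  let P : ℕ → RelationModule k n := Nat.rec (RelationModule.ofIdeal I hI h0) fun _ Q => Q.syzygy
  refine ⟨{
    rank := fun i => (P i).rank
    deg := fun i => (P i).deg
    d := fun i => (P i).cover
    aug := I.mkQ ∘ₗ entryZero k n
    d_homogeneous := fun i => (P i).cover_spec.1
    aug_homogeneous := fun j x hx => ⟨x (0 : Fin 1), (hx (0 : Fin 1)).1 (Nat.zero_le j), rfl⟩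
    aug_surjective := ?_
    exact_aug := ?_
    exact_d := ?_
    minimal := ?_ }⟩
  · intro y
    obtain ⟨x, rfl⟩ := I.mkQ_surjective y
    exact ⟨fun _ => x, rfl⟩
  · intro x
    have h : LinearMap.range (P 0).cover = Submodule.comap (entryZero k n) I :=
      (P 0).cover_spec.2.1
    change I.mkQ (x (0 : Fin 1)) = 0 ↔ x ∈ LinearMap.range (P 0).cover
    rw [h, Submodule.mkQ_apply, Submodule.Quotient.mk_eq_zero]
    rfl
  · intro i x
    have h : LinearMap.range (P (i + 1)).cover = LinearMap.ker (P i).cover :=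
      (P (i + 1)).cover_spec.2.1
    change (P i).cover x = 0 ↔ x ∈ LinearMap.range (P (i + 1)).cover
    rw [h]
    rfl
  · intro i x t
    refine (P i).minimal _ ?_ t
    rw [← (P i).cover_spec.2.1]
    exact LinearMap.mem_range_self _ x

end Existence

/-! ### The graded Betti numbers -/

namespace CentralArrangement

variable {k : Type*} [Field k] {n : ℕ} {A : CentralArrangement n 3}

theorem algebraMapInv_of_mem_osIdeal {x : ExtAlg k n} (hx : x ∈ A.osIdeal k) :
    ExteriorAlgebra.algebraMapInv x = 0 := by
  rw [← ExtAlg.algebraMapInv_component_zero,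
    eq_zero_of_mem_osIdeal (component_mem_osIdeal hx 0) zero_le_one (ExtAlg.component_mem 0 x),
    map_zero]

theorem betti_linear_strand (F : A.OSResolution k) (i : ℕ) :
    F.betti (i + 1) (i + 2) =
      Module.finrank k (cycles (n := n) (idealGr (A.osIdeal k) 2) i) :=
  MinimalFreeResolution.betti_linear F (fun _ => component_mem_osIdeal)
    (fun _ hx _ => eq_zero_of_mem_osIdeal hx) i

/-- For an MLS arrangement the linear strand is the sum of the linear strands of the rank two
flats. -/
theorem IsMLS.betti_linear_strand (hA : A.IsMLS k) (F : A.OSResolution k) (i : ℕ) :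
    F.betti (i + 1) (i + 2) =
      ∑ X ∈ A.rankTwo, (i + 1) * (A.rankTwoMobius X + i).choose (i + 2) := by
  obtain ⟨F', hF'⟩ := hA
  rw [CentralArrangement.betti_linear_strand, finrank_cycles_idealGr_two]
  rw [CentralArrangement.betti_linear_strand, Finset.mul_sum] at hF'
  have h : ((∑ X ∈ A.rankTwo, 2 * (A.rankTwoMobius X + 1).choose 3 : ℕ) : ℤ) =
      ∑ X ∈ A.rankTwo, 2 * Ring.choose (A.mobius X + 1) 3 := by
    push_cast
    refine Finset.sum_congr rfl fun X hX => ?_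
    rw [mobius_eq_rankTwoMobius hX, ← Ring.choose_natCast (R := ℤ)]
    push_cast
    rfl
  rw [← h] at hF'
  exact_mod_cast hF'

theorem sum_choose_mobius_two :
    ∑ X ∈ A.rankTwo, Ring.choose (A.mobius X) 2 = (A.quadDim : ℤ) := by
  rw [quadDim, Nat.cast_sum]
  exact Finset.sum_congr rfl fun X hX => by
    rw [mobius_eq_rankTwoMobius hX, Ring.choose_natCast]

theorem betti_eq_zero_of_ne (F : A.OSResolution k) {i j : ℕ} (h1 : j ≠ i + 2) (h2 : j ≠ i + 3) :
    F.betti (i + 1) j = 0 := by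
  refine MinimalFreeResolution.betti_eq_zero F fun t => ?_
  have h3 := MinimalFreeResolution.le_deg F (fun _ => component_mem_osIdeal)
    (fun _ hx _ => eq_zero_of_mem_osIdeal hx) i t
  have h4 := MinimalFreeResolution.deg_le F (fun _ => component_mem_osIdeal)
    cartanExact_quotGrading i t
  omega

theorem betti_zero (F : A.OSResolution k) (j : ℕ) :
    F.betti 0 j = if j = 0 then 1 else 0 := by
  obtain ⟨t₀, h, hdeg, -⟩ := MinimalFreeResolution.exists_unique_basis_zero F
    (fun _ => component_mem_osIdeal) (fun _ hx _ => eq_zero_of_mem_osIdeal hx)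
  split_ifs with hj
  · refine Finset.card_eq_one.2 ⟨t₀, Finset.ext fun t => ?_⟩
    rw [h t, Finset.mem_filter_univ, Finset.mem_singleton, hj]
    exact iff_of_true hdeg rfl
  · refine MinimalFreeResolution.betti_eq_zero F fun t => ?_
    rw [h t, hdeg]
    exact Ne.symm hj

end CentralArrangement

open CentralArrangement in
theorem theorem2p4 (k : Type*) [Field k] (n : ℕ) (A : CentralArrangement n 3) :
    Nonempty (A.OSResolution k) ∧
    (A.IsMLS k → ∀ F : A.OSResolution k,
      (∀ i : ℕ, 1 ≤ i →
        (F.betti i (i + 1) : ℤ) =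
          i * ∑ X ∈ A.rankTwo, Ring.choose (A.mobius X + i - 1) (i + 1)) ∧
      (∀ i : ℕ, 1 ≤ i →
        (F.betti i (i + 2) : ℤ) =
          F.betti (i + 1) (i + 2)
            + ((i + 1).choose 2 : ℤ) * ((n + i - 2).choose (i + 2) : ℤ)
            - ((n + i - 2).choose i : ℤ) * ∑ X ∈ A.rankTwo, Ring.choose (A.mobius X) 2) ∧
      F.betti 0 0 = 1 ∧
      (∀ j : ℕ, j ≠ 0 → F.betti 0 j = 0) ∧
      (∀ i j : ℕ, 1 ≤ i → j ≠ i + 1 → j ≠ i + 2 → F.betti i j = 0)) := by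
  refine ⟨nonempty_minimalFreeResolution (fun _ => component_mem_osIdeal)
    fun _ => algebraMapInv_of_mem_osIdeal, fun hA F => ⟨?_, ?_, betti_zero F 0,
      fun j hj => (betti_zero F j).trans (if_neg hj), ?_⟩⟩
  · rintro (_ | i) hi
    · omega
    rw [hA.betti_linear_strand F i, Nat.cast_sum, Finset.mul_sum]
    refine Finset.sum_congr rfl fun X hX => ?_
    rw [mobius_eq_rankTwoMobius hX, Nat.cast_mul, ← Ring.choose_natCast (R := ℤ)]
    congr 2
    push_cast
    ring
  · rintro (_ | i) hi
    · omega
    have h : (F.betti (i + 1) (i + 1 + 2) : ℤ) - F.betti (i + 1 + 1) (i + 1 + 2) = _ :=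
      MinimalFreeResolution.betti_sub_betti F (fun _ => component_mem_osIdeal)
        (fun _ hx _ => eq_zero_of_mem_osIdeal hx) cartanExact_quotGrading i
    rw [coeff_hilbertSeries_osIdeal] at h
    rw [sum_choose_mobius_two, show n + (i + 1) - 2 = n + i - 1 by omega]
    linear_combination h
  · rintro (_ | i) j hi h1 h2
    · omega
    · exact betti_eq_zero_of_ne F h1 h2

end
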